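/- **Setting.** Consider a periodic chain of $N$ sites with local Hilbert space $\mathbb C^d$; for a one-site operator $A$ write $A_j$ for $A$ acting on site $j\in\mathbb Z/N$. Let $\tilde G$ be a group with a unitary representation $u:\tilde G\to U(d)$, acting on the chain by $\hat U_g=u(g)^{\otimes N}$. Let $\mathfrak k$ be the real span of the Hermitian matrices $A$ with $e^{i\theta A}\in u(\tilde G)$ for all $\theta\in\mathbb R$ (the local generators), $\mathfrak t\subset\mathfrak k$ a maximal commuting subspace (Cartan subalgebra), and call $q\neq 0$ in the complex span of $\mathfrak k$ a root vector of the root $\alpha\neq0$, $\alpha:\mathfrak t\to\mathbb R$ linear, if $[t,q]=\alpha(t)q$ for all $t\in\mathfrak t$. Fix $z\in\mathfrak t$ on which no root vanishes; root vectors with $\alpha(z)>0$ (resp. $\alpha(z)<0$) are called raising (resp. lowering) operators. Let the anchor $\psi_e\in\mathbb C^d$ be a unit extremal-weight vector: a common eigenvector of $\mathfrak t$ annihilated by all lowering operators. Put $|\Psi_e\rangle=\psi_e^{\otimes N}$ and $\mathcal H_{\tilde G}=\operatorname{span}\{\hat U_g|\Psi_e\rangle: g\in\tilde G\}$. Let $\hat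 H=\hat H_N=\sum_{l\in\mathbb Z/N}\hat h_l$, where $\hat h_l$ is the translate to the sites $l,\dots,l+m$ of one fixed Hermitian operator on $m+1$ sites, not depending on $N$. Assume that for all $N\ge N_1$ the Hamiltonian is degenerate on the quasisymmetry subspace: $\hat H_N\Psi=E_0(N)\Psi$ for all $\Psi\in\mathcal H_{\tilde G}$. For raising operators $q_\alpha,q_\beta,\dots,q_\lambda$ (any finite number, repetitions allowed) let $\hat Q_a=\sum_j (q_a)_j$ and let $$|\Psi_{M}\rangle=\hat Q_\lambda\cdots\hat Q_\beta\hat Q_\alpha|\Psi_e\rangle$$ be the tower state with label $M=(q_\lambda,\dots,q_\beta,q_\alpha)$. Fix a raising operator $q^+$ and put $$|k,M\rangle=\sum_{j=0}^{N-1}e^{ikj}q^+_j|\Psi_M\rangle,\qquad k\in\tfrac{2\pi}{N}\mathbb Z,\ k\notin2\pi\mathbb Z .$$ Whenever $|k,M\rangle\ne0$, write $E$ for the expectation of $\hat H$ in the normalised state $|k,M\rangle$, and set $\varepsilon_{N,M}(k)=E-E_0(N)$ and $\delta\varepsilon^2_{N,M}(k)=\langle(\hat H-E)^2\rangle$. **Statement.**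 1. For every fixed label $M$ there are continuous functions $\varepsilon,v:\mathbb R\to\mathbb R$ with $\varepsilon(k)\to0$ and $v(k)\to0$ as $k\to0$, such that $\varepsilon_{N,M}(k)\to\varepsilon(k)$ and $\delta\varepsilon^2_{N,M}(k)\to v(k)$ as $N\to\infty$, uniformly over all $k\in\frac{2\pi}{N}\mathbb Z\setminus2\pi\mathbb Z$ with $|k,M\rangle\neq0$. 2. For tower states whose label may depend on the size (e.g. at finite filling), the same holds uniformly: for every $\eta>0$ there are $\delta>0$ and $N_0$ such that for all $N\ge N_0$ and all labels $M$ of any length, (a) $|\varepsilon_{N,M}(k)-\varepsilon_{N,M}(k')|<\eta$ and $|\delta\varepsilon^2_{N,M}(k)-\delta\varepsilon^2_{N,M}(k')|<\eta$ whenever $|k-k'|<\delta$, and (b) $|\varepsilon_{N,M}(k)|<\eta$ and $|\delta\varepsilon^2_{N,M}(k)|<\eta$ whenever $|k|<\delta$; here $k,k'$ range over $\frac{2\pi}{N}\mathbb Z\setminus2\pi\mathbb Z$ with $|k,M\rangle,|k',M\rangle\ne0$. -/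

import Mathlib

open scoped Matrix

/-! ## Periodic chain of `N` sites with local space `ℂ^d`

The sites are `ZMod N`; a basis configuration is a map `ZMod N → Fin d`; the many-body space
`(ℂ^d)^{⊗N}` is the space of complex functions on configurations, and many-body operators are
matrices indexed by configurations. -/

namespace ScarTower

/-- Basis configurations of the chain. -/
abbrev Config (d N : ℕ) : Type := ZMod N → Fin d

/-- Many-body state vectors. -/
abbrev State (d N : ℕ) : Type := Config d N → ℂ

/-- Many-body operators. -/
abbrev Op (d N : ℕ) : Type := Matrix (Config d N) (Config d N) ℂ

section Chain

variable {d : ℕ} (N : ℕ) [NeZero N]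

/-- The product state `ψ ⊗ ⋯ ⊗ ψ`. -/
noncomputable def productState (ψ : Fin d → ℂ) : State d N :=
  fun σ => ∏ j, ψ (σ j)

/-- The onsite global action `A ⊗ ⋯ ⊗ A`. -/
noncomputable def onsiteAction (A : Matrix (Fin d) (Fin d) ℂ) : Op d N :=
  fun σ τ => ∏ j, A (σ j) (τ j)

/-- The one-site operator `A` acting on site `j` (and as the identity elsewhere). -/
noncomputable def siteOp (A : Matrix (Fin d) (Fin d) ℂ) (j : ZMod N) : Op d N :=
  fun σ τ => if ∀ i, i ≠ j → σ i = τ i then A (σ j) (τ j) else 0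

/-- The block operator `h` acting on the sites `l, l + 1, …, l + m` (and as the identity
elsewhere).  It has this meaning when `m + 1 ≤ N`. -/
noncomputable def blockOp {m : ℕ}
    (h : Matrix (Fin (m + 1) → Fin d) (Fin (m + 1) → Fin d) ℂ) (l : ZMod N) : Op d N :=
  fun σ τ =>
    if ∀ i, (∀ a : Fin (m + 1), i ≠ l + ((a : ℕ) : ZMod N)) → σ i = τ i then
      h (fun a => σ (l + ((a : ℕ) : ZMod N))) (fun a => τ (l + ((a : ℕ) : ZMod N)))
    else 0

/-- The translation invariant local Hamiltonian `H = ∑ₗ hₗ` with periodic boundary conditions. -/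
noncomputable def hamiltonian {m : ℕ}
    (h : Matrix (Fin (m + 1) → Fin d) (Fin (m + 1) → Fin d) ℂ) : Op d N :=
  ∑ l, blockOp N h l

/-- The collective operator `Q = ∑ⱼ qⱼ`. -/
noncomputable def collectiveOp (q : Matrix (Fin d) (Fin d) ℂ) : Op d N :=
  ∑ j, siteOp N q j

/-- The twisted collective operator `Q_k = ∑ⱼ e^{ikj} qⱼ`, the sites being numbered
`0, …, N - 1`. -/
noncomputable def twistedOp (k : ℝ) (q : Matrix (Fin d) (Fin d) ℂ) : Op d N :=
  ∑ j : ZMod N, Complex.exp (Complex.I * k * (j.val : ℂ)) • siteOp N q j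

/-- For a list `[q_λ, …, q_β, q_α]`, the tower state `Q_λ ⋯ Q_β Q_α (ψ ⊗ ⋯ ⊗ ψ)`. -/
noncomputable def towerState (ψ : Fin d → ℂ) (w : List (Matrix (Fin d) (Fin d) ℂ)) : State d N :=
  w.foldr (fun q Ψ => collectiveOp N q *ᵥ Ψ) (productState N ψ)

/-- The twisted tower state `|k, M⟩ = ∑ⱼ e^{ikj} qⱼ |Ψ_M⟩` (not normalised). -/
noncomputable def twistedState (ψ : Fin d → ℂ) (w : List (Matrix (Fin d) (Fin d) ℂ))
    (q : Matrix (Fin d) (Fin d) ℂ) (k : ℝ) : State d N :=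
  twistedOp N k q *ᵥ towerState N ψ w

/-- The expectation `⟨Ψ|A|Ψ⟩ / ⟨Ψ|Ψ⟩` in the normalised state (used for `Ψ ≠ 0` only). -/
noncomputable def expectation (A : Op d N) (Ψ : State d N) : ℂ :=
  (star Ψ ⬝ᵥ (A *ᵥ Ψ)) / (star Ψ ⬝ᵥ Ψ)

/-- The energy expectation; it is real for a Hermitian `H`. -/
noncomputable def energy (H : Op d N) (Ψ : State d N) : ℝ :=
  (expectation N H Ψ).re

/-- The energy variance `⟨(H - ⟨H⟩)²⟩`. -/
noncomputable def energyVariance (H : Op d N) (Ψ : State d N) : ℝ :=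
  (expectation N ((H - (energy N H Ψ : ℂ) • (1 : Op d N)) ^ 2) Ψ).re

end Chain

/-! ## Quasisymmetry -/

section Quasisymmetry

variable {d : ℕ} {G : Type*} [Group G] (u : G →* Matrix.unitaryGroup (Fin d) ℂ)

/-- The quasisymmetry subspace, spanned by the states `U_g |Ψ_e⟩ = u(g)^{⊗N} ψ^{⊗N}`. -/
noncomputable def scarSpace (ψ : Fin d → ℂ) (N : ℕ) [NeZero N] : Submodule ℂ (State d N) :=
  Submodule.span ℂ (Set.range fun g : G =>
    onsiteAction N (u g : Matrix (Fin d) (Fin d) ℂ) *ᵥ productState N ψ)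

/-- The real space of local (Hermitian) generators: the span of the Hermitian `A` whose
one-parameter group `θ ↦ e^{iθA}` lies in the image of the group. -/
noncomputable def generatorSpace : Submodule ℝ (Matrix (Fin d) (Fin d) ℂ) :=
  Submodule.span ℝ {A | A.IsHermitian ∧
    ∀ θ : ℝ, ∃ g : G, (u g : Matrix (Fin d) (Fin d) ℂ)
      = NormedSpace.exp ((Complex.I * (θ : ℂ)) • A)}

/-- The complexified Lie algebra, in which the ladder operators live. -/
noncomputable def complexGenerators : Submodule ℂ (Matrix (Fin d) (Fin d) ℂ) :=
  Submodule.span ℂ (generatorSpace u : Set (Matrix (Fin d) (Fin d) ℂ))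

/-- `T` is a Cartan subalgebra: a maximal space of mutually commuting generators. -/
structure IsCartan (T : Submodule ℝ (Matrix (Fin d) (Fin d) ℂ)) : Prop where
  le : T ≤ generatorSpace u
  comm : ∀ s ∈ T, ∀ t ∈ T, s * t = t * s
  maximal : ∀ a ∈ generatorSpace u, (∀ t ∈ T, a * t = t * a) → a ∈ T

/-- `q` is a root vector of root `α ≠ 0`: `[t, q] = α(t) q` for all `t` in the Cartan
subalgebra. -/
structure IsRootVector (T : Submodule ℝ (Matrix (Fin d) (Fin d) ℂ)) (α : T →ₗ[ℝ] ℝ)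
    (q : Matrix (Fin d) (Fin d) ℂ) : Prop where
  mem : q ∈ complexGenerators u
  ne_zero : q ≠ 0
  root_ne_zero : α ≠ 0
  bracket : ∀ t : T, (t : Matrix (Fin d) (Fin d) ℂ) * q - q * t = (α t : ℂ) • q

/-- `z` in the Cartan subalgebra is regular (no root vanishes on it), so that its sign on the
roots splits them into positive and negative ones. -/
def IsRegular (T : Submodule ℝ (Matrix (Fin d) (Fin d) ℂ)) (z : T) : Prop :=
  ∀ (α : T →ₗ[ℝ] ℝ) (q : Matrix (Fin d) (Fin d) ℂ), IsRootVector u T α q → α z ≠ 0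

/-- The ladder operators `q⁺`: root vectors of positive roots. -/
def IsRaising (T : Submodule ℝ (Matrix (Fin d) (Fin d) ℂ)) (z : T)
    (q : Matrix (Fin d) (Fin d) ℂ) : Prop :=
  ∃ α : T →ₗ[ℝ] ℝ, IsRootVector u T α q ∧ 0 < α z

/-- The ladder operators `q⁻`: root vectors of negative roots. -/
def IsLowering (T : Submodule ℝ (Matrix (Fin d) (Fin d) ℂ)) (z : T)
    (q : Matrix (Fin d) (Fin d) ℂ) : Prop :=
  ∃ α : T →ₗ[ℝ] ℝ, IsRootVector u T α q ∧ α z < 0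

/-- The local anchor state: a unit extremal-weight vector, i.e. a common eigenvector of the Cartan
subalgebra that all lowering operators annihilate (the all-down convention, in which the tower is
built by raising operators). -/
structure IsAnchor (T : Submodule ℝ (Matrix (Fin d) (Fin d) ℂ)) (z : T) (ψ : Fin d → ℂ) :
    Prop where
  normalized : star ψ ⬝ᵥ ψ = 1
  weight : ∀ t ∈ T, ∃ μ : ℂ, t *ᵥ ψ = μ • ψ
  extremal : ∀ q, IsLowering u T z q → q *ᵥ ψ = 0

end Quasisymmetry

end ScarTower

/-! Subtracting from the local term its expectation in the anchor product state reduces the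
hypothesis to H Φ = 0 on the quasisymmetry subspace. Everything then rests on local consequences of
this global identity, on permutation symmetry of the tower states, and on the vanishing of the phase
sum for k not in 2πℤ.

Locality (`nullOn_blockOp`): the local term h_l has no matrix elements between states that are
products of rotated anchors u(g)ψ on its block and arbitrary off it. For products of h_l with the
terms overlapping it, only the sum has this property (`nullOn_near`).

First moment: as the phases sum to zero, the twisted state is ∑ e^{ikj} (q_j - q_r) Ψ for any
reference site r. If X is supported on a window W, has no such matrix elements, and r is off W, then
only sites i, j in W contribute to the expectation of X (`sand_siteDiff_eq_zero`). The result is a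
finite sum of terms e^{ik(j-i)}. Its coefficients add up to zero, because ∑_{j ∈ W} q_j Ψ differs
from the quasisymmetry state QΨ only by operators acting off W. The squared norm of the twisted
state is N/2 times that of (q_i - q_r)Ψ, so after normalisation the coefficients are bounded by
2‖X‖, with no dependence on N or the label. By translation the expectation of H is N times that of
one block, and the factors N cancel.

Second moment: write H² as translates of h_l H. Overlapping pairs are treated as above. For disjoint
pairs the matrix elements do not depend on the separation, by permutation symmetry, so summing the
phases over all separations turns the sum over distant blocks into minus a sum over the finitely
many near ones (`sum_far_eq`).

Both moments are thus trigonometric polynomials in k with fixed frequencies and uniformly bounded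
coefficients, zero at k = 0 (`IsTrigFamily`). This gives the bounds uniform in the label. For a
fixed label each coefficient is a bounded ratio of polynomials in the size (`eventuallyPoly_word`),
hence convergent, and the limit functions follow. -/

set_option linter.unusedSectionVars false

namespace ScarTower

/-! ### Product vectors, product operators and their matrix elements -/

section Multi

variable {d N : ℕ} [NeZero N]

/-- The product vector `⨂ⱼ aⱼ`. -/
noncomputable def prodVec (a : ZMod N → Fin d → ℂ) : State d N :=
  fun σ => ∏ j, a j (σ j)

/-- The product operator `⨂ⱼ Aⱼ`. -/
noncomputable def multiOp (A : ZMod N → Matrix (Fin d) (Fin d) ℂ) : Op d N :=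
  fun σ τ => ∏ j, A j (σ j) (τ j)

/-- The matrix element `⟨Φ|X|Φ'⟩`. -/
noncomputable def sand (Φ : State d N) (X : Op d N) (Φ' : State d N) : ℂ :=
  star Φ ⬝ᵥ (X *ᵥ Φ')

theorem multiOp_mul (A B : ZMod N → Matrix (Fin d) (Fin d) ℂ) :
    multiOp A * multiOp B = multiOp (fun j => A j * B j) := by
  ext σ τ
  simp only [Matrix.mul_apply, multiOp, ← Finset.prod_mul_distrib]
  rw [Finset.prod_univ_sum]
  simp

theorem multiOp_one : multiOp (fun _ : ZMod N => (1 : Matrix (Fin d) (Fin d) ℂ)) = 1 := by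
  ext σ τ
  simp only [multiOp, Matrix.one_apply, Finset.prod_ite_zero, Finset.mem_univ, true_imp_iff,
    Finset.prod_const_one, funext_iff]

theorem multiOp_conjTranspose (A : ZMod N → Matrix (Fin d) (Fin d) ℂ) :
    (multiOp A)ᴴ = multiOp (fun j => (A j)ᴴ) := by
  ext σ τ
  simp [multiOp, Matrix.conjTranspose_apply]

theorem multiOp_mulVec_prodVec (A : ZMod N → Matrix (Fin d) (Fin d) ℂ)
    (b : ZMod N → Fin d → ℂ) :
    multiOp A *ᵥ prodVec b = prodVec (fun j => A j *ᵥ b j) := by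
  ext σ
  simp only [Matrix.mulVec, dotProduct, multiOp, prodVec, ← Finset.prod_mul_distrib]
  rw [Finset.prod_univ_sum]
  simp

theorem star_prodVec_dotProduct (a b : ZMod N → Fin d → ℂ) :
    star (prodVec a) ⬝ᵥ prodVec b = ∏ j, (star (a j) ⬝ᵥ b j) := by
  simp only [dotProduct, prodVec, Pi.star_apply, star_prod, ← Finset.prod_mul_distrib]
  rw [Finset.prod_univ_sum]
  simp

theorem onsiteAction_eq_multiOp (A : Matrix (Fin d) (Fin d) ℂ) :
    onsiteAction N A = multiOp (fun _ => A) := rfl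

theorem productState_eq_prodVec (ψ : Fin d → ℂ) : productState N ψ = prodVec (fun _ => ψ) := rfl

theorem siteOp_eq_multiOp (A : Matrix (Fin d) (Fin d) ℂ) (j : ZMod N) :
    siteOp N A j = multiOp (Function.update (fun _ => 1) j A) := by
  ext σ τ
  rw [siteOp, multiOp, ← Finset.mul_prod_erase _ _ (Finset.mem_univ j), Function.update_self,
    Finset.prod_congr rfl (g := fun i => if σ i = τ i then (1 : ℂ) else 0)]
  · rw [Finset.prod_ite_zero]
    simp
  · intro i hi
    rw [Function.update_of_ne (Finset.ne_of_mem_erase hi), Matrix.one_apply]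

theorem siteOp_mulVec_prodVec (A : Matrix (Fin d) (Fin d) ℂ) (j : ZMod N)
    (b : ZMod N → Fin d → ℂ) :
    siteOp N A j *ᵥ prodVec b = prodVec (Function.update b j (A *ᵥ b j)) := by
  rw [siteOp_eq_multiOp, multiOp_mulVec_prodVec]
  congr 1
  ext i : 1
  by_cases h : i = j
  · subst h; simp
  · simp [h]

theorem siteOp_conjTranspose (A : Matrix (Fin d) (Fin d) ℂ) (j : ZMod N) :
    (siteOp N A j)ᴴ = siteOp N Aᴴ j := by
  rw [siteOp_eq_multiOp, siteOp_eq_multiOp, multiOp_conjTranspose]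
  congr 1
  ext i : 1
  by_cases h : i = j
  · subst h; simp
  · simp [h]

theorem siteOp_add (A B : Matrix (Fin d) (Fin d) ℂ) (j : ZMod N) :
    siteOp N (A + B) j = siteOp N A j + siteOp N B j := by
  ext σ τ
  simp only [siteOp, Matrix.add_apply]
  split_ifs <;> simp

theorem siteOp_smul (c : ℂ) (A : Matrix (Fin d) (Fin d) ℂ) (j : ZMod N) :
    siteOp N (c • A) j = c • siteOp N A j := by
  ext σ τ
  simp only [siteOp, Matrix.smul_apply]
  split_ifs <;> simp

theorem collectiveOp_add (A B : Matrix (Fin d) (Fin d) ℂ) :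
    collectiveOp N (A + B) = collectiveOp N A + collectiveOp N B := by
  simp [collectiveOp, siteOp_add, Finset.sum_add_distrib]

theorem collectiveOp_smul (c : ℂ) (A : Matrix (Fin d) (Fin d) ℂ) :
    collectiveOp N (c • A) = c • collectiveOp N A := by
  simp [collectiveOp, siteOp_smul, Finset.smul_sum]

theorem collectiveOp_conjTranspose (A : Matrix (Fin d) (Fin d) ℂ) :
    (collectiveOp N A)ᴴ = collectiveOp N Aᴴ := by
  simp [collectiveOp, siteOp_conjTranspose, Matrix.conjTranspose_sum]

theorem commute_multiOp_siteOp (A : Matrix (Fin d) (Fin d) ℂ) (j : ZMod N)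
    (B : ZMod N → Matrix (Fin d) (Fin d) ℂ) (hB : B j = 1) :
    Commute (siteOp N A j) (multiOp B) := by
  rw [siteOp_eq_multiOp, Commute, SemiconjBy, multiOp_mul, multiOp_mul]
  congr 1
  ext i : 1
  by_cases h : i = j
  · subst h; simp [hB]
  · simp [h]

/-! ### Sandwiches -/

theorem sand_sum_left {ι : Type*} (s : Finset ι) (Φ : ι → State d N) (X : Op d N)
    (Φ' : State d N) : sand (∑ i ∈ s, Φ i) X Φ' = ∑ i ∈ s, sand (Φ i) X Φ' := by
  simp [sand, star_sum, sum_dotProduct]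

theorem sand_sum_right {ι : Type*} (s : Finset ι) (Φ : State d N) (X : Op d N)
    (Φ' : ι → State d N) : sand Φ X (∑ i ∈ s, Φ' i) = ∑ i ∈ s, sand Φ X (Φ' i) := by
  simp [sand, Matrix.mulVec_sum, dotProduct_sum]

theorem sand_sum_mid {ι : Type*} (s : Finset ι) (Φ : State d N) (X : ι → Op d N)
    (Φ' : State d N) : sand Φ (∑ i ∈ s, X i) Φ' = ∑ i ∈ s, sand Φ (X i) Φ' := by
  simp [sand, Matrix.sum_mulVec, dotProduct_sum]

theorem sand_smul_left (c : ℂ) (Φ : State d N) (X : Op d N) (Φ' : State d N) :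
    sand (c • Φ) X Φ' = star c * sand Φ X Φ' := by
  simp [sand]

theorem sand_smul_right (c : ℂ) (Φ : State d N) (X : Op d N) (Φ' : State d N) :
    sand Φ X (c • Φ') = c * sand Φ X Φ' := by
  simp [sand, Matrix.mulVec_smul]

theorem sand_smul_mid (c : ℂ) (Φ : State d N) (X : Op d N) (Φ' : State d N) :
    sand Φ (c • X) Φ' = c * sand Φ X Φ' := by
  simp [sand, Matrix.smul_mulVec]

theorem sand_add_left (Φ₁ Φ₂ : State d N) (X : Op d N) (Φ' : State d N) :
    sand (Φ₁ + Φ₂) X Φ' = sand Φ₁ X Φ' + sand Φ₂ X Φ' := by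
  simp [sand]

theorem sand_add_right (Φ₁ Φ₂ : State d N) (X : Op d N) (Φ' : State d N) :
    sand Φ' X (Φ₁ + Φ₂) = sand Φ' X Φ₁ + sand Φ' X Φ₂ := by
  simp [sand, Matrix.mulVec_add]

theorem sand_add_mid (Φ Φ' : State d N) (X Y : Op d N) :
    sand Φ (X + Y) Φ' = sand Φ X Φ' + sand Φ Y Φ' := by
  simp [sand, Matrix.add_mulVec]

theorem sand_sub_mid (Φ Φ' : State d N) (X Y : Op d N) :
    sand Φ (X - Y) Φ' = sand Φ X Φ' - sand Φ Y Φ' := by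
  simp [sand, Matrix.sub_mulVec]

theorem sand_sub_left (Φ₁ Φ₂ : State d N) (X : Op d N) (Φ' : State d N) :
    sand (Φ₁ - Φ₂) X Φ' = sand Φ₁ X Φ' - sand Φ₂ X Φ' := by
  simp [sand, sub_dotProduct]

theorem sand_sub_right (Φ₁ Φ₂ : State d N) (X : Op d N) (Φ' : State d N) :
    sand Φ' X (Φ₁ - Φ₂) = sand Φ' X Φ₁ - sand Φ' X Φ₂ := by
  simp [sand, Matrix.mulVec_sub, dotProduct_sub]

theorem sand_zero_left (X : Op d N) (Φ : State d N) : sand 0 X Φ = 0 := by simp [sand]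

theorem sand_zero_right (X : Op d N) (Φ : State d N) : sand Φ X 0 = 0 := by simp [sand]

theorem sand_mul (Φ : State d N) (X Y : Op d N) (Φ' : State d N) :
    sand Φ (X * Y) Φ' = sand Φ X (Y *ᵥ Φ') := by
  simp [sand, Matrix.mulVec_mulVec]

theorem sand_mulVec_left (Φ : State d N) (X Y : Op d N) (Φ' : State d N) :
    sand (Y *ᵥ Φ) X Φ' = sand Φ (Yᴴ * X) Φ' := by
  simp only [sand, Matrix.star_mulVec, ← Matrix.mulVec_mulVec]
  rw [Matrix.dotProduct_mulVec _ Yᴴ]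

theorem sand_one (Φ Φ' : State d N) : sand Φ 1 Φ' = star Φ ⬝ᵥ Φ' := by simp [sand]

/-! ### Placed operators -/

/-- The operator `h` acting on the sites `f 0, …, f m`. -/
noncomputable def placeOp {m : ℕ}
    (h : Matrix (Fin (m + 1) → Fin d) (Fin (m + 1) → Fin d) ℂ) (f : Fin (m + 1) → ZMod N) :
    Op d N :=
  fun σ τ => if ∀ i, (∀ a, i ≠ f a) → σ i = τ i then h (σ ∘ f) (τ ∘ f) else 0

theorem blockOp_eq_placeOp {m : ℕ}
    (h : Matrix (Fin (m + 1) → Fin d) (Fin (m + 1) → Fin d) ℂ) (l : ZMod N) :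
    blockOp N h l = placeOp h (fun a => l + ((a : ℕ) : ZMod N)) := rfl

theorem multiOp_single_apply {m : ℕ} {f : Fin (m + 1) → ZMod N}
    (s t : Fin (m + 1) → Fin d) (B : ZMod N → Matrix (Fin d) (Fin d) ℂ)
    (hB : ∀ a, B (f a) = Matrix.single (s a) (t a) 1) (hB' : ∀ j, (∀ a, j ≠ f a) → B j = 1)
    (σ τ : Config d N) :
    multiOp B σ τ =
      if (∀ i, (∀ a, i ≠ f a) → σ i = τ i) ∧ s = σ ∘ f ∧ t = τ ∘ f then 1 else 0 := by
  split_ifs with hc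
  · obtain ⟨h1, h2, h3⟩ := hc
    apply Finset.prod_eq_one
    intro j _
    by_cases hj : ∃ a, j = f a
    · obtain ⟨a, rfl⟩ := hj
      rw [hB, Matrix.single_apply, if_pos]
      exact ⟨congrFun h2 a, congrFun h3 a⟩
    · push Not at hj
      rw [hB' j hj, h1 j hj, Matrix.one_apply_eq]
  · by_contra hne
    apply hc
    have hne' : ∀ j, B j (σ j) (τ j) ≠ 0 := fun j => by
      have := Finset.prod_ne_zero_iff.mp hne j (Finset.mem_univ j)
      exact this
    have hst : ∀ a, s a = σ (f a) ∧ t a = τ (f a) := fun a => by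
      have := hne' (f a)
      rw [hB, Matrix.single_apply] at this
      by_contra hcon
      exact this (if_neg hcon)
    refine ⟨fun i hi => ?_, funext fun a => (hst a).1, funext fun a => (hst a).2⟩
    have := hne' i
    rw [hB' i hi, Matrix.one_apply] at this
    by_contra hcon
    exact this (if_neg hcon)

/-- Expansion in matrix units. The family `B` is left free because two choices are needed: one for
arbitrary injective placements, and one given by a sequence on ℕ that is the same for all sizes. -/
theorem placeOp_eq_sum {m : ℕ}
    (h : Matrix (Fin (m + 1) → Fin d) (Fin (m + 1) → Fin d) ℂ) {f : Fin (m + 1) → ZMod N}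
    (B : (Fin (m + 1) → Fin d) → (Fin (m + 1) → Fin d) → ZMod N → Matrix (Fin d) (Fin d) ℂ)
    (hB : ∀ s t a, B s t (f a) = Matrix.single (s a) (t a) 1)
    (hB' : ∀ s t j, (∀ a, j ≠ f a) → B s t j = 1) :
    placeOp h f = ∑ s, ∑ t, h s t • multiOp (B s t) := by
  ext σ τ
  simp only [Matrix.sum_apply, Matrix.smul_apply, smul_eq_mul]
  simp_rw [fun s t => multiOp_single_apply s t (B s t) (hB s t) (hB' s t) σ τ]
  rw [placeOp]
  split_ifs with hc
  · rw [Finset.sum_eq_single (σ ∘ f), Finset.sum_eq_single (τ ∘ f)]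
    · rw [if_pos ⟨hc, rfl, rfl⟩, mul_one]
    · intro t _ ht
      simp [ht]
    · simp
    · intro s _ hs
      simp [hs]
    · simp
  · simp [hc]

open Classical in
/-- The family of matrix units used to expand a placed operator. -/
noncomputable def unitFamily {m : ℕ} (f : Fin (m + 1) → ZMod N) (s t : Fin (m + 1) → Fin d) :
    ZMod N → Matrix (Fin d) (Fin d) ℂ :=
  fun j => if hj : ∃ a, j = f a then Matrix.single (s hj.choose) (t hj.choose) 1 else 1

theorem unitFamily_apply {m : ℕ} {f : Fin (m + 1) → ZMod N} (hf : Function.Injective f)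
    (s t : Fin (m + 1) → Fin d) (a : Fin (m + 1)) :
    unitFamily f s t (f a) = Matrix.single (s a) (t a) 1 := by
  have hj : ∃ b, f a = f b := ⟨a, rfl⟩
  have := hf hj.choose_spec
  rw [unitFamily, dif_pos hj, ← this]

theorem unitFamily_of_ne {m : ℕ} {f : Fin (m + 1) → ZMod N}
    (s t : Fin (m + 1) → Fin d) (j : ZMod N) (hj : ∀ a, j ≠ f a) :
    unitFamily f s t j = 1 := by
  rw [unitFamily, dif_neg]
  push Not
  exact hj

theorem placeOp_eq_sum_unitFamily {m : ℕ}
    (h : Matrix (Fin (m + 1) → Fin d) (Fin (m + 1) → Fin d) ℂ) {f : Fin (m + 1) → ZMod N}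
    (hf : Function.Injective f) :
    placeOp h f = ∑ s, ∑ t, h s t • multiOp (unitFamily f s t) :=
  placeOp_eq_sum h _ (unitFamily_apply hf) unitFamily_of_ne

theorem commute_siteOp_placeOp {m : ℕ}
    (h : Matrix (Fin (m + 1) → Fin d) (Fin (m + 1) → Fin d) ℂ) {f : Fin (m + 1) → ZMod N}
    (hf : Function.Injective f) (A : Matrix (Fin d) (Fin d) ℂ) (j : ZMod N)
    (hj : ∀ a, j ≠ f a) : Commute (siteOp N A j) (placeOp h f) := by
  rw [placeOp_eq_sum_unitFamily h hf]
  exact Commute.sum_right _ _ _ fun s _ => Commute.sum_right _ _ _ fun t _ =>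
    (commute_multiOp_siteOp A j _ (unitFamily_of_ne s t j hj)).smul_right _

theorem commute_placeOp {m : ℕ}
    (h h' : Matrix (Fin (m + 1) → Fin d) (Fin (m + 1) → Fin d) ℂ) {f f' : Fin (m + 1) → ZMod N}
    (hf : Function.Injective f) (hf' : Function.Injective f') (hd : ∀ a b, f a ≠ f' b) :
    Commute (placeOp h f) (placeOp h' f') := by
  rw [placeOp_eq_sum_unitFamily h hf, placeOp_eq_sum_unitFamily h' hf']
  refine Commute.sum_right _ _ _ fun s _ => Commute.sum_right _ _ _ fun t _ =>
    Commute.smul_right (Commute.sum_left _ _ _ fun s' _ => Commute.sum_left _ _ _ fun t' _ =>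
    Commute.smul_left ?_ _) _
  rw [Commute, SemiconjBy, multiOp_mul, multiOp_mul]
  congr 1
  ext i : 1
  by_cases hi : ∃ a, i = f a
  · obtain ⟨a, rfl⟩ := hi
    rw [unitFamily_of_ne (f := f') _ _ _ (hd a)]
    simp
  · push Not at hi
    rw [unitFamily_of_ne (f := f) _ _ _ hi]
    simp

theorem placeOp_sub {m : ℕ}
    (h h' : Matrix (Fin (m + 1) → Fin d) (Fin (m + 1) → Fin d) ℂ) (f : Fin (m + 1) → ZMod N) :
    placeOp (h - h') f = placeOp h f - placeOp h' f := by
  ext σ τ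
  simp only [placeOp, Matrix.sub_apply]
  split_ifs <;> simp

theorem placeOp_smul_one {m : ℕ} (c : ℂ) (f : Fin (m + 1) → ZMod N) :
    placeOp (c • (1 : Matrix (Fin (m + 1) → Fin d) (Fin (m + 1) → Fin d) ℂ)) f = c • 1 := by
  ext σ τ
  simp only [placeOp, Matrix.smul_apply, Matrix.one_apply]
  by_cases h : σ = τ
  · simp [h]
  · rw [if_neg h]
    split_ifs with h1 h2
    · exfalso
      apply h
      ext i : 1
      by_cases hi : ∃ a, i = f a
      · obtain ⟨a, rfl⟩ := hi
        exact congrFun h2 a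
      · push Not at hi
        exact h1 i hi
    · rfl
    · simp

theorem blockSites_injective {m : ℕ} (hN : m + 1 ≤ N) (l : ZMod N) :
    Function.Injective (fun a : Fin (m + 1) => l + ((a : ℕ) : ZMod N)) := by
  intro a b hab
  have hab' : (((a : ℕ) : ZMod N)) = ((b : ℕ) : ZMod N) := add_left_cancel hab
  rw [ZMod.natCast_eq_natCast_iff', Nat.mod_eq_of_lt (by omega), Nat.mod_eq_of_lt (by omega)]
    at hab'
  exact Fin.ext hab'

end Multi

end ScarTower

namespace ScarTower

/-! ### Permutations of the sites -/

section Perm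

variable {d N : ℕ} [NeZero N]

/-- The action of a permutation of the sites on states. -/
def permState (π : Equiv.Perm (ZMod N)) (Φ : State d N) : State d N := fun σ => Φ (σ ∘ π)

/-- The conjugation of operators by a permutation of the sites. -/
def permOp (π : Equiv.Perm (ZMod N)) (X : Op d N) : Op d N := fun σ τ => X (σ ∘ π) (τ ∘ π)

theorem collectiveOp_zero : collectiveOp N (0 : Matrix (Fin d) (Fin d) ℂ) = 0 := by
  have := collectiveOp_smul (N := N) 0 (0 : Matrix (Fin d) (Fin d) ℂ)
  simpa using this

theorem permOp_eq_submatrix (π : Equiv.Perm (ZMod N)) (X : Op d N) :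
    permOp π X = X.submatrix (Equiv.arrowCongr π.symm (Equiv.refl (Fin d)))
      (Equiv.arrowCongr π.symm (Equiv.refl (Fin d))) := rfl

theorem permState_eq_comp (π : Equiv.Perm (ZMod N)) (Φ : State d N) :
    permState π Φ = Φ ∘ (Equiv.arrowCongr π.symm (Equiv.refl (Fin d))) := rfl

theorem permOp_mul (π : Equiv.Perm (ZMod N)) (X Y : Op d N) :
    permOp π (X * Y) = permOp π X * permOp π Y := by
  simp only [permOp_eq_submatrix, Matrix.submatrix_mul_equiv]

theorem permOp_one (π : Equiv.Perm (ZMod N)) : permOp π (1 : Op d N) = 1 := by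
  rw [permOp_eq_submatrix, Matrix.submatrix_one_equiv]

theorem permOp_sum {ι : Type*} (s : Finset ι) (π : Equiv.Perm (ZMod N)) (X : ι → Op d N) :
    permOp π (∑ i ∈ s, X i) = ∑ i ∈ s, permOp π (X i) := by
  ext σ τ
  simp [permOp, Matrix.sum_apply]

theorem permState_sum {ι : Type*} (s : Finset ι) (π : Equiv.Perm (ZMod N)) (X : ι → State d N) :
    permState π (∑ i ∈ s, X i) = ∑ i ∈ s, permState π (X i) := by
  ext σ
  simp [permState]

theorem permState_sub (π : Equiv.Perm (ZMod N)) (X Y : State d N) :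
    permState π (X - Y) = permState π X - permState π Y := rfl

theorem permState_smul (π : Equiv.Perm (ZMod N)) (c : ℂ) (X : State d N) :
    permState π (c • X) = c • permState π X := rfl

theorem permState_mulVec (π : Equiv.Perm (ZMod N)) (X : Op d N) (Φ : State d N) :
    permState π (X *ᵥ Φ) = permOp π X *ᵥ permState π Φ := by
  rw [permOp_eq_submatrix, permState_eq_comp, permState_eq_comp, Matrix.submatrix_mulVec_equiv]
  congr 2
  ext σ
  simp only [Function.comp_apply]
  exact congrArg Φ (funext fun i => by simp [Equiv.arrowCongr])

theorem sand_perm (π : Equiv.Perm (ZMod N)) (Φ : State d N) (X : Op d N) (Φ' : State d N) :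
    sand (permState π Φ) (permOp π X) (permState π Φ') = sand Φ X Φ' := by
  rw [sand, ← permState_mulVec, sand]
  exact (Equiv.arrowCongr π.symm (Equiv.refl (Fin d))).sum_comp
    (fun σ => star Φ σ * (X *ᵥ Φ') σ)

theorem permOp_siteOp (π : Equiv.Perm (ZMod N)) (A : Matrix (Fin d) (Fin d) ℂ) (j : ZMod N) :
    permOp π (siteOp N A j) = siteOp N A (π j) := by
  ext σ τ
  have : (∀ i, i ≠ j → (σ ∘ π) i = (τ ∘ π) i) ↔ (∀ i, i ≠ π j → σ i = τ i) := by
    refine ⟨fun h i hi => ?_, fun h i hi => h _ (π.injective.ne hi)⟩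
    have := h (π.symm i) (fun hc => hi (by rw [← hc]; simp))
    simpa using this
  exact if_congr this rfl rfl

theorem permOp_placeOp {m : ℕ} (π : Equiv.Perm (ZMod N))
    (h : Matrix (Fin (m + 1) → Fin d) (Fin (m + 1) → Fin d) ℂ) (f : Fin (m + 1) → ZMod N) :
    permOp π (placeOp h f) = placeOp h (π ∘ f) := by
  ext σ τ
  have : (∀ i, (∀ a, i ≠ f a) → (σ ∘ π) i = (τ ∘ π) i) ↔
      (∀ i, (∀ a, i ≠ (π ∘ f) a) → σ i = τ i) := by
    refine ⟨fun h i hi => ?_, fun h i hi => h _ (fun a => π.injective.ne (hi a))⟩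
    have := h (π.symm i) (fun a hc => hi a (by simp [← hc]))
    simpa using this
  exact if_congr this rfl rfl

theorem permOp_collectiveOp (π : Equiv.Perm (ZMod N)) (A : Matrix (Fin d) (Fin d) ℂ) :
    permOp π (collectiveOp N A) = collectiveOp N A := by
  rw [collectiveOp, permOp_sum]
  simp_rw [permOp_siteOp]
  exact Equiv.sum_comp π (fun j => siteOp N A j)

/-- Invariance of a state under all permutations of the sites. -/
def IsSymm (Ψ : State d N) : Prop := ∀ π, permState π Ψ = Ψ

theorem isSymm_prodVec_const (φ : Fin d → ℂ) : IsSymm (prodVec (fun _ : ZMod N => φ)) := by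
  intro π
  ext σ
  exact Equiv.prod_comp π (fun j => φ (σ j))

/-- Translation of the sites. -/
abbrev shift (t : ZMod N) : Equiv.Perm (ZMod N) := Equiv.addRight t

theorem permOp_shift_blockOp {m : ℕ}
    (h : Matrix (Fin (m + 1) → Fin d) (Fin (m + 1) → Fin d) ℂ) (l t : ZMod N) :
    permOp (shift t) (blockOp N h l) = blockOp N h (l + t) := by
  rw [blockOp_eq_placeOp, blockOp_eq_placeOp, permOp_placeOp]
  congr 1
  ext a
  simp only [Function.comp_apply, Equiv.coe_addRight]
  ring

theorem permOp_shift_hamiltonian {m : ℕ}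
    (h : Matrix (Fin (m + 1) → Fin d) (Fin (m + 1) → Fin d) ℂ) (t : ZMod N) :
    permOp (shift t) (hamiltonian N h) = hamiltonian N h := by
  rw [hamiltonian, permOp_sum]
  simp_rw [permOp_shift_blockOp]
  exact Equiv.sum_comp (shift t) (fun l => blockOp N h l)

end Perm

/-! ### The quasisymmetry subspace and its stability under collective generators -/

section Scar

variable {d : ℕ} {G : Type*} [Group G] (u : G →* Matrix.unitaryGroup (Fin d) ℂ)

/-- The rotated local anchor state `u(g) ψ`. -/
noncomputable def orbit (ψ : Fin d → ℂ) (g : G) : Fin d → ℂ :=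
  (u g : Matrix (Fin d) (Fin d) ℂ) *ᵥ ψ

theorem orbit_normalized {ψ : Fin d → ℂ} (hψ : star ψ ⬝ᵥ ψ = 1) (g : G) :
    star (orbit u ψ g) ⬝ᵥ orbit u ψ g = 1 := by
  have := Matrix.mem_unitaryGroup_iff'.mp (u g).2
  rw [orbit, Matrix.star_mulVec, ← Matrix.dotProduct_mulVec, Matrix.mulVec_mulVec,
    ← Matrix.star_eq_conjTranspose, this, Matrix.one_mulVec, hψ]

theorem scarSpace_eq_span (ψ : Fin d → ℂ) (N : ℕ) [NeZero N] :
    scarSpace u ψ N =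
      Submodule.span ℂ (Set.range fun g : G => prodVec (N := N) (fun _ => orbit u ψ g)) := by
  rw [scarSpace]
  congr 2
  ext1 g
  rw [onsiteAction_eq_multiOp, productState_eq_prodVec, multiOp_mulVec_prodVec]
  rfl

theorem prodVec_orbit_mem (ψ : Fin d → ℂ) (N : ℕ) [NeZero N] (g : G) :
    prodVec (N := N) (fun _ => orbit u ψ g) ∈ scarSpace u ψ N := by
  rw [scarSpace_eq_span]
  exact Submodule.subset_span ⟨g, rfl⟩

theorem isSymm_of_mem_scarSpace {ψ : Fin d → ℂ} {N : ℕ} [NeZero N] {Ψ : State d N}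
    (h : Ψ ∈ scarSpace u ψ N) : IsSymm Ψ := by
  intro π
  rw [scarSpace_eq_span] at h
  induction h using Submodule.span_induction with
  | mem x hx => obtain ⟨g, rfl⟩ := hx; exact isSymm_prodVec_const _ π
  | zero => rfl
  | add x y _ _ hx hy => exact congrArg₂ (· + ·) hx hy
  | smul c x _ hx => exact congrArg (c • ·) hx

open scoped Matrix.Norms.Operator in
theorem hasDerivAt_exp_mulVec (A : Matrix (Fin d) (Fin d) ℂ) (φ : Fin d → ℂ) (i : Fin d) :
    HasDerivAt (fun θ : ℝ => (NormedSpace.exp ((Complex.I * (θ : ℂ)) • A) *ᵥ φ) i)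
      (((Complex.I • A) *ᵥ φ) i) 0 := by
  have h1 : HasDerivAt (fun θ : ℝ => NormedSpace.exp (θ • (Complex.I • A))) (Complex.I • A) 0 := by
    have := hasDerivAt_exp_smul_const (𝕂 := ℝ) (Complex.I • A) 0
    simp only [zero_smul, NormedSpace.exp_zero, one_mul] at this
    exact this
  have h2 : (fun θ : ℝ => (NormedSpace.exp ((Complex.I * (θ : ℂ)) • A) *ᵥ φ) i)
      = fun θ : ℝ => (NormedSpace.exp (θ • (Complex.I • A)) *ᵥ φ) i := by
    ext θ
    have : (Complex.I * (θ : ℂ)) • A = θ • (Complex.I • A) := by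
      ext a b
      simp only [Matrix.smul_apply, smul_eq_mul, Complex.real_smul]
      ring
    rw [this]
  rw [h2]
  simp only [Matrix.mulVec, dotProduct]
  refine HasDerivAt.fun_sum fun j _ => HasDerivAt.mul_const ?_ _
  exact hasDerivAt_pi.mp (hasDerivAt_pi.mp h1 i) j

/-- The curve θ ↦ (e^{iθA}φ)^{⊗N} runs inside the subspace, its derivative at 0 is i times the
collective operator applied to φ^{⊗N}, and a finite-dimensional subspace is closed, so it contains
this derivative. -/
theorem collectiveOp_prodVec_mem {ψ : Fin d → ℂ} {N : ℕ} [NeZero N]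
    {A : Matrix (Fin d) (Fin d) ℂ}
    (hA : ∀ θ : ℝ, ∃ g : G, (u g : Matrix (Fin d) (Fin d) ℂ)
      = NormedSpace.exp ((Complex.I * (θ : ℂ)) • A)) (g : G) :
    collectiveOp N A *ᵥ prodVec (fun _ => orbit u ψ g) ∈ scarSpace u ψ N := by
  set φ := orbit u ψ g
  let c : ℝ → State d N := fun θ =>
    prodVec (fun _ => NormedSpace.exp ((Complex.I * (θ : ℂ)) • A) *ᵥ φ)
  have hc : ∀ θ, c θ ∈ scarSpace u ψ N := fun θ => by
    obtain ⟨g', hg'⟩ := hA θ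
    have : c θ = prodVec (fun _ => orbit u ψ (g' * g)) := by
      simp only [c, φ, orbit, ← hg', Matrix.mulVec_mulVec, map_mul, Matrix.UnitaryGroup.mul_val]
    rw [this]
    exact prodVec_orbit_mem u ψ N _
  have hd : HasDerivAt c (Complex.I • (collectiveOp N A *ᵥ prodVec (fun _ => φ))) 0 := by
    rw [hasDerivAt_pi]
    intro σ
    -- Leibniz rule: differentiating the product over sites produces the sum over sites in the
    -- collective operator.
    have := HasDerivAt.fun_finsetProd (u := (Finset.univ : Finset (ZMod N)))
      (f := fun j (θ : ℝ) => (NormedSpace.exp ((Complex.I * (θ : ℂ)) • A) *ᵥ φ) (σ j))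
      (f' := fun j => ((Complex.I • A) *ᵥ φ) (σ j)) (x := 0)
      (fun j _ => hasDerivAt_exp_mulVec A φ (σ j))
    refine this.congr_deriv ?_
    rw [collectiveOp, Matrix.sum_mulVec, Pi.smul_apply, Finset.sum_apply, Finset.smul_sum]
    refine Finset.sum_congr rfl fun j _ => ?_
    rw [siteOp_mulVec_prodVec, prodVec, ← Finset.mul_prod_erase _ _ (Finset.mem_univ j)]
    simp only [Complex.ofReal_zero, mul_zero, zero_smul, NormedSpace.exp_zero, Matrix.one_mulVec,
      Function.update_self, Matrix.smul_mulVec, Pi.smul_apply, smul_eq_mul]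
    have hprod : ∏ i ∈ Finset.univ.erase j, Function.update (fun _ => φ) j (A *ᵥ φ) i (σ i)
        = ∏ i ∈ Finset.univ.erase j, φ (σ i) :=
      Finset.prod_congr rfl fun i hi => by rw [Function.update_of_ne (Finset.ne_of_mem_erase hi)]
    rw [hprod]
    ring
  have hclosed : IsClosed (scarSpace u ψ N : Set (State d N)) :=
    Submodule.closed_of_finiteDimensional _
  have hmem : Complex.I • (collectiveOp N A *ᵥ prodVec (fun _ => φ)) ∈ scarSpace u ψ N := by
    refine hclosed.mem_of_tendsto (hasDerivAt_iff_tendsto_slope.mp hd)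
      (Filter.Eventually.of_forall fun θ => ?_)
    rw [slope_def_module]
    exact Submodule.smul_of_tower_mem _ _ (Submodule.sub_mem _ (hc θ) (hc 0))
  have := (scarSpace u ψ N).smul_mem (-Complex.I) hmem
  simpa [smul_smul] using this

/-- Linearity reduces to a one-parameter generator and a rotated anchor product. Two nested span
inductions on `A` are needed, the complex span being taken over a real one. -/
theorem collectiveOp_mem_scarSpace {ψ : Fin d → ℂ} {N : ℕ} [NeZero N]
    {A : Matrix (Fin d) (Fin d) ℂ} (hA : A ∈ complexGenerators u) {Ψ : State d N}
    (hΨ : Ψ ∈ scarSpace u ψ N) : collectiveOp N A *ᵥ Ψ ∈ scarSpace u ψ N := by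
  rw [complexGenerators] at hA
  induction hA using Submodule.span_induction with
  | zero => simp [collectiveOp_zero]
  | add x y _ _ hx hy =>
    rw [collectiveOp_add, Matrix.add_mulVec]
    exact Submodule.add_mem _ hx hy
  | smul c x _ hx =>
    rw [collectiveOp_smul, Matrix.smul_mulVec]
    exact Submodule.smul_mem _ _ hx
  | mem A hA =>
    rw [SetLike.mem_coe, generatorSpace] at hA
    induction hA using Submodule.span_induction with
    | zero => simp [collectiveOp_zero]
    | add x y _ _ hx hy =>
      rw [collectiveOp_add, Matrix.add_mulVec]
      exact Submodule.add_mem _ hx hy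
    | smul c x _ hx =>
      have : c • x = (c : ℂ) • x := by ext; simp
      rw [this, collectiveOp_smul, Matrix.smul_mulVec]
      exact Submodule.smul_mem _ _ hx
    | mem A hA =>
      rw [scarSpace_eq_span] at hΨ
      induction hΨ using Submodule.span_induction with
      | zero => simp
      | add x y _ _ hx hy =>
        rw [Matrix.mulVec_add]
        exact Submodule.add_mem _ hx hy
      | smul c x _ hx =>
        rw [Matrix.mulVec_smul]
        exact Submodule.smul_mem _ _ hx
      | mem x hx =>
        obtain ⟨g, rfl⟩ := hx
        exact collectiveOp_prodVec_mem u hA.2 g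

theorem towerState_mem_scarSpace {ψ : Fin d → ℂ} {N : ℕ} [NeZero N]
    {w : List (Matrix (Fin d) (Fin d) ℂ)} (hw : ∀ a ∈ w, a ∈ complexGenerators u) :
    towerState N ψ w ∈ scarSpace u ψ N := by
  induction w with
  | nil =>
    have := prodVec_orbit_mem u ψ N 1
    simpa [orbit, towerState, productState_eq_prodVec] using this
  | cons a w ih =>
    exact collectiveOp_mem_scarSpace u (hw a (by simp)) (ih fun b hb => hw b (by simp [hb]))

end Scar

end ScarTower

namespace ScarTower

/-! ### Locality: tensor factors off the support of an operator can be exchanged -/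

section Local

variable {d N : ℕ} [NeZero N]

/-- `X` is supported on the sites `W`: it commutes with all one-site operators off `W`, and it is
invariant under the permutations of the other sites. -/
structure LocalOn (W : Finset (ZMod N)) (X : Op d N) : Prop where
  comm : ∀ j ∉ W, ∀ A, Commute (siteOp N A j) X
  perm : ∀ π : Equiv.Perm (ZMod N), (∀ j ∈ W, π j = j) → permOp π X = X

theorem LocalOn.mono {W W' : Finset (ZMod N)} {X : Op d N} (h : LocalOn W X) (hW : W ⊆ W') :
    LocalOn W' X :=
  ⟨fun j hj => h.comm j fun hc => hj (hW hc), fun π hπ => h.perm π fun j hj => hπ j (hW hj)⟩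

theorem LocalOn.mul {W : Finset (ZMod N)} {X Y : Op d N} (hX : LocalOn W X) (hY : LocalOn W Y) :
    LocalOn W (X * Y) :=
  ⟨fun j hj A => (hX.comm j hj A).mul_right (hY.comm j hj A), fun π hπ => by
    rw [permOp_mul, hX.perm π hπ, hY.perm π hπ]⟩

theorem LocalOn.sum {ι : Type*} {s : Finset ι} {W : Finset (ZMod N)} {X : ι → Op d N}
    (hX : ∀ i ∈ s, LocalOn W (X i)) : LocalOn W (∑ i ∈ s, X i) :=
  ⟨fun j hj A => Commute.sum_right _ _ _ fun i hi => (hX i hi).comm j hj A, fun π hπ => by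
    rw [permOp_sum]
    exact Finset.sum_congr rfl fun i hi => (hX i hi).perm π hπ⟩

/-- The sites `l, …, l + m`. -/
def blockSet (N m : ℕ) [NeZero N] (l : ZMod N) : Finset (ZMod N) :=
  Finset.univ.image (fun a : Fin (m + 1) => l + ((a : ℕ) : ZMod N))

theorem mem_blockSet {m : ℕ} {l j : ZMod N} :
    j ∈ blockSet N m l ↔ ∃ a : Fin (m + 1), j = l + ((a : ℕ) : ZMod N) := by
  simp [blockSet, eq_comm]

theorem localOn_blockOp {m : ℕ} (hN : m + 1 ≤ N)
    (h : Matrix (Fin (m + 1) → Fin d) (Fin (m + 1) → Fin d) ℂ) (l : ZMod N) :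
    LocalOn (blockSet N m l) (blockOp N h l) := by
  rw [blockOp_eq_placeOp]
  refine ⟨fun j hj A => commute_siteOp_placeOp h (blockSites_injective hN l) A j
    fun a ha => hj (mem_blockSet.mpr ⟨a, ha⟩), fun π hπ => ?_⟩
  rw [permOp_placeOp]
  congr 1
  ext a
  exact hπ _ (mem_blockSet.mpr ⟨a, rfl⟩)

/-- The bound N ≥ m + 2 is what makes distinct blocks differ as sets; for N = m + 1 every block is
the whole ring. With `l` lying `s` steps after `l'`, the last site of the block at `l` works unless
it wraps around, and then the site N - 1 steps after `l'` does. -/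
theorem exists_mem_blockSet_notMem {m : ℕ} (hN : m + 2 ≤ N) {l l' : ZMod N} (hl : l ≠ l') :
    ∃ j ∈ blockSet N m l, j ∉ blockSet N m l' := by
  set s := (l - l').val with hs
  have hs0 : s ≠ 0 := by
    rw [hs, Ne, ZMod.val_eq_zero]
    exact sub_ne_zero.mpr hl
  have hsN : s < N := ZMod.val_lt _
  have hls : l = l' + ((s : ℕ) : ZMod N) := by
    rw [hs, ZMod.natCast_zmod_val]; ring
  have key : ∀ t : ℕ, m < t → t < N → l' + (t : ZMod N) ∉ blockSet N m l' := by
    intro t ht htN hmem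
    obtain ⟨a, ha⟩ := mem_blockSet.mp hmem
    have ha' := add_left_cancel ha
    have := a.2
    rw [ZMod.natCast_eq_natCast_iff', Nat.mod_eq_of_lt htN, Nat.mod_eq_of_lt (by omega)] at ha'
    omega
  by_cases hsm : s + m < N
  · refine ⟨l' + ((s + m : ℕ) : ZMod N), mem_blockSet.mpr ⟨⟨m, by omega⟩, ?_⟩,
      key _ (by omega) hsm⟩
    rw [hls]; push_cast; ring
  · refine ⟨l' + ((N - 1 : ℕ) : ZMod N), mem_blockSet.mpr ⟨⟨N - 1 - s, by omega⟩, ?_⟩,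
      key _ (by omega) (by omega)⟩
    have : N - 1 = s + (N - 1 - s) := by omega
    calc l' + ((N - 1 : ℕ) : ZMod N) = l' + (s : ZMod N) + ((N - 1 - s : ℕ) : ZMod N) := by
          rw [add_assoc, ← Nat.cast_add, ← this]
      _ = _ := by rw [← hls]

theorem prodVec_update_smul (b : ZMod N → Fin d → ℂ) (j : ZMod N) (c : ℂ) (y : Fin d → ℂ) :
    prodVec (Function.update b j (c • y)) = c • prodVec (Function.update b j y) := by
  ext σ
  simp only [prodVec, Pi.smul_apply, smul_eq_mul]
  rw [← Finset.mul_prod_erase _ _ (Finset.mem_univ j),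
    ← Finset.mul_prod_erase (Finset.univ : Finset (ZMod N))
      (fun i => Function.update b j y i (σ i)) (Finset.mem_univ j)]
  have : ∏ i ∈ Finset.univ.erase j, Function.update b j (c • y) i (σ i)
      = ∏ i ∈ Finset.univ.erase j, Function.update b j y i (σ i) :=
    Finset.prod_congr rfl fun i hi => by
      rw [Function.update_of_ne (Finset.ne_of_mem_erase hi),
        Function.update_of_ne (Finset.ne_of_mem_erase hi)]
  rw [this]
  simp only [Function.update_self, Pi.smul_apply, smul_eq_mul, mul_assoc]

/-- Off its support `X` sees only the scalar product of the two local vectors. This follows by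
moving the rank-one operator |y⟩⟨c| at site `j` through `X`. The cross-multiplied form avoids
dividing by a scalar product that may vanish. -/
theorem sand_prodVec_update {X : Op d N} {j : ZMod N} (hX : ∀ A, Commute (siteOp N A j) X)
    (a b : ZMod N → Fin d → ℂ) (c v x y : Fin d → ℂ) :
    (star c ⬝ᵥ v) *
        sand (prodVec (Function.update a j x)) X (prodVec (Function.update b j y)) =
      (star x ⬝ᵥ y) *
        sand (prodVec (Function.update a j c)) X (prodVec (Function.update b j v)) := by
  have h1 : siteOp N (Matrix.vecMulVec y (star c)) j *ᵥ prodVec (Function.update b j v)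
      = (star c ⬝ᵥ v) • prodVec (Function.update b j y) := by
    rw [siteOp_mulVec_prodVec, Function.update_self, Function.update_idem,
      Matrix.vecMulVec_mulVec, op_smul_eq_smul, prodVec_update_smul]
  have h2 : siteOp N (Matrix.vecMulVec y (star c))ᴴ j *ᵥ prodVec (Function.update a j x)
      = (star y ⬝ᵥ x) • prodVec (Function.update a j c) := by
    rw [siteOp_mulVec_prodVec, Function.update_self, Function.update_idem,
      Matrix.conjTranspose_vecMulVec, star_star, Matrix.vecMulVec_mulVec, op_smul_eq_smul,
      prodVec_update_smul]
  rw [← sand_smul_right, ← h1, ← sand_mul, ← (hX _).eq]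
  have h3 : star x ⬝ᵥ y = star (star y ⬝ᵥ x) := by
    rw [← Matrix.star_dotProduct_star, star_star]
  rw [h3, ← sand_smul_left, ← h2, sand_mulVec_left, siteOp_conjTranspose,
    Matrix.conjTranspose_conjTranspose]

theorem sand_prodVec_eq_zero_of_orthogonal {X : Op d N} {j : ZMod N}
    (hX : ∀ A, Commute (siteOp N A j) X) {a b : ZMod N → Fin d → ℂ} {φ : Fin d → ℂ}
    (hφ : star φ ⬝ᵥ φ = 1) (hab : star (a j) ⬝ᵥ b j = 0) :
    sand (prodVec a) X (prodVec b) = 0 := by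
  have := sand_prodVec_update hX a b φ φ (a j) (b j)
  simpa [hφ, hab] using this

/-- The factors off `W` are exchanged one site at a time. Each exchange multiplies by a scalar, and
the nonzero overlaps of the primed vectors allow the vanishing to be carried over. -/
theorem sand_prodVec_eq_zero_of_agree {X : Op d N} {W : Finset (ZMod N)}
    (hX : ∀ j ∉ W, ∀ A, Commute (siteOp N A j) X) {a b a' b' : ZMod N → Fin d → ℂ}
    (ha : ∀ j ∈ W, a j = a' j) (hb : ∀ j ∈ W, b j = b' j)
    (ho : ∀ j ∉ W, star (a' j) ⬝ᵥ b' j ≠ 0)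
    (h0 : sand (prodVec a') X (prodVec b') = 0) :
    sand (prodVec a) X (prodVec b) = 0 := by
  have key : ∀ s : Finset (ZMod N), (∀ j ∈ s, j ∉ W) →
      sand (prodVec (s.piecewise a a')) X (prodVec (s.piecewise b b')) = 0 := by
    intro s
    induction s using Finset.induction_on with
    | empty => intro _; simpa using h0
    | insert j s hj ih =>
      intro hs
      have ih' := ih fun i hi => hs i (Finset.mem_insert_of_mem hi)
      have hjW := hs j (Finset.mem_insert_self _ _)
      have := sand_prodVec_update (hX j hjW) (s.piecewise a a') (s.piecewise b b')
        (a' j) (b' j) (a j) (b j)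
      rw [← Finset.piecewise_insert, ← Finset.piecewise_insert,
        show Function.update (s.piecewise a a') j (a' j) = s.piecewise a a' from
          Function.update_eq_self_iff.mpr (by simp [hj]),
        show Function.update (s.piecewise b b') j (b' j) = s.piecewise b b' from
          Function.update_eq_self_iff.mpr (by simp [hj]), ih', mul_zero] at this
      exact (mul_eq_zero.mp this).resolve_left (ho j hjW)
  have := key Wᶜ (fun j hj => Finset.mem_compl.mp hj)
  have e : ∀ {c c' : ZMod N → Fin d → ℂ}, (∀ j ∈ W, c j = c' j) → Wᶜ.piecewise c c' = c := by
    intro c c' hc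
    ext j : 1
    by_cases hj : j ∈ W
    · simp [hj, hc j hj]
    · simp [hj]
  rwa [e ha, e hb] at this

end Local

/-! ### Absence of local matrix elements between quasisymmetry states -/

section Null

variable {d : ℕ} {G : Type*} [Group G] (u : G →* Matrix.unitaryGroup (Fin d) ℂ)
variable (ψ : Fin d → ℂ) {N : ℕ} [NeZero N]

/-- The states that look like quasisymmetry states on the sites `W`. -/
noncomputable def partialScar (W : Finset (ZMod N)) : Submodule ℂ (State d N) :=
  Submodule.span ℂ {Φ | ∃ (g : G) (b : ZMod N → Fin d → ℂ),
    (∀ j ∈ W, b j = orbit u ψ g) ∧ Φ = prodVec b}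

variable {ψ}

theorem scarSpace_le_partialScar (W : Finset (ZMod N)) :
    scarSpace u ψ N ≤ partialScar u ψ W := by
  rw [scarSpace_eq_span]
  refine Submodule.span_mono ?_
  rintro _ ⟨g, rfl⟩
  exact ⟨g, _, fun _ _ => rfl, rfl⟩

theorem partialScar_anti {W W' : Finset (ZMod N)} (hW : W ⊆ W') :
    partialScar u ψ W' ≤ partialScar u ψ W := by
  refine Submodule.span_mono ?_
  rintro _ ⟨g, b, hb, rfl⟩
  exact ⟨g, b, fun j hj => hb j (hW hj), rfl⟩

theorem multiOp_mem_partialScar {W : Finset (ZMod N)} {B : ZMod N → Matrix (Fin d) (Fin d) ℂ}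
    (hB : ∀ j ∈ W, B j = 1) {Φ : State d N} (hΦ : Φ ∈ partialScar u ψ W) :
    multiOp B *ᵥ Φ ∈ partialScar u ψ W := by
  induction hΦ using Submodule.span_induction with
  | zero => simp
  | add x y _ _ hx hy => rw [Matrix.mulVec_add]; exact Submodule.add_mem _ hx hy
  | smul c x _ hx => rw [Matrix.mulVec_smul]; exact Submodule.smul_mem _ _ hx
  | mem x hx =>
    obtain ⟨g, b, hb, rfl⟩ := hx
    rw [multiOp_mulVec_prodVec]
    exact Submodule.subset_span ⟨g, _, fun j hj => by simp [hB j hj, hb j hj], rfl⟩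

theorem siteOp_mem_partialScar {W : Finset (ZMod N)} (A : Matrix (Fin d) (Fin d) ℂ) {j : ZMod N}
    (hj : j ∉ W) {Φ : State d N} (hΦ : Φ ∈ partialScar u ψ W) :
    siteOp N A j *ᵥ Φ ∈ partialScar u ψ W := by
  rw [siteOp_eq_multiOp]
  exact multiOp_mem_partialScar u (fun i hi => Function.update_of_ne (ne_of_mem_of_not_mem hi hj) _ _) hΦ

theorem blockOp_mem_partialScar {m : ℕ} (hN : m + 1 ≤ N)
    (h : Matrix (Fin (m + 1) → Fin d) (Fin (m + 1) → Fin d) ℂ) {l : ZMod N}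
    {W : Finset (ZMod N)} (hd : Disjoint (blockSet N m l) W)
    {Φ : State d N} (hΦ : Φ ∈ partialScar u ψ W) :
    blockOp N h l *ᵥ Φ ∈ partialScar u ψ W := by
  rw [blockOp_eq_placeOp, placeOp_eq_sum_unitFamily h (blockSites_injective hN l),
    Matrix.sum_mulVec]
  refine Submodule.sum_mem _ fun s _ => ?_
  rw [Matrix.sum_mulVec]
  refine Submodule.sum_mem _ fun t _ => ?_
  rw [Matrix.smul_mulVec]
  refine Submodule.smul_mem _ _ (multiOp_mem_partialScar u (fun j hj => ?_) hΦ)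
  refine unitFamily_of_ne _ _ _ fun a ha => ?_
  exact Finset.disjoint_left.mp hd (mem_blockSet.mpr ⟨a, ha⟩) hj

variable (ψ) in
/-- `X` has no matrix elements between states that look like quasisymmetry states on `W`. -/
def NullOn (W : Finset (ZMod N)) (X : Op d N) : Prop :=
  ∀ Φ ∈ partialScar u ψ W, ∀ Φ' ∈ partialScar u ψ W, sand Φ X Φ' = 0

variable {u} in
theorem NullOn.mono {W W' : Finset (ZMod N)} {X : Op d N} (h : NullOn u ψ W X) (hW : W ⊆ W') :
    NullOn u ψ W' X :=
  fun Φ hΦ Φ' hΦ' => h Φ (partialScar_anti u hW hΦ) Φ' (partialScar_anti u hW hΦ')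

theorem nullOn_of_prodVec {W : Finset (ZMod N)} {X : Op d N}
    (h : ∀ (g g' : G) (a b : ZMod N → Fin d → ℂ), (∀ j ∈ W, a j = orbit u ψ g) →
      (∀ j ∈ W, b j = orbit u ψ g') → sand (prodVec a) X (prodVec b) = 0) : NullOn u ψ W X := by
  intro Φ hΦ Φ' hΦ'
  induction hΦ using Submodule.span_induction with
  | zero => exact sand_zero_left _ _
  | add x y _ _ hx hy => rw [sand_add_left, hx, hy, add_zero]
  | smul c x _ hx => rw [sand_smul_left, hx, mul_zero]
  | mem x hx =>
    obtain ⟨g, a, ha, rfl⟩ := hx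
    induction hΦ' using Submodule.span_induction with
    | zero => exact sand_zero_right _ _
    | add x y _ _ hx hy => rw [sand_add_right, hx, hy, add_zero]
    | smul c x _ hx => rw [sand_smul_right, hx, mul_zero]
    | mem x hx =>
      obtain ⟨g', b, hb, rfl⟩ := hx
      exact h g g' a b ha hb

variable {m : ℕ} {h : Matrix (Fin (m + 1) → Fin d) (Fin (m + 1) → Fin d) ℂ}

/-- Only the local factors on the block matter, so the rest of the chain can be filled conveniently.
If u(g)ψ and u(g')ψ are not orthogonal, extend both to the whole chain: by translation all N terms
of the vanishing matrix element of H are equal. If they are orthogonal, fill the outside of both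
states with u(g')ψ: the right state is still annihilated by H, and every other block misses a site
where the two states are orthogonal, so only the term at `l` survives. -/
theorem nullOn_blockOp (hψ : star ψ ⬝ᵥ ψ = 1) (hN : m + 2 ≤ N)
    (h0 : ∀ Φ ∈ scarSpace u ψ N, hamiltonian N h *ᵥ Φ = 0) (l : ZMod N) :
    NullOn u ψ (blockSet N m l) (blockOp N h l) := by
  refine nullOn_of_prodVec u fun g g' a b ha hb => ?_
  have hloc := localOn_blockOp (show m + 1 ≤ N by omega) h
  have hsum : ∀ Φ : State d N,
      ∑ l', sand Φ (blockOp N h l') (prodVec fun _ => orbit u ψ g') = 0 := by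
    intro Φ
    rw [← sand_sum_mid]
    exact (congrArg (star Φ ⬝ᵥ ·) (h0 _ (prodVec_orbit_mem u ψ N g'))).trans (by simp)
  by_cases ho : star (orbit u ψ g) ⬝ᵥ orbit u ψ g' = 0
  · refine sand_prodVec_eq_zero_of_agree (hloc l).comm
      (a' := fun j => if j ∈ blockSet N m l then orbit u ψ g else orbit u ψ g')
      (b' := fun _ => orbit u ψ g') (fun j hj => by simp [hj, ha j hj]) hb
      (fun j hj => by simp [hj, orbit_normalized u hψ]) ?_
    rw [← hsum, Finset.sum_eq_single l]
    · intro l' _ hl'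
      obtain ⟨j, hj, hj'⟩ := exists_mem_blockSet_notMem hN hl'.symm
      exact sand_prodVec_eq_zero_of_orthogonal ((hloc l').comm j hj') hψ (by simp [hj, ho])
    · simp
  · refine sand_prodVec_eq_zero_of_agree (hloc l).comm
      (a' := fun _ => orbit u ψ g) (b' := fun _ => orbit u ψ g') ha hb (fun _ _ => ho) ?_
    have hconst : ∀ l', sand (prodVec fun _ => orbit u ψ g) (blockOp N h l')
        (prodVec fun _ => orbit u ψ g') = sand (prodVec fun _ => orbit u ψ g) (blockOp N h l)
        (prodVec fun _ => orbit u ψ g') := by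
      intro l'
      have := sand_perm (shift (l' - l)) (prodVec fun _ => orbit u ψ g) (blockOp N h l)
        (prodVec fun _ => orbit u ψ g')
      rw [permOp_shift_blockOp, isSymm_prodVec_const, isSymm_prodVec_const] at this
      simpa using this
    have := hsum (prodVec fun _ => orbit u ψ g)
    simp_rw [hconst] at this
    simpa [NeZero.ne N] using this

theorem commute_blockOp (hN : m + 1 ≤ N) {l l' : ZMod N}
    (hd : Disjoint (blockSet N m l) (blockSet N m l')) :
    Commute (blockOp N h l) (blockOp N h l') := by
  refine commute_placeOp h h (blockSites_injective hN l) (blockSites_injective hN l')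
    fun a b hab => ?_
  exact Finset.disjoint_left.mp hd (mem_blockSet.mpr ⟨a, rfl⟩) (mem_blockSet.mpr ⟨b, hab⟩)

variable {u} in
-- The term at `l'` acts off the block at `l`, so it preserves the class of states on which the term
-- at `l` is null.
theorem nullOn_blockOp_mul (hN : m + 1 ≤ N) {l l' : ZMod N}
    (hd : Disjoint (blockSet N m l) (blockSet N m l'))
    (hnull : NullOn u ψ (blockSet N m l) (blockOp N h l)) :
    NullOn u ψ (blockSet N m l) (blockOp N h l * blockOp N h l') := by
  intro Φ hΦ Φ' hΦ'
  rw [sand_mul]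
  exact hnull Φ hΦ _ (blockOp_mem_partialScar u hN h hd.symm hΦ')

/-- For non-orthogonal rotated anchors, the matrix element of h_l H vanishes and each distant
product is null by itself, so the sum of the near ones vanishes. For orthogonal ones, the spare site
`p`, which lies in `W` but in none of the blocks, makes every product vanish separately. -/
theorem nullOn_near (hψ : star ψ ⬝ᵥ ψ = 1) (hN : m + 2 ≤ N)
    (h0 : ∀ Φ ∈ scarSpace u ψ N, hamiltonian N h *ᵥ Φ = 0) (l : ZMod N)
    {near W : Finset (ZMod N)} (hfar : ∀ t ∉ near, Disjoint (blockSet N m l) (blockSet N m t))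
    (hlW : blockSet N m l ⊆ W) (hnW : ∀ t ∈ near, blockSet N m t ⊆ W)
    {p : ZMod N} (hpW : p ∈ W) (hpl : p ∉ blockSet N m l)
    (hpn : ∀ t ∈ near, p ∉ blockSet N m t) :
    NullOn u ψ W (∑ t ∈ near, blockOp N h l * blockOp N h t) := by
  have hN' : m + 1 ≤ N := by omega
  have hloc := localOn_blockOp hN' h
  have hcomm : ∀ t, ∀ j ∉ blockSet N m l, j ∉ blockSet N m t →
      ∀ A, Commute (siteOp N A j) (blockOp N h l * blockOp N h t) := fun t j hj hj' A =>
    ((hloc l).comm j hj A).mul_right ((hloc t).comm j hj' A)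
  refine nullOn_of_prodVec u fun g g' a b ha hb => ?_
  by_cases ho : star (orbit u ψ g) ⬝ᵥ orbit u ψ g' = 0
  · rw [sand_sum_mid]
    refine Finset.sum_eq_zero fun t ht => ?_
    exact sand_prodVec_eq_zero_of_orthogonal (hcomm t p hpl (hpn t ht)) hψ
      (by rw [ha p hpW, hb p hpW, ho])
  · refine sand_prodVec_eq_zero_of_agree (W := W) (fun j hj A => ?_)
      (a' := fun _ => orbit u ψ g) (b' := fun _ => orbit u ψ g') ha hb (fun _ _ => ho) ?_
    · exact Commute.sum_right _ _ _ fun t ht =>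
        hcomm t j (fun hc => hj (hlW hc)) (fun hc => hj (hnW t ht hc)) A
    · have hg := prodVec_orbit_mem u ψ N g
      have hg' := prodVec_orbit_mem u ψ N g'
      have htot : sand (prodVec fun _ => orbit u ψ g) (∑ t, blockOp N h l * blockOp N h t)
          (prodVec fun _ => orbit u ψ g') = 0 := by
        rw [← Finset.mul_sum, sand_mul]
        refine (congrArg (sand _ _) (h0 _ hg')).trans (sand_zero_right _ _)
      rw [← Finset.sum_add_sum_compl near, sand_add_mid, sand_sum_mid nearᶜ] at htot
      rw [Finset.sum_eq_zero (s := nearᶜ), add_zero] at htot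
      · exact htot
      · intro t ht
        exact nullOn_blockOp_mul hN' (hfar t (Finset.mem_compl.mp ht))
          (nullOn_blockOp u hψ hN h0 l) _ (scarSpace_le_partialScar u _ hg) _
          (scarSpace_le_partialScar u _ hg')

end Null

end ScarTower

namespace ScarTower

/-- Used to move any finite configuration of distinct sites to any other of the same shape; with
permutation-symmetric states this shows that matrix elements do not depend on positions. -/
theorem exists_perm_extending {ι α : Type*} [Fintype α] {x y : ι → α}
    (hx : Function.Injective x) (hy : Function.Injective y) :
    ∃ π : Equiv.Perm α, ∀ i, π (x i) = y i := by
  classical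
  let e : {a // a ∈ Set.range x} ≃ {a // a ∈ Set.range y} :=
    (Equiv.ofInjective x hx).symm.trans (Equiv.ofInjective y hy)
  refine ⟨e.extendSubtype, fun i => ?_⟩
  rw [Equiv.extendSubtype_apply_of_mem e (x i) ⟨i, rfl⟩]
  have : (⟨x i, ⟨i, rfl⟩⟩ : Set.range x) = Equiv.ofInjective x hx i := rfl
  simp only [e, Equiv.trans_apply]
  erw [this, Equiv.symm_apply_apply]
  rfl

/-! ### Operator norm bounds independent of the size -/

section Norm

open scoped Matrix.Norms.L2Operator

variable {d N : ℕ} [NeZero N]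

theorem norm_sand_le (Φ : State d N) (X : Op d N) (Φ' : State d N) :
    ‖sand Φ X Φ'‖ ≤ ‖WithLp.toLp 2 Φ‖ * (‖X‖ * ‖WithLp.toLp 2 Φ'‖) := by
  have h1 : sand Φ X Φ' = inner ℂ (WithLp.toLp 2 Φ) (WithLp.toLp 2 (X *ᵥ Φ')) := by
    rw [EuclideanSpace.inner_toLp_toLp, dotProduct_comm]
    rfl
  rw [h1]
  refine (norm_inner_le_norm _ _).trans ?_
  gcongr
  exact Matrix.l2_opNorm_mulVec X (WithLp.toLp 2 Φ')

theorem sand_one_self (Φ : State d N) : sand Φ 1 Φ = ((‖WithLp.toLp 2 Φ‖ ^ 2 : ℝ) : ℂ) := by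
  rw [sand_one, dotProduct_comm]
  have := inner_self_eq_norm_sq_to_K (𝕜 := ℂ) (WithLp.toLp 2 Φ : EuclideanSpace ℂ (Config d N))
  rw [EuclideanSpace.inner_toLp_toLp] at this
  rw [this]
  norm_cast

theorem norm_sand_le_of_eq {Φ Φ' : State d N} (X : Op d N) {x : ℂ} (h : sand Φ 1 Φ = x)
    (h' : sand Φ' 1 Φ' = x) : ‖sand Φ X Φ'‖ ≤ ‖X‖ * ‖x‖ := by
  rw [sand_one_self] at h h'
  have hn : ‖WithLp.toLp 2 Φ‖ ^ 2 = ‖x‖ := by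
    rw [← h, Complex.norm_real, Real.norm_of_nonneg (by positivity)]
  have hn' : ‖WithLp.toLp 2 Φ'‖ ^ 2 = ‖x‖ := by
    rw [← h', Complex.norm_real, Real.norm_of_nonneg (by positivity)]
  have he : ‖WithLp.toLp 2 Φ'‖ = ‖WithLp.toLp 2 Φ‖ := by
    rw [← sq_eq_sq₀ (norm_nonneg _) (norm_nonneg _), hn, hn']
  refine (norm_sand_le Φ X Φ').trans (le_of_eq ?_)
  rw [he, ← hn]
  ring

/-- `Xᴴ * X` is a self-adjoint idempotent, so by the C*-identity its norm equals its own square and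
is at most 1; the same identity passes this to `X`. -/
theorem norm_le_one_of_idempotent {X : Op d N}
    (h : (Xᴴ * X) * (Xᴴ * X) = Xᴴ * X) : ‖X‖ ≤ 1 := by
  have h1 : ‖Xᴴ * X‖ = ‖X‖ * ‖X‖ := CStarRing.norm_star_mul_self
  have h2 : ‖Xᴴ * X‖ = ‖Xᴴ * X‖ * ‖Xᴴ * X‖ := by
    have : ‖(Xᴴ * X)ᴴ * (Xᴴ * X)‖ = _ := CStarRing.norm_star_mul_self
    rwa [Matrix.conjTranspose_mul, Matrix.conjTranspose_conjTranspose, h] at this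
  have h3 : ‖Xᴴ * X‖ ≤ 1 := by nlinarith [norm_nonneg (Xᴴ * X)]
  nlinarith [norm_nonneg X]

theorem norm_multiOp_unitFamily_le {m : ℕ} {f : Fin (m + 1) → ZMod N}
    (hf : Function.Injective f) (s t : Fin (m + 1) → Fin d) :
    ‖(multiOp (unitFamily f s t) : Op d N)‖ ≤ 1 := by
  apply norm_le_one_of_idempotent
  rw [multiOp_conjTranspose, multiOp_mul, multiOp_mul]
  congr 1
  ext j : 1
  by_cases hj : ∃ a, j = f a
  · obtain ⟨a, rfl⟩ := hj
    rw [unitFamily_apply hf]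
    simp
  · push Not at hj
    rw [unitFamily_of_ne _ _ _ hj]
    simp

theorem norm_blockOp_le {m : ℕ} (hN : m + 1 ≤ N)
    (h : Matrix (Fin (m + 1) → Fin d) (Fin (m + 1) → Fin d) ℂ) (l : ZMod N) :
    ‖blockOp N h l‖ ≤ ∑ s, ∑ t, ‖h s t‖ := by
  have hf := blockSites_injective hN l
  rw [blockOp_eq_placeOp, placeOp_eq_sum_unitFamily h hf]
  refine (norm_sum_le _ _).trans (Finset.sum_le_sum fun s _ => (norm_sum_le _ _).trans
    (Finset.sum_le_sum fun t _ => ?_))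
  rw [norm_smul]
  exact mul_le_of_le_one_right (norm_nonneg _) (norm_multiOp_unitFamily_le hf s t)

end Norm

/-! ### Twisted states: change of reference site, translation, norm -/

section Twisted

variable {d N : ℕ} [NeZero N]

/-- The state `∑ⱼ χ(j) qⱼ Ψ`. -/
noncomputable def twist (χ : ZMod N → ℂ) (q : Matrix (Fin d) (Fin d) ℂ) (Ψ : State d N) :
    State d N :=
  ∑ j, χ j • (siteOp N q j *ᵥ Ψ)

/-- The state `(qⱼ - qᵣ) Ψ`. -/
noncomputable def siteDiff (q : Matrix (Fin d) (Fin d) ℂ) (Ψ : State d N) (r j : ZMod N) :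
    State d N :=
  siteOp N q j *ᵥ Ψ - siteOp N q r *ᵥ Ψ

variable (q : Matrix (Fin d) (Fin d) ℂ)

theorem IsSymm.permState_siteOp {Ψ : State d N} (hΨ : IsSymm Ψ) (π : Equiv.Perm (ZMod N))
    (j : ZMod N) : permState π (siteOp N q j *ᵥ Ψ) = siteOp N q (π j) *ᵥ Ψ := by
  rw [permState_mulVec, permOp_siteOp, hΨ π]

theorem IsSymm.permState_siteDiff {Ψ : State d N} (hΨ : IsSymm Ψ) (π : Equiv.Perm (ZMod N))
    (r j : ZMod N) : permState π (siteDiff q Ψ r j) = siteDiff q Ψ (π r) (π j) := by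
  rw [siteDiff, permState_sub, hΨ.permState_siteOp, hΨ.permState_siteOp, siteDiff]

theorem twist_eq_sum_siteDiff {χ : ZMod N → ℂ} (hχ : ∑ j, χ j = 0) (Ψ : State d N)
    (r : ZMod N) : twist χ q Ψ = ∑ j, χ j • siteDiff q Ψ r j := by
  simp only [siteDiff, smul_sub, Finset.sum_sub_distrib, ← Finset.sum_smul, hχ, zero_smul,
    sub_zero, twist]

/-- For a character χ and a symmetric Ψ the twisted state is an eigenvector of translations, with an
eigenvalue of modulus one that cancels in expectations. -/
theorem sand_twist_shift {χ : ZMod N → ℂ} (hadd : ∀ i j, χ (i + j) = χ i * χ j)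
    (hunit : ∀ i, star (χ i) * χ i = 1) {Ψ : State d N} (hΨ : IsSymm Ψ) (X : Op d N)
    (t : ZMod N) :
    sand (twist χ q Ψ) (permOp (shift t) X) (twist χ q Ψ)
      = sand (twist χ q Ψ) X (twist χ q Ψ) := by
  have h1 : twist χ q Ψ = χ t • permState (shift t) (twist χ q Ψ) := by
    simp only [twist]
    rw [permState_sum, Finset.smul_sum, ← Equiv.sum_comp (shift t)]
    refine Finset.sum_congr rfl fun j _ => ?_
    rw [permState_smul, hΨ.permState_siteOp, smul_smul, Equiv.coe_addRight, hadd, mul_comm]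
  conv_lhs => rw [h1]
  rw [sand_smul_left, sand_smul_right, sand_perm, ← mul_assoc, hunit, one_mul]

theorem sand_siteOp_const {Ψ : State d N} (hΨ : IsSymm Ψ) {i j i' j' : ZMod N}
    (h : i ≠ j) (h' : i' ≠ j') :
    sand (siteOp N q i *ᵥ Ψ) 1 (siteOp N q j *ᵥ Ψ)
      = sand (siteOp N q i' *ᵥ Ψ) 1 (siteOp N q j' *ᵥ Ψ) := by
  obtain ⟨π, hπ⟩ := exists_perm_extending (x := ![i, j]) (y := ![i', j'])
    (by intro a b; fin_cases a <;> fin_cases b <;> simp [h, h.symm])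
    (by intro a b; fin_cases a <;> fin_cases b <;> simp [h', h'.symm])
  have h0 : π i = i' := hπ 0
  have h1 : π j = j' := hπ 1
  rw [← sand_perm π, permOp_one, hΨ.permState_siteOp, hΨ.permState_siteOp, h0, h1]

theorem sand_siteDiff_self_const {Ψ : State d N} (hΨ : IsSymm Ψ) {r i r' i' : ZMod N}
    (h : i ≠ r) (h' : i' ≠ r') :
    sand (siteDiff q Ψ r i) 1 (siteDiff q Ψ r i)
      = sand (siteDiff q Ψ r' i') 1 (siteDiff q Ψ r' i') := by
  obtain ⟨π, hπ⟩ := exists_perm_extending (x := ![i, r]) (y := ![i', r'])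
    (by intro a b; fin_cases a <;> fin_cases b <;> simp [h, h.symm])
    (by intro a b; fin_cases a <;> fin_cases b <;> simp [h', h'.symm])
  have h0 : π i = i' := hπ 0
  have h1 : π r = r' := hπ 1
  rw [← sand_perm π, permOp_one, hΨ.permState_siteDiff, h0, h1]

/-- The Gram matrix of the states q_j Ψ has one value a on the diagonal and one value c off it. The
constant part is killed by ∑ χ = 0, leaving N(a - c), while the squared norm of (q_i - q_r)Ψ is 2(a
- c). -/
theorem sand_twist_self {χ : ZMod N → ℂ} (hχ : ∑ j, χ j = 0)
    (hunit : ∀ i, star (χ i) * χ i = 1) {Ψ : State d N} (hΨ : IsSymm Ψ) {r i₀ : ZMod N}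
    (h : i₀ ≠ r) :
    sand (twist χ q Ψ) 1 (twist χ q Ψ)
      = N * (sand (siteDiff q Ψ r i₀) 1 (siteDiff q Ψ r i₀) / 2) := by
  set S := fun j : ZMod N => siteOp N q j *ᵥ Ψ with hS
  set c := sand (S i₀) 1 (S r) with hc
  set a := sand (S r) 1 (S r) with ha
  have hdiag : ∀ i, sand (S i) 1 (S i) = a := fun i => by
    rw [ha, ← sand_perm (Equiv.swap i r), permOp_one]
    simp only [hS, hΨ.permState_siteOp, Equiv.swap_apply_left]
  have hoff : ∀ i j, sand (S i) 1 (S j) = c + if i = j then a - c else 0 := fun i j => by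
    split_ifs with hij
    · subst hij; rw [hdiag]; ring
    · rw [add_zero]; exact sand_siteOp_const q hΨ hij h
  have h1 : sand (siteDiff q Ψ r i₀) 1 (siteDiff q Ψ r i₀) = 2 * (a - c) := by
    change sand (S i₀ - S r) 1 (S i₀ - S r) = _
    rw [sand_sub_left, sand_sub_right, sand_sub_right, hoff, hoff, hoff r i₀, hoff r r]
    simp only [h, h.symm, if_true, if_false]
    ring
  rw [h1, twist, sand_sum_left]
  simp_rw [sand_sum_right, sand_smul_left, sand_smul_right]
  have h2 : ∀ i, ∑ j, star (χ i) * (χ j * sand (siteOp N q i *ᵥ Ψ) 1 (siteOp N q j *ᵥ Ψ))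
      = a - c := fun i => by
    change ∑ j, star (χ i) * (χ j * sand (S i) 1 (S j)) = _
    simp_rw [hoff, mul_add, Finset.sum_add_distrib, ← Finset.mul_sum, ← Finset.sum_mul, hχ]
    simp only [zero_mul, mul_zero, zero_add, mul_ite, Finset.sum_ite_eq, Finset.mem_univ, if_true]
    rw [← mul_assoc, hunit, one_mul]
  simp_rw [h2]
  simp only [Finset.sum_const, Finset.card_univ, ZMod.card, nsmul_eq_mul]
  ring

end Twisted

/-! ### Localisation of expectation values in twisted states -/

section Core

variable {d : ℕ} {G : Type*} [Group G] {u : G →* Matrix.unitaryGroup (Fin d) ℂ}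
variable {ψ : Fin d → ℂ} {N : ℕ} [NeZero N] (q : Matrix (Fin d) (Fin d) ℂ) {Ψ : State d N}

theorem siteDiff_mem_partialScar (hΨ : Ψ ∈ scarSpace u ψ N) {W : Finset (ZMod N)} {r j : ZMod N}
    (hr : r ∉ W) (hj : j ∉ W) : siteDiff q Ψ r j ∈ partialScar u ψ W :=
  Submodule.sub_mem _ (siteOp_mem_partialScar u q hj (scarSpace_le_partialScar u W hΨ))
    (siteOp_mem_partialScar u q hr (scarSpace_le_partialScar u W hΨ))

/-- Although a single q_j with j in `W` destroys the quasisymmetry form on `W`, the sum over `W`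
equals QΨ, again a quasisymmetry state, minus terms in which q acts off `W`. This is the source of
the vanishing at k = 0. -/
theorem sum_siteDiff_mem_partialScar (hΨ : Ψ ∈ scarSpace u ψ N)
    (hQ : collectiveOp N q *ᵥ Ψ ∈ scarSpace u ψ N) {W : Finset (ZMod N)} {r : ZMod N}
    (hr : r ∉ W) : ∑ j ∈ W, siteDiff q Ψ r j ∈ partialScar u ψ W := by
  have h1 : ∀ j ∉ W, siteOp N q j *ᵥ Ψ ∈ partialScar u ψ W := fun j hj =>
    siteOp_mem_partialScar u q hj (scarSpace_le_partialScar u W hΨ)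
  have h2 : ∑ j ∈ W, siteDiff q Ψ r j = collectiveOp N q *ᵥ Ψ
      - ∑ j ∈ Wᶜ, siteOp N q j *ᵥ Ψ - ∑ j ∈ W, siteOp N q r *ᵥ Ψ := by
    rw [collectiveOp, Matrix.sum_mulVec, ← Finset.sum_add_sum_compl W]
    simp [siteDiff]
  rw [h2]
  refine Submodule.sub_mem _ (Submodule.sub_mem _ (scarSpace_le_partialScar u W hQ) ?_) ?_
  · exact Submodule.sum_mem _ fun j hj => h1 j (Finset.mem_compl.mp hj)
  · exact Submodule.sum_mem _ fun _ _ => h1 r hr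

/-- If both sites are off `W`, both states look like quasisymmetry states on `W` and nullity
applies. If just one is, nullity removes the q_r part from the other state, and the swap of the
outside site with `r` fixes everything except the difference, whose two terms therefore cancel. -/
theorem sand_siteDiff_eq_zero (hΨ : Ψ ∈ scarSpace u ψ N) {W : Finset (ZMod N)} {X : Op d N}
    (hloc : LocalOn W X) (hnull : NullOn u ψ W X) {r i j : ZMod N} (hr : r ∉ W)
    (hij : i ∉ W ∨ j ∉ W) : sand (siteDiff q Ψ r i) X (siteDiff q Ψ r j) = 0 := by
  have hs := isSymm_of_mem_scarSpace u hΨ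
  have hS : ∀ j ∉ W, siteOp N q j *ᵥ Ψ ∈ partialScar u ψ W := fun j hj =>
    siteOp_mem_partialScar u q hj (scarSpace_le_partialScar u W hΨ)
  have hswap : ∀ j ∉ W, permOp (Equiv.swap j r) X = X := fun j hj =>
    hloc.perm _ fun i hi => Equiv.swap_apply_of_ne_of_ne (ne_of_mem_of_not_mem hi hj)
      (ne_of_mem_of_not_mem hi hr)
  by_cases hi : i ∈ W
  · have hj : j ∉ W := hij.resolve_left (not_not.mpr hi)
    have hD := siteDiff_mem_partialScar q hΨ hr hj
    rw [siteDiff, sand_sub_left, hnull _ (hS r hr) _ hD, sub_zero, siteDiff, sand_sub_right,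
      ← sand_perm (Equiv.swap j r), hswap j hj, hs.permState_siteOp, hs.permState_siteOp,
      Equiv.swap_apply_left, Equiv.swap_apply_of_ne_of_ne (ne_of_mem_of_not_mem hi hj)
      (ne_of_mem_of_not_mem hi hr), sub_self]
  · have hD := siteDiff_mem_partialScar q hΨ hr hi
    by_cases hj : j ∈ W
    · rw [siteDiff.eq_1 q Ψ r j, sand_sub_right, hnull _ hD _ (hS r hr), sub_zero, siteDiff,
        sand_sub_left, ← sand_perm (Equiv.swap i r), hswap i hi, hs.permState_siteOp,
        hs.permState_siteOp, Equiv.swap_apply_left, Equiv.swap_apply_of_ne_of_ne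
        (ne_of_mem_of_not_mem hj hi) (ne_of_mem_of_not_mem hj hr), sub_self]
    · exact hnull _ hD _ (siteDiff_mem_partialScar q hΨ hr hj)

theorem sand_twist_eq {χ : ZMod N → ℂ} (hχ : ∑ j, χ j = 0) (hΨ : Ψ ∈ scarSpace u ψ N)
    {W : Finset (ZMod N)} {X : Op d N} (hloc : LocalOn W X) (hnull : NullOn u ψ W X)
    {r : ZMod N} (hr : r ∉ W) :
    sand (twist χ q Ψ) X (twist χ q Ψ)
      = ∑ i ∈ W, ∑ j ∈ W, star (χ i) * χ j * sand (siteDiff q Ψ r i) X (siteDiff q Ψ r j) := by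
  rw [twist_eq_sum_siteDiff q hχ Ψ r, sand_sum_left]
  simp_rw [sand_sum_right, sand_smul_left, sand_smul_right, ← mul_assoc]
  rw [← Finset.sum_subset (Finset.subset_univ W)]
  · refine Finset.sum_congr rfl fun i _ => ?_
    rw [← Finset.sum_subset (Finset.subset_univ W)]
    intro j _ hj
    rw [sand_siteDiff_eq_zero q hΨ hloc hnull hr (Or.inr hj), mul_zero]
  · intro i _ hi
    refine Finset.sum_eq_zero fun j _ => ?_
    rw [sand_siteDiff_eq_zero q hΨ hloc hnull hr (Or.inl hi), mul_zero]

theorem sum_sand_siteDiff_eq_zero (hΨ : Ψ ∈ scarSpace u ψ N)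
    (hQ : collectiveOp N q *ᵥ Ψ ∈ scarSpace u ψ N)
    {W : Finset (ZMod N)} {X : Op d N} (hnull : NullOn u ψ W X) {r : ZMod N} (hr : r ∉ W) :
    ∑ i ∈ W, ∑ j ∈ W, sand (siteDiff q Ψ r i) X (siteDiff q Ψ r j) = 0 := by
  have hD := sum_siteDiff_mem_partialScar q hΨ hQ hr
  simp_rw [← sand_sum_right]
  rw [← sand_sum_left]
  exact hnull _ hD _ hD

variable {m : ℕ} {h : Matrix (Fin (m + 1) → Fin d) (Fin (m + 1) → Fin d) ℂ}

theorem sum_blockSet {M : Type*} [AddCommMonoid M] (hN : m + 1 ≤ N) (l : ZMod N)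
    (F : ZMod N → M) :
    ∑ j ∈ blockSet N m l, F j = ∑ a : Fin (m + 1), F (l + ((a : ℕ) : ZMod N)) := by
  rw [blockSet, Finset.sum_image fun a _ b _ hab => blockSites_injective hN l hab]

theorem nullOn_blockOp_mul_right (hN : m + 1 ≤ N) {l l' : ZMod N}
    (hd : Disjoint (blockSet N m l) (blockSet N m l'))
    (hnull : NullOn u ψ (blockSet N m l') (blockOp N h l')) :
    NullOn u ψ (blockSet N m l') (blockOp N h l * blockOp N h l') := by
  rw [(commute_blockOp hN hd).eq]
  exact nullOn_blockOp_mul hN hd.symm hnull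

/-- The product of two disjoint terms is null on each block separately. Hence pairs of sites in the
same block contribute nothing, and only the mixed pairs remain. -/
theorem sand_twist_far_eq {χ : ZMod N → ℂ} (hχ : ∑ j, χ j = 0) (hΨ : Ψ ∈ scarSpace u ψ N)
    (hN : m + 1 ≤ N) (hnull : ∀ l, NullOn u ψ (blockSet N m l) (blockOp N h l))
    {l l' : ZMod N} (hd : Disjoint (blockSet N m l) (blockSet N m l')) {r : ZMod N}
    (hr : r ∉ blockSet N m l) (hr' : r ∉ blockSet N m l') :
    sand (twist χ q Ψ) (blockOp N h l * blockOp N h l') (twist χ q Ψ)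
      = ∑ i ∈ blockSet N m l, ∑ j ∈ blockSet N m l', (star (χ i) * χ j *
          sand (siteDiff q Ψ r i) (blockOp N h l * blockOp N h l') (siteDiff q Ψ r j)
        + star (χ j) * χ i *
          sand (siteDiff q Ψ r j) (blockOp N h l * blockOp N h l') (siteDiff q Ψ r i)) := by
  set X := blockOp N h l * blockOp N h l' with hX
  have hXl : NullOn u ψ (blockSet N m l) X := nullOn_blockOp_mul hN hd (hnull l)
  have hXl' : NullOn u ψ (blockSet N m l') X := nullOn_blockOp_mul_right hN hd (hnull l')
  have hloc : LocalOn (blockSet N m l ∪ blockSet N m l') X :=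
    ((localOn_blockOp hN h l).mono Finset.subset_union_left).mul
      ((localOn_blockOp hN h l').mono Finset.subset_union_right)
  rw [sand_twist_eq q hχ hΨ hloc (hXl.mono Finset.subset_union_left)
    (by simp [hr, hr'] : r ∉ blockSet N m l ∪ blockSet N m l'), Finset.sum_union hd]
  simp_rw [Finset.sum_union hd, Finset.sum_add_distrib]
  rw [Finset.sum_eq_zero (s := blockSet N m l), Finset.sum_eq_zero (s := blockSet N m l')
    (f := fun i => ∑ j ∈ blockSet N m l', _), zero_add, add_zero]
  · congr 1
    exact Finset.sum_comm
  · refine fun i hi => Finset.sum_eq_zero fun j hj => ?_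
    rw [hXl _ (siteDiff_mem_partialScar q hΨ hr (Finset.disjoint_right.mp hd hi)) _
      (siteDiff_mem_partialScar q hΨ hr (Finset.disjoint_right.mp hd hj)), mul_zero]
  · refine fun i hi => Finset.sum_eq_zero fun j hj => ?_
    rw [hXl' _ (siteDiff_mem_partialScar q hΨ hr' (Finset.disjoint_left.mp hd hi)) _
      (siteDiff_mem_partialScar q hΨ hr' (Finset.disjoint_left.mp hd hj)), mul_zero]

/-- Nullity on the block at `l'` suffices: the sum over the other block acts off it, and the sum
over `l'` itself is covered by `sum_siteDiff_mem_partialScar`. -/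
theorem sum_sand_far_eq_zero (hΨ : Ψ ∈ scarSpace u ψ N)
    (hQ : collectiveOp N q *ᵥ Ψ ∈ scarSpace u ψ N)
    (hN : m + 1 ≤ N) (hnull : ∀ l, NullOn u ψ (blockSet N m l) (blockOp N h l))
    {l l' : ZMod N} (hd : Disjoint (blockSet N m l) (blockSet N m l')) {r : ZMod N}
    (hr' : r ∉ blockSet N m l') :
    ∑ i ∈ blockSet N m l, ∑ j ∈ blockSet N m l',
        sand (siteDiff q Ψ r i) (blockOp N h l * blockOp N h l') (siteDiff q Ψ r j) = 0 ∧
      ∑ i ∈ blockSet N m l, ∑ j ∈ blockSet N m l',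
        sand (siteDiff q Ψ r j) (blockOp N h l * blockOp N h l') (siteDiff q Ψ r i) = 0 := by
  have hXl' : NullOn u ψ (blockSet N m l') (blockOp N h l * blockOp N h l') :=
    nullOn_blockOp_mul_right hN hd (hnull l')
  have h1 : ∑ i ∈ blockSet N m l, siteDiff q Ψ r i ∈ partialScar u ψ (blockSet N m l') :=
    Submodule.sum_mem _ fun i hi =>
      siteDiff_mem_partialScar q hΨ hr' (Finset.disjoint_left.mp hd hi)
  have h2 := sum_siteDiff_mem_partialScar q hΨ hQ hr'
  constructor
  · simp_rw [← sand_sum_right]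
    rw [← sand_sum_left]
    exact hXl' _ h1 _ h2
  · rw [Finset.sum_comm]
    simp_rw [← sand_sum_right]
    rw [← sand_sum_left]
    exact hXl' _ h2 _ h1

/-- The matrix elements of two distant local terms do not depend on their distance. -/
theorem sand_far_const (hs : IsSymm Ψ) (hN : m + 1 ≤ N) {l l' l'' r r'' : ZMod N}
    (hd : Disjoint (blockSet N m l) (blockSet N m l'))
    (hd' : Disjoint (blockSet N m l) (blockSet N m l''))
    (hr : r ∉ blockSet N m l) (hr' : r ∉ blockSet N m l')
    (hr'' : r'' ∉ blockSet N m l) (hr''' : r'' ∉ blockSet N m l'') (a b : Fin (m + 1)) :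
    sand (siteDiff q Ψ r (l + (a : ℕ))) (blockOp N h l * blockOp N h l')
        (siteDiff q Ψ r (l' + (b : ℕ)))
      = sand (siteDiff q Ψ r'' (l + (a : ℕ))) (blockOp N h l * blockOp N h l'')
        (siteDiff q Ψ r'' (l'' + (b : ℕ))) ∧
    sand (siteDiff q Ψ r (l' + (b : ℕ))) (blockOp N h l * blockOp N h l')
        (siteDiff q Ψ r (l + (a : ℕ)))
      = sand (siteDiff q Ψ r'' (l'' + (b : ℕ))) (blockOp N h l * blockOp N h l'')
        (siteDiff q Ψ r'' (l + (a : ℕ))) := by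
  have hinj : ∀ {l' r : ZMod N}, Disjoint (blockSet N m l) (blockSet N m l') →
      r ∉ blockSet N m l → r ∉ blockSet N m l' →
      Function.Injective (Sum.elim (fun a : Fin (m + 1) => l + ((a : ℕ) : ZMod N))
        (Sum.elim (fun a : Fin (m + 1) => l' + ((a : ℕ) : ZMod N)) (fun _ : Unit => r))) := by
    intro l' r hd hr hr'
    refine (blockSites_injective hN l).sumElim ((blockSites_injective hN l').sumElim
      (fun _ _ _ => rfl) fun a _ hc => hr' (mem_blockSet.mpr ⟨a, hc.symm⟩)) ?_
    rintro a (b | _) hc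
    · exact Finset.disjoint_left.mp hd (mem_blockSet.mpr ⟨a, rfl⟩) (mem_blockSet.mpr ⟨b, hc⟩)
    · exact hr (mem_blockSet.mpr ⟨a, hc.symm⟩)
  -- The permutation fixes the first block sitewise and carries the second block and the reference
  -- site to their new positions.
  obtain ⟨π, hπ⟩ := exists_perm_extending (hinj hd hr hr') (hinj hd' hr'' hr''')
  have hl : ∀ a : Fin (m + 1), π (l + ((a : ℕ) : ZMod N)) = l + ((a : ℕ) : ZMod N) :=
    fun a => hπ (Sum.inl a)
  have hl' : ∀ a : Fin (m + 1), π (l' + ((a : ℕ) : ZMod N)) = l'' + ((a : ℕ) : ZMod N) :=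
    fun a => hπ (Sum.inr (Sum.inl a))
  have hπr : π r = r'' := hπ (Sum.inr (Sum.inr ()))
  have hX : permOp π (blockOp N h l * blockOp N h l') = blockOp N h l * blockOp N h l'' := by
    rw [permOp_mul, blockOp_eq_placeOp, blockOp_eq_placeOp, blockOp_eq_placeOp, permOp_placeOp,
      permOp_placeOp]
    congr 2
    · ext a; exact hl a
    · ext a; exact hl' a
  constructor
  · rw [← sand_perm π, hX, hs.permState_siteDiff, hs.permState_siteDiff, hπr, hl, hl']
  · rw [← sand_perm π, hX, hs.permState_siteDiff, hs.permState_siteDiff, hπr, hl, hl']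

end Core

end ScarTower

namespace ScarTower

/-! ### Limits of bounded rational functions of the size -/

open Filter Topology Polynomial

theorem tendsto_eval_div_pow (p : ℂ[X]) {D : ℕ} (hD : p.natDegree ≤ D) :
    Tendsto (fun n : ℕ => p.eval (n : ℂ) / (n : ℂ) ^ D) atTop (𝓝 (p.coeff D)) := by
  have h1 : ∀ i ∈ Finset.range (D + 1), Tendsto (fun n : ℕ => p.coeff i * (n : ℂ)⁻¹ ^ (D - i))
      atTop (𝓝 (p.coeff i * 0 ^ (D - i))) := fun i _ =>
    (tendsto_inv_atTop_nhds_zero_nat (𝕜 := ℂ)).pow (D - i) |>.const_mul _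
  have h2 := tendsto_finsetSum _ h1
  have h3 : ∑ i ∈ Finset.range (D + 1), p.coeff i * (0 : ℂ) ^ (D - i) = p.coeff D := by
    rw [Finset.sum_range_succ, Finset.sum_eq_zero]
    · simp
    · intro i hi
      rw [zero_pow (by have := Finset.mem_range.mp hi; omega), mul_zero]
  rw [h3] at h2
  refine h2.congr' ?_
  filter_upwards [eventually_gt_atTop 0] with n hn
  have hn' : (n : ℂ) ≠ 0 := by exact_mod_cast hn.ne'
  rw [Polynomial.eval_eq_sum_range' (Nat.lt_succ_of_le hD), Finset.sum_div]
  refine Finset.sum_congr rfl fun i hi => ?_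
  have hi' : i ≤ D := Nat.lt_succ_iff.mp (Finset.mem_range.mp hi)
  rw [mul_div_assoc]
  congr 1
  rw [eq_div_iff (pow_ne_zero _ hn'), ← Nat.sub_add_cancel hi', pow_add, ← mul_assoc,
    Nat.sub_add_cancel hi', ← mul_pow, inv_mul_cancel₀ hn', one_pow, one_mul]

/-- A bounded rational function of `n` converges as `n → ∞`. -/
theorem exists_tendsto_eval_div_eval {p q : ℂ[X]} {C : ℝ}
    (h : ∀ᶠ n : ℕ in atTop, ‖p.eval (n : ℂ)‖ ≤ C * ‖q.eval (n : ℂ)‖) :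
    ∃ L, Tendsto (fun n : ℕ => p.eval (n : ℂ) / q.eval (n : ℂ)) atTop (𝓝 L) := by
  by_cases hq : q = 0
  · exact ⟨0, by simp [hq]⟩
  -- If `p` had the larger degree, dividing the bound by n^{deg p} would send its right side to 0
  -- and force the leading coefficient of `p` to vanish.
  have hdeg : p.natDegree ≤ q.natDegree := by
    by_contra! hlt
    have hp := tendsto_eval_div_pow p le_rfl
    have hq' := tendsto_eval_div_pow q hlt.le
    rw [coeff_eq_zero_of_natDegree_lt hlt] at hq'
    have h1 : Tendsto (fun n : ℕ => p.eval (n : ℂ) / (n : ℂ) ^ p.natDegree) atTop (𝓝 0) := by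
      have h2 := hq'.norm.const_mul C
      rw [norm_zero, mul_zero] at h2
      refine squeeze_zero_norm' ?_ h2
      filter_upwards [h] with n hn
      rw [norm_div, norm_div, ← mul_div_assoc]
      gcongr
    have h3 : p.leadingCoeff = 0 := tendsto_nhds_unique hp h1
    rw [leadingCoeff_eq_zero] at h3
    simp [h3] at hlt
  refine ⟨_, ((tendsto_eval_div_pow p hdeg).div (tendsto_eval_div_pow q le_rfl)
    (by simpa using hq)).congr' ?_⟩
  filter_upwards [eventually_gt_atTop 0] with n hn
  have hn' : (n : ℂ) ≠ 0 := by exact_mod_cast hn.ne'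
  exact div_div_div_cancel_right₀ (pow_ne_zero _ hn') _ _

/-- Agreement with a polynomial for all large arguments. -/
def EventuallyPoly (f : ℕ → ℂ) : Prop := ∃ p : ℂ[X], ∀ᶠ n : ℕ in atTop, f n = p.eval (n : ℂ)

theorem EventuallyPoly.congr {f g : ℕ → ℂ} (hf : EventuallyPoly f)
    (h : ∀ᶠ n in atTop, g n = f n) : EventuallyPoly g := by
  obtain ⟨p, hp⟩ := hf
  exact ⟨p, by filter_upwards [hp, h] with n h1 h2; rw [h2, h1]⟩

theorem EventuallyPoly.add {f g : ℕ → ℂ} (hf : EventuallyPoly f) (hg : EventuallyPoly g) :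
    EventuallyPoly (fun n => f n + g n) := by
  obtain ⟨p, hp⟩ := hf
  obtain ⟨q, hq⟩ := hg
  exact ⟨p + q, by filter_upwards [hp, hq] with n h1 h2; rw [eval_add, h1, h2]⟩

theorem EventuallyPoly.mul {f g : ℕ → ℂ} (hf : EventuallyPoly f) (hg : EventuallyPoly g) :
    EventuallyPoly (fun n => f n * g n) := by
  obtain ⟨p, hp⟩ := hf
  obtain ⟨q, hq⟩ := hg
  exact ⟨p * q, by filter_upwards [hp, hq] with n h1 h2; rw [eval_mul, h1, h2]⟩

theorem eventuallyPoly_const (c : ℂ) : EventuallyPoly (fun _ => c) := ⟨C c, by simp⟩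

theorem eventuallyPoly_natCast : EventuallyPoly (fun n => (n : ℂ)) := ⟨X, by simp⟩

theorem EventuallyPoly.sum {ι : Type*} {s : Finset ι} {f : ι → ℕ → ℂ}
    (h : ∀ i ∈ s, EventuallyPoly (f i)) : EventuallyPoly (fun n => ∑ i ∈ s, f i n) := by
  classical
  induction s using Finset.induction_on with
  | empty => simpa using eventuallyPoly_const 0
  | insert i s hi ih =>
    simp_rw [Finset.sum_insert hi]
    exact (h i (Finset.mem_insert_self _ _)).add
      (ih fun j hj => h j (Finset.mem_insert_of_mem hj))

/-! ### Expectation values polynomial in the size -/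

section Words

variable (d : ℕ)

/-- Families of operators, one for each chain of `n + 1` sites. -/
abbrev OpFamily : Type := ∀ n : ℕ, Op d (n + 1)

variable {d}

/-- The product operators of a sequence of one-site operators. -/
noncomputable def multiFamily (F : ℕ → Matrix (Fin d) (Fin d) ℂ) : OpFamily d :=
  fun _ => multiOp fun j => F j.val

/-- The collective operators of a one-site operator. -/
noncomputable def collectiveFamily (A : Matrix (Fin d) (Fin d) ℂ) : OpFamily d :=
  fun n => collectiveOp (n + 1) A

variable (d) in
/-- The generators of the algebra of families with polynomial expectation values. -/
def letters : Set (OpFamily d) :=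
  {X | ∃ (F : ℕ → Matrix (Fin d) (Fin d) ℂ) (n₀ : ℕ), (∀ j ≥ n₀, F j = 1) ∧ X = multiFamily F} ∪
    Set.range collectiveFamily

theorem multiFamily_mul (F F' : ℕ → Matrix (Fin d) (Fin d) ℂ) :
    multiFamily F * multiFamily F' = multiFamily (F * F') := by
  funext n
  exact multiOp_mul _ _

theorem multiFamily_one : multiFamily (1 : ℕ → Matrix (Fin d) (Fin d) ℂ) = 1 := by
  funext n
  exact multiOp_one

theorem permOp_multiOp {N : ℕ} [NeZero N] (π : Equiv.Perm (ZMod N))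
    (B : ZMod N → Matrix (Fin d) (Fin d) ℂ) :
    permOp π (multiOp B) = multiOp (fun j => B (π.symm j)) := by
  ext σ τ
  simp only [permOp, multiOp, Function.comp_apply]
  rw [← Equiv.prod_comp π (fun j => B (π.symm j) (σ j) (τ j))]
  simp

theorem permOp_multiFamily {F : ℕ → Matrix (Fin d) (Fin d) ℂ} {n₀ n : ℕ}
    (hF : ∀ j ≥ n₀, F j = 1) {π : Equiv.Perm (ZMod (n + 1))}
    (hπ : ∀ j, j.val < n₀ → π j = j) : permOp π (multiFamily F n) = multiFamily F n := by
  rw [multiFamily, permOp_multiOp]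
  congr 1
  ext j : 1
  by_cases hj : j.val < n₀
  · rw [(Equiv.symm_apply_eq π).mpr (hπ j hj).symm]
  · rw [hF _ (not_lt.mp hj), hF]
    by_contra! hlt
    have h1 := hπ _ hlt
    rw [Equiv.apply_symm_apply] at h1
    rw [← h1] at hlt
    exact hj hlt

/-- A word involves only finitely many distinguished sites, bounded independently of the size, and
is symmetric in all others. -/
theorem exists_permOp_prod_eq {L : List (OpFamily d)} (hL : ∀ X ∈ L, X ∈ letters d) :
    ∃ n₀ : ℕ, ∀ (n : ℕ) (π : Equiv.Perm (ZMod (n + 1))), (∀ j, j.val < n₀ → π j = j) →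
      permOp π (L.prod n) = L.prod n := by
  induction L with
  | nil => exact ⟨0, fun n π _ => by simp [permOp_one]⟩
  | cons X L ih =>
    obtain ⟨n₁, h₁⟩ := ih fun Y hY => hL Y (List.mem_cons_of_mem _ hY)
    rcases hL X List.mem_cons_self with ⟨F, n₀, hF, rfl⟩ | ⟨A, rfl⟩
    · refine ⟨max n₀ n₁, fun n π hπ => ?_⟩
      rw [List.prod_cons, Pi.mul_apply, permOp_mul,
        permOp_multiFamily hF fun j hj => hπ j (lt_max_of_lt_left hj),
        h₁ n π fun j hj => hπ j (lt_max_of_lt_right hj)]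
    · refine ⟨n₁, fun n π hπ => ?_⟩
      rw [List.prod_cons, Pi.mul_apply, permOp_mul, h₁ n π hπ, collectiveFamily,
        permOp_collectiveOp]

theorem siteOp_natCast_eq_multiFamily (A : Matrix (Fin d) (Fin d) ℂ) {t n : ℕ} (ht : t ≤ n) :
    siteOp (n + 1) A (t : ZMod (n + 1)) = multiFamily (Function.update (fun _ => 1) t A) n := by
  rw [siteOp_eq_multiOp, multiFamily]
  congr 1
  ext j : 1
  have hval : ((t : ℕ) : ZMod (n + 1)).val = t := ZMod.val_cast_of_lt (Nat.lt_succ_of_le ht)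
  by_cases hj : j = (t : ZMod (n + 1))
  · subst hj
    rw [Function.update_self, hval, Function.update_self]
  · have hj' : j.val ≠ t := fun hc => hj (by rw [← hc, ZMod.natCast_zmod_val])
    rw [Function.update_of_ne hj, Function.update_of_ne hj']

theorem sum_zmod_eq_sum_range {M : Type*} [AddCommMonoid M] (n : ℕ) (f : ZMod (n + 1) → M) :
    ∑ j, f j = ∑ t ∈ Finset.range (n + 1), f (t : ZMod (n + 1)) := by
  rw [← Fin.sum_univ_eq_sum_range (fun t => f (t : ZMod (n + 1)))]
  refine Finset.sum_congr rfl fun j _ => ?_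
  exact congrArg f (ZMod.natCast_zmod_val (n := n + 1) j).symm

/-- Induction on the word, with a product-operator prefix `F` that absorbs letters. A collective
letter is a sum over sites: finitely many sites are distinguished, and all the others contribute
equally by symmetry, so the sum is polynomial if each contribution is. For the empty word,
normalisation leaves a fixed finite product. -/
theorem eventuallyPoly_word {ψ : Fin d → ℂ} (hψ : star ψ ⬝ᵥ ψ = 1) {L : List (OpFamily d)}
    (hL : ∀ X ∈ L, X ∈ letters d) {F : ℕ → Matrix (Fin d) (Fin d) ℂ} {n₀ : ℕ}
    (hF : ∀ j ≥ n₀, F j = 1) :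
    EventuallyPoly fun n => sand (productState (n + 1) ψ) (multiFamily F n * L.prod n)
      (productState (n + 1) ψ) := by
  induction L generalizing F n₀ with
  | nil =>
    refine (eventuallyPoly_const (∏ t ∈ Finset.range n₀, (star ψ ⬝ᵥ (F t *ᵥ ψ)))).congr ?_
    filter_upwards [eventually_ge_atTop n₀] with n hn
    rw [List.prod_nil, Pi.one_apply, mul_one, productState_eq_prodVec, sand, multiFamily,
      multiOp_mulVec_prodVec, star_prodVec_dotProduct]
    have h1 : ∏ j : ZMod (n + 1), (star ψ ⬝ᵥ (F j.val *ᵥ ψ))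
        = ∏ t ∈ Finset.range (n + 1), (star ψ ⬝ᵥ (F t *ᵥ ψ)) :=
      Fin.prod_univ_eq_prod_range (fun t => star ψ ⬝ᵥ (F t *ᵥ ψ)) (n + 1)
    rw [h1]
    symm
    refine Finset.prod_subset (fun t ht => ?_) fun t _ ht => ?_
    · simp only [Finset.mem_range] at ht ⊢; omega
    · rw [hF t (by simpa using ht), Matrix.one_mulVec, hψ]
  | cons X L ih =>
    have hL' : ∀ X ∈ L, X ∈ letters d := fun Y hY => hL Y (List.mem_cons_of_mem _ hY)
    rcases hL X List.mem_cons_self with ⟨F', n₁, hF', rfl⟩ | ⟨A, rfl⟩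
    · have := ih hL' (F := F * F') (n₀ := max n₀ n₁) fun j hj => by
        rw [Pi.mul_apply, hF j (le_of_max_le_left hj), hF' j (le_of_max_le_right hj), one_mul]
      refine this.congr (Eventually.of_forall fun n => ?_)
      rw [List.prod_cons, Pi.mul_apply, ← mul_assoc, ← multiFamily_mul, Pi.mul_apply]
    · obtain ⟨n₁, h₁⟩ := exists_permOp_prod_eq hL'
      set n₂ := max n₀ n₁
      let g : ℕ → ℕ → ℂ := fun t n => sand (productState (n + 1) ψ)
        (multiFamily (F * Function.update (fun _ => 1) t A) n * L.prod n) (productState (n + 1) ψ)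
      have hg : ∀ t, EventuallyPoly (g t) := fun t => by
        have hU : ∀ j ≥ max n₀ (t + 1), (F * (Function.update (fun _ => 1) t A : ℕ → Matrix (Fin d) (Fin d) ℂ)) j = 1 := by
          intro j hj
          have h2 : t + 1 ≤ j := le_of_max_le_right hj
          have h3 : j ≠ t := by omega
          rw [Pi.mul_apply, hF j (le_of_max_le_left hj), Function.update_of_ne h3, one_mul]
        exact ih hL' hU
      have hsite : ∀ n t, t ≤ n → sand (productState (n + 1) ψ)
          (multiFamily F n * (siteOp (n + 1) A (t : ZMod (n + 1)) * L.prod n))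
          (productState (n + 1) ψ) = g t n := fun n t ht => by
        rw [siteOp_natCast_eq_multiFamily A ht, ← mul_assoc]
        simp only [g]
        rw [← multiFamily_mul, Pi.mul_apply]
      have hconst : ∀ n t, n₂ ≤ t → t ≤ n → g t n = g n₂ n := fun n t h2 h3 => by
        rw [← hsite n t h3, ← hsite n n₂ (h2.trans h3),
          ← sand_perm (Equiv.swap (t : ZMod (n + 1)) (n₂ : ZMod (n + 1)))]
        have hv : ((t : ℕ) : ZMod (n + 1)).val = t := ZMod.val_cast_of_lt (by omega)
        have hv' : ((n₂ : ℕ) : ZMod (n + 1)).val = n₂ := ZMod.val_cast_of_lt (by omega)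
        have hfix : ∀ j : ZMod (n + 1), j.val < n₂ →
            Equiv.swap (t : ZMod (n + 1)) (n₂ : ZMod (n + 1)) j = j := fun j hj =>
          Equiv.swap_apply_of_ne_of_ne (by rintro rfl; omega) (by rintro rfl; omega)
        rw [permOp_mul, permOp_mul, permOp_siteOp, Equiv.swap_apply_left,
          permOp_multiFamily hF fun j hj => hfix j (lt_max_of_lt_left hj),
          h₁ n _ fun j hj => hfix j (lt_max_of_lt_right hj), productState_eq_prodVec,
          isSymm_prodVec_const]
      -- Of the n + 1 sites, the n + 1 - n₂ with index at least n₂ all contribute the same value.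
      have hpoly : EventuallyPoly fun n => ∑ t ∈ Finset.range n₂, g t n
          + ((n : ℂ) + (1 - n₂ : ℂ)) * g n₂ n :=
        (EventuallyPoly.sum fun t _ => hg t).add
          ((eventuallyPoly_natCast.add (eventuallyPoly_const _)).mul (hg n₂))
      refine hpoly.congr ?_
      filter_upwards [eventually_ge_atTop n₂] with n hn
      rw [List.prod_cons, Pi.mul_apply, collectiveFamily, collectiveOp, Finset.sum_mul,
        Finset.mul_sum, sand_sum_mid, sum_zmod_eq_sum_range,
        Finset.sum_congr rfl fun t ht => hsite n t (by simpa [Nat.lt_succ_iff] using ht),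
        ← Finset.sum_range_add_sum_Ico _ (show n₂ ≤ n + 1 by omega),
        Finset.sum_congr (s₁ := Finset.Ico n₂ (n + 1)) rfl (g := fun _ => g n₂ n)
          fun t ht => hconst n t (Finset.mem_Ico.mp ht).1
            (Nat.lt_succ_iff.mp (Finset.mem_Ico.mp ht).2)]
      rw [Finset.sum_const, Nat.card_Ico, nsmul_eq_mul, Nat.cast_sub (by omega)]
      push_cast
      ring

/-- Families that eventually belong to the algebra generated by local and collective
operators. -/
def IsWordFamily (X : OpFamily d) : Prop :=
  ∃ Y ∈ Algebra.adjoin ℂ (letters d), ∀ᶠ n in atTop, X n = Y n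

theorem IsWordFamily.eventuallyPoly {X : OpFamily d} (hX : IsWordFamily X) {ψ : Fin d → ℂ}
    (hψ : star ψ ⬝ᵥ ψ = 1) :
    EventuallyPoly fun n => sand (productState (n + 1) ψ) (X n) (productState (n + 1) ψ) := by
  obtain ⟨Y, hY, hXY⟩ := hX
  suffices h : EventuallyPoly fun n =>
      sand (productState (n + 1) ψ) (Y n) (productState (n + 1) ψ) from
    h.congr (by filter_upwards [hXY] with n hn; rw [hn])
  clear hXY
  rw [← Subalgebra.mem_toSubmodule, Algebra.adjoin_eq_span] at hY
  induction hY using Submodule.span_induction with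
  | zero => simpa [sand] using eventuallyPoly_const 0
  | add x y _ _ hx hy =>
    refine (hx.add hy).congr (Eventually.of_forall fun n => ?_)
    rw [Pi.add_apply, sand_add_mid]
  | smul c x _ hx =>
    refine ((eventuallyPoly_const c).mul hx).congr (Eventually.of_forall fun n => ?_)
    rw [Pi.smul_apply, sand_smul_mid]
  | mem x hx =>
    obtain ⟨L, hL, rfl⟩ := Submonoid.exists_list_of_mem_closure hx
    refine (eventuallyPoly_word hψ hL (F := 1) (n₀ := 0) fun _ _ => rfl).congr
      (Eventually.of_forall fun n => ?_)
    rw [multiFamily_one, Pi.one_apply, one_mul]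

theorem IsWordFamily.mul {X Y : OpFamily d} (hX : IsWordFamily X) (hY : IsWordFamily Y) :
    IsWordFamily fun n => X n * Y n := by
  obtain ⟨X', hX', h1⟩ := hX
  obtain ⟨Y', hY', h2⟩ := hY
  exact ⟨X' * Y', mul_mem hX' hY', by filter_upwards [h1, h2] with n h1 h2; simp [h1, h2]⟩

theorem IsWordFamily.sub {X Y : OpFamily d} (hX : IsWordFamily X) (hY : IsWordFamily Y) :
    IsWordFamily fun n => X n - Y n := by
  obtain ⟨X', hX', h1⟩ := hX
  obtain ⟨Y', hY', h2⟩ := hY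
  exact ⟨X' - Y', sub_mem hX' hY', by filter_upwards [h1, h2] with n h1 h2; simp [h1, h2]⟩

theorem isWordFamily_one : IsWordFamily (fun n => (1 : Op d (n + 1))) :=
  ⟨1, one_mem _, by simp⟩

theorem IsWordFamily.sum {ι : Type*} {s : Finset ι} {X : ι → OpFamily d}
    (h : ∀ i ∈ s, IsWordFamily (X i)) : IsWordFamily fun n => ∑ i ∈ s, X i n := by
  classical
  induction s using Finset.induction_on with
  | empty => exact ⟨0, zero_mem _, by simp⟩
  | insert i s hi ih =>
    obtain ⟨X', hX', h1⟩ := h i (Finset.mem_insert_self _ _)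
    obtain ⟨Y', hY', h2⟩ := ih fun j hj => h j (Finset.mem_insert_of_mem hj)
    refine ⟨X' + Y', add_mem hX' hY', ?_⟩
    filter_upwards [h1, h2] with n h1 h2
    rw [Finset.sum_insert hi, h1, h2, Pi.add_apply]

theorem isWordFamily_siteOp (A : Matrix (Fin d) (Fin d) ℂ) (t : ℕ) :
    IsWordFamily fun n => siteOp (n + 1) A (t : ZMod (n + 1)) := by
  refine ⟨multiFamily (Function.update (fun _ => 1) t A), Algebra.subset_adjoin (Or.inl ⟨_, t + 1,
    fun j hj => Function.update_of_ne (by omega) _ _, rfl⟩), ?_⟩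
  filter_upwards [eventually_ge_atTop t] with n hn
  exact siteOp_natCast_eq_multiFamily A hn

theorem isWordFamily_collectiveOp (A : Matrix (Fin d) (Fin d) ℂ) :
    IsWordFamily fun n => collectiveOp (n + 1) A :=
  ⟨collectiveFamily A, Algebra.subset_adjoin (Or.inr ⟨A, rfl⟩), by simp [collectiveFamily]⟩

theorem isWordFamily_blockOp {m : ℕ}
    (h : Matrix (Fin (m + 1) → Fin d) (Fin (m + 1) → Fin d) ℂ) (l : ℕ) :
    IsWordFamily fun n => blockOp (n + 1) h (l : ZMod (n + 1)) := by
  let F : (Fin (m + 1) → Fin d) → (Fin (m + 1) → Fin d) → ℕ → Matrix (Fin d) (Fin d) ℂ :=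
    fun s t j => if hj : l ≤ j ∧ j - l < m + 1 then
      Matrix.single (s ⟨j - l, hj.2⟩) (t ⟨j - l, hj.2⟩) 1 else 1
  refine ⟨∑ s, ∑ t, h s t • multiFamily (F s t), ?_, ?_⟩
  · refine sum_mem fun s _ => sum_mem fun t _ => Subalgebra.smul_mem _ ?_ _
    refine Algebra.subset_adjoin (Or.inl ⟨_, l + m + 1, fun j hj => ?_, rfl⟩)
    exact dif_neg (by omega)
  · filter_upwards [eventually_ge_atTop (l + m)] with n hn
    rw [blockOp_eq_placeOp, placeOp_eq_sum h (fun s t j => F s t j.val)]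
    · simp [Finset.sum_apply, multiFamily]
    · intro s t a
      have hv : ((l : ZMod (n + 1)) + ((a : ℕ) : ZMod (n + 1))).val = l + a := by
        rw [← Nat.cast_add]
        exact ZMod.val_cast_of_lt (by have := a.2; omega)
      simp only [F, hv]
      rw [dif_pos ⟨by omega, by have := a.2; omega⟩]
      simp
    · intro s t j hj
      refine dif_neg fun hc => hj ⟨j.val - l, hc.2⟩ ?_
      rw [← Nat.cast_add, Nat.add_sub_cancel' hc.1, ZMod.natCast_zmod_val]

/-- The operator that creates the tower state. -/
noncomputable def towerOp (N : ℕ) [NeZero N] (w : List (Matrix (Fin d) (Fin d) ℂ)) : Op d N :=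
  (w.map (collectiveOp N)).prod

theorem towerState_eq (N : ℕ) [NeZero N] (ψ : Fin d → ℂ) (w : List (Matrix (Fin d) (Fin d) ℂ)) :
    towerState N ψ w = towerOp N w *ᵥ productState N ψ := by
  induction w with
  | nil => simp [towerState, towerOp]
  | cons a w ih =>
    rw [towerOp, List.map_cons, List.prod_cons, ← Matrix.mulVec_mulVec, ← towerOp, ← ih]
    rfl

theorem isWordFamily_towerOp (w : List (Matrix (Fin d) (Fin d) ℂ)) :
    IsWordFamily (fun n => towerOp (n + 1) w) ∧ IsWordFamily (fun n => (towerOp (n + 1) w)ᴴ) := by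
  induction w with
  | nil => simpa [towerOp] using isWordFamily_one
  | cons a w ih =>
    constructor
    · simpa [towerOp] using (isWordFamily_collectiveOp a).mul ih.1
    · simpa [towerOp, collectiveOp_conjTranspose] using
        ih.2.mul (isWordFamily_collectiveOp aᴴ)

theorem eventuallyPoly_sand_siteDiff {ψ : Fin d → ℂ} (hψ : star ψ ⬝ᵥ ψ = 1)
    (q : Matrix (Fin d) (Fin d) ℂ) (w : List (Matrix (Fin d) (Fin d) ℂ)) (r i j : ℕ)
    {X : OpFamily d} (hX : IsWordFamily X) :
    EventuallyPoly fun n =>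
      sand (siteDiff q (towerState (n + 1) ψ w) r i) (X n)
        (siteDiff q (towerState (n + 1) ψ w) r j) := by
  have hw := isWordFamily_towerOp w
  have hY := (((hw.2.mul ((isWordFamily_siteOp qᴴ i).sub (isWordFamily_siteOp qᴴ r))).mul
    hX).mul ((isWordFamily_siteOp q j).sub (isWordFamily_siteOp q r))).mul hw.1
  refine (hY.eventuallyPoly hψ).congr (Eventually.of_forall fun n => ?_)
  simp only [siteDiff, towerState_eq, ← Matrix.sub_mulVec, Matrix.mulVec_mulVec, ← sub_mul]
  rw [sand_mulVec_left, ← sand_mul, Matrix.conjTranspose_mul, Matrix.conjTranspose_sub,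
    siteOp_conjTranspose, siteOp_conjTranspose]
  simp only [mul_assoc]

end Words

end ScarTower

namespace ScarTower

/-! ### Window geometry and the two moments of the Hamiltonian -/

section Moments

variable {d : ℕ} {G : Type*} [Group G] {u : G →* Matrix.unitaryGroup (Fin d) ℂ}
variable {ψ : Fin d → ℂ} {N : ℕ} [NeZero N] (q : Matrix (Fin d) (Fin d) ℂ) {Ψ : State d N}

theorem eq_of_natCast_zmod_eq {a b : ℕ} (ha : a < N) (hb : b < N)
    (hab : (a : ZMod N) = (b : ZMod N)) : a = b := by
  rwa [ZMod.natCast_eq_natCast_iff', Nat.mod_eq_of_lt ha, Nat.mod_eq_of_lt hb] at hab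

theorem natCast_mem_blockSet {m l j : ℕ} (hl : l + m < N) (hj : j < N) :
    (j : ZMod N) ∈ blockSet N m (l : ZMod N) ↔ l ≤ j ∧ j ≤ l + m := by
  rw [mem_blockSet]
  constructor
  · rintro ⟨a, ha⟩
    have := a.2
    rw [← Nat.cast_add] at ha
    have := eq_of_natCast_zmod_eq hj (by omega) ha
    omega
  · rintro ⟨h1, h2⟩
    refine ⟨⟨j - l, by omega⟩, ?_⟩
    rw [← Nat.cast_add]
    congr 1
    simp only
    omega

theorem exists_natCast_of_mem_blockSet {m l : ℕ} {j : ZMod N} (h : j ∈ blockSet N m (l : ZMod N)) :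
    ∃ i : ℕ, l ≤ i ∧ i ≤ l + m ∧ j = (i : ZMod N) := by
  obtain ⟨a, ha⟩ := mem_blockSet.mp h
  exact ⟨l + a, by omega, by omega, by rw [ha]; push_cast; rfl⟩

/-- The base points of the blocks that meet the block at `m + 1`. -/
def nearSites (N m : ℕ) [NeZero N] : Finset (ZMod N) :=
  Finset.univ.image fun t : Fin (2 * m + 1) => (((t : ℕ) + 1 : ℕ) : ZMod N)

/-- The first `3m + 2` sites. -/
def window (N m : ℕ) [NeZero N] : Finset (ZMod N) :=
  Finset.univ.image fun t : Fin (3 * m + 2) => ((t : ℕ) : ZMod N)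

theorem natCast_mem_window {m i : ℕ} (h : i < 3 * m + 2) : (i : ZMod N) ∈ window N m :=
  Finset.mem_image.mpr ⟨⟨i, h⟩, Finset.mem_univ _, rfl⟩

theorem sum_window {M : Type*} [AddCommMonoid M] {m : ℕ} (hN : 3 * m + 4 ≤ N) (F : ZMod N → M) :
    ∑ j ∈ window N m, F j = ∑ i : Fin (3 * m + 2), F ((i : ℕ) : ZMod N) := by
  rw [window, Finset.sum_image]
  intro a _ b _ hab
  exact Fin.ext (eq_of_natCast_zmod_eq (by omega) (by omega) hab)

theorem sum_nearSites {M : Type*} [AddCommMonoid M] {m : ℕ} (hN : 3 * m + 4 ≤ N)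
    (F : ZMod N → M) :
    ∑ j ∈ nearSites N m, F j = ∑ t : Fin (2 * m + 1), F (((t : ℕ) + 1 : ℕ) : ZMod N) := by
  rw [nearSites, Finset.sum_image]
  intro a _ b _ hab
  have := eq_of_natCast_zmod_eq (N := N) (by omega) (by omega) hab
  exact Fin.ext (by omega)

theorem disjoint_of_notMem_nearSites {m : ℕ} {t : ZMod N} (ht : t ∉ nearSites N m) :
    Disjoint (blockSet N m ((m + 1 : ℕ) : ZMod N)) (blockSet N m t) := by
  rw [Finset.disjoint_left]
  intro j hj hj'
  obtain ⟨a, ha⟩ := mem_blockSet.mp hj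
  obtain ⟨b, hb⟩ := mem_blockSet.mp hj'
  -- A common site forces t = m + 1 + a - b, which lies between 1 and 2m + 1; the index is shifted
  -- down by one.
  refine ht (Finset.mem_image.mpr ⟨⟨m + a - b, by omega⟩, Finset.mem_univ _, ?_⟩)
  have h1 : ((m + a - b + 1 : ℕ) : ZMod N) + ((b : ℕ) : ZMod N)
      = ((m + 1 : ℕ) : ZMod N) + ((a : ℕ) : ZMod N) := by
    rw [← Nat.cast_add, ← Nat.cast_add]
    congr 1
    omega
  rw [← ha, hb] at h1
  exact add_right_cancel h1

theorem blockSet_subset_window {m l : ℕ} (hl : l + m < 3 * m + 2) :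
    blockSet N m (l : ZMod N) ⊆ window N m := by
  intro j hj
  obtain ⟨i, _, hi, rfl⟩ := exists_natCast_of_mem_blockSet hj
  exact natCast_mem_window (by omega)

theorem notMem_window {m : ℕ} (hN : 3 * m + 4 ≤ N) :
    ((3 * m + 3 : ℕ) : ZMod N) ∉ window N m := by
  intro h
  obtain ⟨i, _, hi⟩ := Finset.mem_image.mp h
  have := eq_of_natCast_zmod_eq (N := N) (by omega) (by omega) hi
  omega

variable {m : ℕ} (h : Matrix (Fin (m + 1) → Fin d) (Fin (m + 1) → Fin d) ℂ)

variable (N) in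
/-- The products of the local term at `m + 1` with the local terms it overlaps. -/
noncomputable def nearOp : Op d N :=
  ∑ t : Fin (2 * m + 1),
    blockOp N h ((m + 1 : ℕ) : ZMod N) * blockOp N h (((t : ℕ) + 1 : ℕ) : ZMod N)

variable (N) in
/-- The product of the local term at `m + 1` with a local term it does not overlap. -/
noncomputable def farOp : Op d N :=
  blockOp N h ((m + 1 : ℕ) : ZMod N) * blockOp N h ((2 * m + 2 : ℕ) : ZMod N)

theorem nearOp_eq_sum (hN : 3 * m + 4 ≤ N) : nearOp N h = ∑ t ∈ nearSites N m,
    blockOp N h ((m + 1 : ℕ) : ZMod N) * blockOp N h t := by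
  rw [sum_nearSites hN, nearOp]

variable {h}

theorem localOn_window_blockOp (hN : 3 * m + 4 ≤ N) :
    LocalOn (window N m) (blockOp N h ((m + 1 : ℕ) : ZMod N)) :=
  (localOn_blockOp (by omega) h _).mono (blockSet_subset_window (by omega))

theorem localOn_window_nearOp (hN : 3 * m + 4 ≤ N) :
    LocalOn (window N m) (nearOp N h) :=
  LocalOn.sum fun t _ => (localOn_window_blockOp hN).mul
    ((localOn_blockOp (by omega) h _).mono (blockSet_subset_window (by omega)))

theorem nullOn_window_blockOp (hψ : star ψ ⬝ᵥ ψ = 1) (hN : 3 * m + 4 ≤ N)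
    (h0 : ∀ Φ ∈ scarSpace u ψ N, hamiltonian N h *ᵥ Φ = 0) :
    NullOn u ψ (window N m) (blockOp N h ((m + 1 : ℕ) : ZMod N)) :=
  (nullOn_blockOp u hψ (by omega) h0 _).mono (blockSet_subset_window (by omega))

/-- The layout is made for this: blocks meeting the one at m + 1 start at 1, …, 2m + 1 and cover
sites 1, …, 3m + 1. Site 0 of the window is then the spare site needed by `nullOn_near`. The
disjoint block at 2m + 2 ends at 3m + 2, and 3m + 3 serves as reference site off everything, whence
N ≥ 3m + 4. -/
theorem nullOn_window_nearOp (hψ : star ψ ⬝ᵥ ψ = 1) (hN : 3 * m + 4 ≤ N)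
    (h0 : ∀ Φ ∈ scarSpace u ψ N, hamiltonian N h *ᵥ Φ = 0) :
    NullOn u ψ (window N m) (nearOp N h) := by
  rw [nearOp_eq_sum h hN]
  refine nullOn_near u hψ (by omega) h0 _ (fun t ht => disjoint_of_notMem_nearSites ht)
    (blockSet_subset_window (by omega)) (fun t ht => ?_)
    (natCast_mem_window (i := 0) (by omega)) (fun hc => ?_) (fun t ht hc => ?_)
  · obtain ⟨i, _, rfl⟩ := Finset.mem_image.mp ht
    exact blockSet_subset_window (by omega)
  · have := (natCast_mem_blockSet (by omega) (by omega)).mp hc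
    omega
  · obtain ⟨i, _, rfl⟩ := Finset.mem_image.mp ht
    have := (natCast_mem_blockSet (by omega) (by omega)).mp hc
    omega

theorem disjoint_far (hN : 3 * m + 4 ≤ N) :
    Disjoint (blockSet N m ((m + 1 : ℕ) : ZMod N)) (blockSet N m ((2 * m + 2 : ℕ) : ZMod N)) := by
  rw [Finset.disjoint_left]
  intro j hj hj'
  obtain ⟨i, h1, h2, rfl⟩ := exists_natCast_of_mem_blockSet hj
  have := (natCast_mem_blockSet (by omega) (by omega)).mp hj'
  omega

theorem notMem_blockSet_left (hN : 3 * m + 4 ≤ N) :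
    ((3 * m + 3 : ℕ) : ZMod N) ∉ blockSet N m ((m + 1 : ℕ) : ZMod N) := fun hc =>
  notMem_window hN (blockSet_subset_window (by omega) hc)

theorem notMem_blockSet_right (hN : 3 * m + 4 ≤ N) :
    ((3 * m + 3 : ℕ) : ZMod N) ∉ blockSet N m ((2 * m + 2 : ℕ) : ZMod N) := fun hc => by
  have := (natCast_mem_blockSet (by omega) (by omega)).mp hc
  omega

theorem exists_notMem_blockSets (hN : 3 * m + 4 ≤ N) (l l' : ZMod N) :
    ∃ r, r ∉ blockSet N m l ∧ r ∉ blockSet N m l' := by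
  by_contra! hcon
  have h1 : (Finset.univ : Finset (ZMod N)) ⊆ blockSet N m l ∪ blockSet N m l' := fun r _ => by
    rw [Finset.mem_union]
    by_cases hr : r ∈ blockSet N m l
    · exact Or.inl hr
    · exact Or.inr (hcon r hr)
  have h2 := (Finset.card_le_card h1).trans (Finset.card_union_le _ _)
  have h3 : ∀ l : ZMod N, (blockSet N m l).card ≤ m + 1 := fun l =>
    Finset.card_image_le.trans (by simp)
  have := h3 l
  have := h3 l'
  rw [Finset.card_univ, ZMod.card] at h2
  omega

variable {χ : ZMod N → ℂ}

theorem sand_twist_window (hχ : ∑ j, χ j = 0) (hΨ : Ψ ∈ scarSpace u ψ N) (hN : 3 * m + 4 ≤ N)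
    {X : Op d N} (hloc : LocalOn (window N m) X) (hnull : NullOn u ψ (window N m) X) :
    sand (twist χ q Ψ) X (twist χ q Ψ) = ∑ i : Fin (3 * m + 2), ∑ j : Fin (3 * m + 2),
      star (χ (i : ℕ)) * χ (j : ℕ) * sand (siteDiff q Ψ ((3 * m + 3 : ℕ) : ZMod N) (i : ℕ)) X
        (siteDiff q Ψ ((3 * m + 3 : ℕ) : ZMod N) (j : ℕ)) := by
  rw [sand_twist_eq q hχ hΨ hloc hnull (notMem_window hN), sum_window hN]
  exact Finset.sum_congr rfl fun i _ => sum_window hN _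

theorem sand_twist_hamiltonian (hadd : ∀ i j, χ (i + j) = χ i * χ j)
    (hunit : ∀ i, star (χ i) * χ i = 1) (hs : IsSymm Ψ) (l : ZMod N) :
    sand (twist χ q Ψ) (hamiltonian N h) (twist χ q Ψ)
      = N * sand (twist χ q Ψ) (blockOp N h l) (twist χ q Ψ) := by
  rw [hamiltonian, sand_sum_mid, Finset.sum_congr rfl
    (g := fun _ => sand (twist χ q Ψ) (blockOp N h l) (twist χ q Ψ))]
  · simp [ZMod.card]
  · intro l' _
    rw [← sand_twist_shift q hadd hunit hs (blockOp N h l) (l' - l), permOp_shift_blockOp,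
      add_sub_cancel]

/-- H² is the sum of the translates of h_l H, which have equal expectations in a translation
eigenvector. -/
theorem sand_twist_hamiltonian_sq (hadd : ∀ i j, χ (i + j) = χ i * χ j)
    (hunit : ∀ i, star (χ i) * χ i = 1) (hs : IsSymm Ψ) (l : ZMod N) :
    sand (twist χ q Ψ) (hamiltonian N h * hamiltonian N h) (twist χ q Ψ)
      = N * ∑ t, sand (twist χ q Ψ) (blockOp N h l * blockOp N h t) (twist χ q Ψ) := by
  have h1 : hamiltonian N h * hamiltonian N h = ∑ l, blockOp N h l * hamiltonian N h := by
    rw [← Finset.sum_mul]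
    rfl
  rw [h1, sand_sum_mid, Finset.sum_congr rfl
    (g := fun _ => sand (twist χ q Ψ) (blockOp N h l * hamiltonian N h) (twist χ q Ψ))]
  · have h2 : ∑ t, sand (twist χ q Ψ) (blockOp N h l * blockOp N h t) (twist χ q Ψ)
        = sand (twist χ q Ψ) (blockOp N h l * hamiltonian N h) (twist χ q Ψ) := by
      rw [hamiltonian, Finset.mul_sum, sand_sum_mid]
    rw [h2]
    simp [ZMod.card]
  · intro l' _
    rw [← sand_twist_shift q hadd hunit hs (blockOp N h l * hamiltonian N h) (l' - l), permOp_mul,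
      permOp_shift_blockOp, permOp_shift_hamiltonian, add_sub_cancel]

/-- By `sand_far_const` a distant base point `t` enters only through the phases χ(t + b). The
resulting expression `F t` makes sense for every `t`, and its sum over the whole ring vanishes with
∑ χ. So the distant sum is minus the sum of `F` over near base points, where `F` is not the actual
expectation: a number of terms growing with N becomes a fixed number. -/
theorem sum_far_eq (hχ : ∑ j, χ j = 0) (hψ : star ψ ⬝ᵥ ψ = 1) (hΨ : Ψ ∈ scarSpace u ψ N)
    (hN : 3 * m + 4 ≤ N) (h0 : ∀ Φ ∈ scarSpace u ψ N, hamiltonian N h *ᵥ Φ = 0) :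
    ∑ t ∈ (nearSites N m)ᶜ, sand (twist χ q Ψ)
        (blockOp N h ((m + 1 : ℕ) : ZMod N) * blockOp N h t) (twist χ q Ψ)
      = -∑ t : Fin (2 * m + 1), ∑ a : Fin (m + 1), ∑ b : Fin (m + 1),
        (star (χ (m + 1 + a : ℕ)) * χ (t + 1 + b : ℕ) *
          sand (siteDiff q Ψ ((3 * m + 3 : ℕ) : ZMod N) (m + 1 + a : ℕ)) (farOp N h)
            (siteDiff q Ψ ((3 * m + 3 : ℕ) : ZMod N) (2 * m + 2 + b : ℕ)) +
        star (χ (t + 1 + b : ℕ)) * χ (m + 1 + a : ℕ) *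
          sand (siteDiff q Ψ ((3 * m + 3 : ℕ) : ZMod N) (2 * m + 2 + b : ℕ)) (farOp N h)
            (siteDiff q Ψ ((3 * m + 3 : ℕ) : ZMod N) (m + 1 + a : ℕ))) := by
  have hs := isSymm_of_mem_scarSpace u hΨ
  have hN' : m + 1 ≤ N := by omega
  set r := ((3 * m + 3 : ℕ) : ZMod N)
  let F : ZMod N → ℂ := fun t => ∑ a : Fin (m + 1), ∑ b : Fin (m + 1),
        (star (χ (m + 1 + a : ℕ)) * χ (t + (b : ℕ)) *
          sand (siteDiff q Ψ r (m + 1 + a : ℕ)) (farOp N h)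
            (siteDiff q Ψ r (2 * m + 2 + b : ℕ)) +
        star (χ (t + (b : ℕ))) * χ (m + 1 + a : ℕ) *
          sand (siteDiff q Ψ r (2 * m + 2 + b : ℕ)) (farOp N h)
            (siteDiff q Ψ r (m + 1 + a : ℕ)))
  have hfar : ∀ t ∈ (nearSites N m)ᶜ, sand (twist χ q Ψ)
        (blockOp N h ((m + 1 : ℕ) : ZMod N) * blockOp N h t) (twist χ q Ψ) = F t := by
    intro t ht
    have hd := disjoint_of_notMem_nearSites (Finset.mem_compl.mp ht)
    -- The fixed reference site may lie in the block at `t`, so an auxiliary one is chosen and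
    -- replaced afterwards by symmetry.
    obtain ⟨r', hr, hr'⟩ := exists_notMem_blockSets hN ((m + 1 : ℕ) : ZMod N) t
    rw [sand_twist_far_eq q hχ hΨ hN' (nullOn_blockOp u hψ (by omega) h0) hd hr hr',
      sum_blockSet hN']
    refine Finset.sum_congr rfl fun a _ => ?_
    rw [sum_blockSet hN']
    refine Finset.sum_congr rfl fun b _ => ?_
    obtain ⟨h1, h2⟩ := sand_far_const (h := h) q hs hN' hd (disjoint_far hN) hr hr'
      (notMem_blockSet_left hN) (notMem_blockSet_right hN) a b
    rw [h1, h2]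
    simp only [Nat.cast_add _ (a : ℕ), Nat.cast_add _ (b : ℕ)]
    rfl
  have hshift : ∀ b : ZMod N, ∑ t, χ (t + b) = 0 := fun b =>
    (Equiv.sum_comp (Equiv.addRight b) χ).trans hχ
  have hshift' : ∀ b : ZMod N, ∑ t, star (χ (t + b)) = 0 := fun b => by
    rw [← star_sum, hshift, star_zero]
  have htot : ∑ t, F t = 0 := by
    simp only [F]
    rw [Finset.sum_comm]
    refine Finset.sum_eq_zero fun a _ => ?_
    rw [Finset.sum_comm]
    refine Finset.sum_eq_zero fun b _ => ?_
    rw [Finset.sum_add_distrib, ← Finset.sum_mul, ← Finset.mul_sum, ← Finset.sum_mul,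
      ← Finset.sum_mul, hshift, hshift']
    simp
  rw [Finset.sum_congr rfl hfar, eq_neg_iff_add_eq_zero, ← htot,
    ← Finset.sum_add_sum_compl (nearSites N m), add_comm, sum_nearSites hN]
  congr 1
  refine Finset.sum_congr rfl fun t _ => Finset.sum_congr rfl fun a _ =>
    Finset.sum_congr rfl fun b _ => ?_
  rw [Nat.cast_add (_ + 1) (b : ℕ)]

theorem sum_farOp_eq_zero (hψ : star ψ ⬝ᵥ ψ = 1) (hΨ : Ψ ∈ scarSpace u ψ N)
    (hQ : collectiveOp N q *ᵥ Ψ ∈ scarSpace u ψ N)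
    (hN : 3 * m + 4 ≤ N) (h0 : ∀ Φ ∈ scarSpace u ψ N, hamiltonian N h *ᵥ Φ = 0) :
    ∑ a : Fin (m + 1), ∑ b : Fin (m + 1),
      sand (siteDiff q Ψ ((3 * m + 3 : ℕ) : ZMod N) (m + 1 + a : ℕ)) (farOp N h)
            (siteDiff q Ψ ((3 * m + 3 : ℕ) : ZMod N) (2 * m + 2 + b : ℕ)) = 0 ∧
    ∑ a : Fin (m + 1), ∑ b : Fin (m + 1),
      sand (siteDiff q Ψ ((3 * m + 3 : ℕ) : ZMod N) (2 * m + 2 + b : ℕ)) (farOp N h)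
            (siteDiff q Ψ ((3 * m + 3 : ℕ) : ZMod N) (m + 1 + a : ℕ)) = 0 := by
  have hN' : m + 1 ≤ N := by omega
  have := sum_sand_far_eq_zero q hΨ hQ hN' (nullOn_blockOp u hψ (by omega) h0) (disjoint_far hN)
    (notMem_blockSet_right hN)
  simp only [sum_blockSet hN', ← Nat.cast_add] at this
  exact this

end Moments

end ScarTower

namespace ScarTower

open Filter Topology

/-! ### Trigonometric families with uniformly bounded coefficients -/

section Trig

/-- Families of trigonometric polynomials in `k` with fixed frequencies and uniformly bounded
coefficients, that vanish at `k = 0` and, for each label, have convergent coefficients. -/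
def IsTrigFamily {M : Type*} (good : M → Prop) (f : ℕ → M → ℝ → ℂ) : Prop :=
  ∃ (ι : Type) (_ : Fintype ι) (θ : ι → ℝ) (c : ι → ℕ → M → ℂ) (C : ℝ) (n₀ : ℕ),
    (∀ n ≥ n₀, ∀ w, good w → ∀ s, ‖c s n w‖ ≤ C) ∧
    (∀ n ≥ n₀, ∀ w, good w → ∑ s, c s n w = 0) ∧
    (∀ w, good w → ∀ s, ∃ L, Tendsto (fun n => c s n w) atTop (𝓝 L)) ∧
    ∀ n ≥ n₀, ∀ w, good w → ∀ k, f n w k = ∑ s, c s n w * Complex.exp (Complex.I * k * θ s)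

variable {M : Type*} {good : M → Prop} {f f' : ℕ → M → ℝ → ℂ}

theorem IsTrigFamily.add (hf : IsTrigFamily good f) (hf' : IsTrigFamily good f') :
    IsTrigFamily good (fun n w k => f n w k + f' n w k) := by
  obtain ⟨ι, _, θ, c, C, n₀, h1, h2, h3, h4⟩ := hf
  obtain ⟨ι', _, θ', c', C', n₀', h1', h2', h3', h4'⟩ := hf'
  refine ⟨ι ⊕ ι', inferInstance, Sum.elim θ θ', Sum.elim c c', max C C', max n₀ n₀',
    fun n hn w hw s => ?_, fun n hn w hw => ?_, fun w hw s => ?_, fun n hn w hw k => ?_⟩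
  · rcases s with s | s
    · exact (h1 n (le_of_max_le_left hn) w hw s).trans (le_max_left _ _)
    · exact (h1' n (le_of_max_le_right hn) w hw s).trans (le_max_right _ _)
  · rw [Fintype.sum_sum_type]
    simp [h2 n (le_of_max_le_left hn) w hw, h2' n (le_of_max_le_right hn) w hw]
  · rcases s with s | s
    · exact h3 w hw s
    · exact h3' w hw s
  · change f n w k + f' n w k = _
    rw [Fintype.sum_sum_type, h4 n (le_of_max_le_left hn) w hw,
      h4' n (le_of_max_le_right hn) w hw]
    rfl

theorem IsTrigFamily.neg (hf : IsTrigFamily good f) :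
    IsTrigFamily good (fun n w k => -f n w k) := by
  obtain ⟨ι, _, θ, c, C, n₀, h1, h2, h3, h4⟩ := hf
  refine ⟨ι, inferInstance, θ, fun s n w => -c s n w, C, n₀,
    fun n hn w hw s => ?_, fun n hn w hw => ?_, fun w hw s => ?_, fun n hn w hw k => ?_⟩
  · rw [norm_neg]; exact h1 n hn w hw s
  · rw [Finset.sum_neg_distrib, h2 n hn w hw, neg_zero]
  · obtain ⟨L, hL⟩ := h3 w hw s
    exact ⟨-L, hL.neg⟩
  · change -f n w k = _
    rw [h4 n hn w hw]
    simp

theorem norm_exp_I_mul (k θ : ℝ) : ‖Complex.exp (Complex.I * k * θ)‖ = 1 := by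
  have : Complex.I * k * θ = ((k * θ : ℝ) : ℂ) * Complex.I := by push_cast; ring
  rw [this, Complex.norm_exp_ofReal_mul_I]

theorem norm_exp_I_mul_sub_le (k k' θ : ℝ) :
    ‖Complex.exp (Complex.I * k * θ) - Complex.exp (Complex.I * k' * θ)‖ ≤ |θ| * |k - k'| := by
  have h1 : Complex.exp (Complex.I * k * θ) - Complex.exp (Complex.I * k' * θ)
      = Complex.exp (Complex.I * k' * θ) * (Complex.exp (Complex.I * ((k - k') * θ : ℝ)) - 1) := by
    rw [mul_sub, ← Complex.exp_add, mul_one]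
    congr 2
    push_cast
    ring
  rw [h1, norm_mul, norm_exp_I_mul, one_mul]
  refine (Real.norm_exp_I_mul_ofReal_sub_one_le).trans (le_of_eq ?_)
  rw [norm_mul, Real.norm_eq_abs, Real.norm_eq_abs, mul_comm]

/-- Bounded coefficients and fixed frequencies give a bound and a Lipschitz constant independent of
size and label; with zero coefficient sum, the Lipschitz bound against k = 0 is the third estimate.
-/
theorem IsTrigFamily.exists_bound (hf : IsTrigFamily good f) :
    ∃ K > 0, ∃ n₀ : ℕ, ∀ n ≥ n₀, ∀ w, good w → ∀ k k' : ℝ,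
      ‖f n w k‖ ≤ K ∧ ‖f n w k - f n w k'‖ ≤ K * |k - k'| ∧ ‖f n w k‖ ≤ K * |k| := by
  obtain ⟨ι, _, θ, c, C, n₀, h1, h2, h3, h4⟩ := hf
  set K₁ := ∑ _s : ι, |C| with hK₁
  set K₂ := ∑ s, |C| * |θ s| with hK₂
  have hK₁0 : 0 ≤ K₁ := Finset.sum_nonneg fun _ _ => abs_nonneg _
  have hK₂0 : 0 ≤ K₂ := Finset.sum_nonneg fun _ _ => by positivity
  have hlip : ∀ n ≥ n₀, ∀ w, good w → ∀ k k' : ℝ, ‖f n w k - f n w k'‖ ≤ K₂ * |k - k'| := by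
    intro n hn w hw k k'
    rw [h4 n hn w hw, h4 n hn w hw, ← Finset.sum_sub_distrib, hK₂, Finset.sum_mul]
    refine (norm_sum_le _ _).trans (Finset.sum_le_sum fun s _ => ?_)
    rw [← mul_sub, norm_mul, mul_assoc |C|]
    exact mul_le_mul ((h1 n hn w hw s).trans (le_abs_self C)) (norm_exp_I_mul_sub_le k k' (θ s))
      (norm_nonneg _) (abs_nonneg _)
  refine ⟨K₁ + K₂ + 1, by positivity, n₀, fun n hn w hw k k' => ⟨?_, ?_, ?_⟩⟩
  · have : ‖f n w k‖ ≤ K₁ := by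
      rw [h4 n hn w hw]
      refine (norm_sum_le _ _).trans (Finset.sum_le_sum fun s _ => ?_)
      rw [norm_mul, norm_exp_I_mul, mul_one]
      exact (h1 n hn w hw s).trans (le_abs_self C)
    linarith
  · refine (hlip n hn w hw k k').trans ?_
    gcongr
    linarith
  · have hz : f n w 0 = 0 := by
      rw [h4 n hn w hw]
      simpa using h2 n hn w hw
    have := hlip n hn w hw k 0
    rw [hz, sub_zero, sub_zero] at this
    refine this.trans ?_
    gcongr
    linarith

/-- Convergence is uniform over all real k because the exponentials have modulus one and only the
finitely many coefficients vary with the size. -/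
theorem IsTrigFamily.exists_limit (hf : IsTrigFamily good f) {w : M} (hw : good w) :
    ∃ g : ℝ → ℂ, Continuous g ∧ g 0 = 0 ∧
      ∀ η > 0, ∃ n₀ : ℕ, ∀ n ≥ n₀, ∀ k : ℝ, ‖f n w k - g k‖ < η := by
  obtain ⟨ι, _, θ, c, C, n₀, h1, h2, h3, h4⟩ := hf
  choose L hL using h3 w hw
  refine ⟨fun k => ∑ s, L s * Complex.exp (Complex.I * k * θ s), by fun_prop, ?_,
    fun η hη => ?_⟩
  · have h5 : Tendsto (fun n => ∑ s, c s n w) atTop (𝓝 (∑ s, L s)) :=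
      tendsto_finsetSum _ fun s _ => hL s
    have h6 : Tendsto (fun n => ∑ s, c s n w) atTop (𝓝 0) :=
      tendsto_const_nhds.congr' (by
        filter_upwards [eventually_ge_atTop n₀] with n hn
        exact (h2 n hn w hw).symm)
    simpa using tendsto_nhds_unique h5 h6
  · have h5 : Tendsto (fun n => ∑ s, ‖c s n w - L s‖) atTop (𝓝 0) := by
      have := tendsto_finsetSum (Finset.univ : Finset ι) fun s _ =>
        ((hL s).sub_const (L s)).norm
      simpa using this
    obtain ⟨n₁, hn₁⟩ := eventually_atTop.mp (h5.eventually_lt_const hη)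
    refine ⟨max n₀ n₁, fun n hn k => ?_⟩
    rw [h4 n (le_of_max_le_left hn) w hw, ← Finset.sum_sub_distrib]
    refine lt_of_le_of_lt ((norm_sum_le _ _).trans (Finset.sum_le_sum fun s _ => ?_))
      (hn₁ n (le_of_max_le_right hn))
    rw [← sub_mul, norm_mul, norm_exp_I_mul, mul_one]

end Trig

/-! ### Phases of allowed momenta as characters of the ring -/

section Phase

/-- The phases `e^{ikj}`. -/
noncomputable def phase (N : ℕ) (k : ℝ) (j : ZMod N) : ℂ :=
  Complex.exp (Complex.I * k * (j.val : ℂ))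

variable {N : ℕ} [NeZero N] {p : ℤ} {k : ℝ}

theorem phase_natCast (hk : k = 2 * Real.pi * p / N) (a : ℕ) :
    phase N k (a : ZMod N) = Complex.exp (Complex.I * k * a) := by
  have hN : (N : ℂ) ≠ 0 := by exact_mod_cast NeZero.ne N
  rw [phase, ZMod.val_natCast]
  obtain ⟨c, hc⟩ : ∃ c : ℕ, a = a % N + N * c := ⟨a / N, (Nat.mod_add_div a N).symm⟩
  have h1 : (a : ℂ) = (a % N : ℕ) + N * c := by exact_mod_cast hc
  have h2 : Complex.I * k * a = Complex.I * k * (a % N : ℕ)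
      + ((p * c : ℤ) : ℂ) * (2 * Real.pi * Complex.I) := by
    rw [h1, hk]
    push_cast
    field_simp
  rw [h2, Complex.exp_add, Complex.exp_int_mul_two_pi_mul_I, mul_one]

theorem phase_add (hk : k = 2 * Real.pi * p / N) (i j : ZMod N) :
    phase N k (i + j) = phase N k i * phase N k j := by
  have : i + j = ((i.val + j.val : ℕ) : ZMod N) := by push_cast; simp
  rw [this, phase_natCast hk, phase, phase, ← Complex.exp_add]
  push_cast
  ring_nf

theorem star_phase (i : ZMod N) : star (phase N k i) = Complex.exp (-(Complex.I * k * i.val)) := by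
  rw [phase, Complex.star_def, ← Complex.exp_conj]
  simp only [map_mul, Complex.conj_I, Complex.conj_ofReal, Complex.conj_natCast, neg_mul]

theorem star_phase_mul_self (i : ZMod N) : star (phase N k i) * phase N k i = 1 := by
  rw [star_phase, phase, ← Complex.exp_add, neg_add_cancel, Complex.exp_zero]

theorem star_phase_natCast_mul (hk : k = 2 * Real.pi * p / N) (a b : ℕ) :
    star (phase N k a) * phase N k b = Complex.exp (Complex.I * k * ((b - a : ℝ) : ℂ)) := by
  rw [phase_natCast hk, phase_natCast hk, Complex.star_def, ← Complex.exp_conj, ← Complex.exp_add]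
  congr 1
  simp
  ring

/-- Translation by one site multiplies the sum by e^{ik}, which is not 1 when N does not divide `p`.
-/
theorem sum_phase (hk : k = 2 * Real.pi * p / N) (hp : ¬ (N : ℤ) ∣ p) :
    ∑ j, phase N k j = 0 := by
  have h1 : phase N k 1 * ∑ j, phase N k j = ∑ j, phase N k j := by
    rw [Finset.mul_sum, ← Equiv.sum_comp (Equiv.addLeft (1 : ZMod N)) (phase N k)]
    exact Finset.sum_congr rfl fun j _ => (phase_add hk 1 j).symm
  have h2 : phase N k 1 ≠ 1 := by
    intro hc
    have hN : (N : ℂ) ≠ 0 := by exact_mod_cast NeZero.ne N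
    have h3 := phase_natCast hk 1
    rw [Nat.cast_one, hc, eq_comm, Complex.exp_eq_one_iff] at h3
    obtain ⟨t, ht⟩ := h3
    apply hp
    refine ⟨t, ?_⟩
    have h4 : (2 * Real.pi * Complex.I) * (p : ℂ) = (2 * Real.pi * Complex.I) * (N * t : ℂ) := by
      rw [hk] at ht
      push_cast at ht
      field_simp at ht
      linear_combination (2 * Real.pi * Complex.I) * ht
    have h5 := mul_left_cancel₀ Complex.two_pi_I_ne_zero h4
    exact_mod_cast h5
  have h3 : (phase N k 1 - 1) * ∑ j, phase N k j = 0 := by rw [sub_mul, h1, one_mul, sub_self]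
  exact (mul_eq_zero.mp h3).resolve_left (sub_ne_zero.mpr h2)

theorem twistedState_eq_twist {d : ℕ} (ψ : Fin d → ℂ) (w : List (Matrix (Fin d) (Fin d) ℂ))
    (q : Matrix (Fin d) (Fin d) ℂ) (k : ℝ) :
    twistedState N ψ w q k = twist (phase N k) q (towerState N ψ w) := by
  simp only [twistedState, twistedOp, twist, Matrix.sum_mulVec, Matrix.smul_mulVec, phase]

end Phase

end ScarTower

namespace ScarTower

open Filter Topology

/-! ### Both moments as trigonometric families -/

section Families

open scoped Matrix.Norms.L2Operator

variable {d : ℕ} {G : Type*} [Group G] {u : G →* Matrix.unitaryGroup (Fin d) ℂ}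
variable {ψ : Fin d → ℂ} (q : Matrix (Fin d) (Fin d) ℂ)

/-- Labels whose letters belong to the complexified Lie algebra. -/
def IsLabel (u : G →* Matrix.unitaryGroup (Fin d) ℂ) (w : List (Matrix (Fin d) (Fin d) ℂ)) :
    Prop :=
  ∀ a ∈ w, a ∈ complexGenerators u

/-- All states (q_i - q_r)Ψ with i ≠ r have the same norm, so Cauchy–Schwarz bounds each quotient by
the operator norm of `X n`, whatever the label. For a fixed label, numerator and denominator are
eventually polynomials in the size and the bounded quotient converges. The factor 2 comes from the
norm formula `sand_twist_self`. If the denominator vanishes, the coefficient is 0 by the division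
convention and the estimates persist. -/
theorem isTrigFamily_sand_siteDiff (hψ : star ψ ⬝ᵥ ψ = 1) {ι : Type} [Fintype ι] (θ : ι → ℝ)
    {i j : ι → ℕ} {r : ℕ} (hi : ∀ s, i s < r) (hj : ∀ s, j s < r) (hr : 0 < r)
    {X : OpFamily d} (hX : IsWordFamily X) {C : ℝ} {n₀ : ℕ} (hC : ∀ n ≥ n₀, ‖X n‖ ≤ C)
    (hz : ∀ n ≥ n₀, ∀ w, IsLabel u w →
      ∑ s, sand (siteDiff q (towerState (n + 1) ψ w) r (i s)) (X n)
        (siteDiff q (towerState (n + 1) ψ w) r (j s)) = 0) :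
    IsTrigFamily (IsLabel u) fun n w k => ∑ s,
      2 * sand (siteDiff q (towerState (n + 1) ψ w) r (i s)) (X n)
          (siteDiff q (towerState (n + 1) ψ w) r (j s)) /
        sand (siteDiff q (towerState (n + 1) ψ w) r (0 : ℕ)) 1
          (siteDiff q (towerState (n + 1) ψ w) r (0 : ℕ)) *
      Complex.exp (Complex.I * k * θ s) := by
  have hle : ∀ n, n₀ ≤ n → r ≤ n → ∀ w, IsLabel u w → ∀ s,
      ‖sand (siteDiff q (towerState (n + 1) ψ w) r (i s)) (X n)
          (siteDiff q (towerState (n + 1) ψ w) r (j s))‖ ≤ C *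
        ‖sand (siteDiff q (towerState (n + 1) ψ w) r (0 : ℕ)) 1
          (siteDiff q (towerState (n + 1) ψ w) r (0 : ℕ))‖ := by
    intro n hn hrn w hw s
    have hs : IsSymm (towerState (n + 1) ψ w) :=
      isSymm_of_mem_scarSpace u (towerState_mem_scarSpace u hw)
    have hne : ∀ t < r, (t : ZMod (n + 1)) ≠ (r : ZMod (n + 1)) := fun t ht hc => by
      have := eq_of_natCast_zmod_eq (by omega) (by omega) hc
      omega
    refine (norm_sand_le_of_eq (X n) (sand_siteDiff_self_const q hs (hne _ (hi s)) (hne 0 hr))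
      (sand_siteDiff_self_const q hs (hne _ (hj s)) (hne 0 hr))).trans ?_
    gcongr
    exact hC n hn
  refine ⟨ι, inferInstance, θ, _, 2 * |C|, max n₀ r, fun n hn w hw s => ?_,
    fun n hn w hw => ?_, fun w hw s => ?_, fun n hn w hw k => rfl⟩
  · have h1 := hle n (le_of_max_le_left hn) (le_of_max_le_right hn) w hw s
    rw [norm_div, norm_mul, mul_div_assoc]
    have h2 : ‖(2 : ℂ)‖ = 2 := by simp
    rw [h2]
    refine mul_le_mul_of_nonneg_left (div_le_of_le_mul₀ (norm_nonneg _) (abs_nonneg _) ?_)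
      zero_le_two
    exact h1.trans (mul_le_mul_of_nonneg_right (le_abs_self C) (norm_nonneg _))
  · rw [← Finset.sum_div, ← Finset.mul_sum, hz n (le_of_max_le_left hn) w hw]
    simp
  · obtain ⟨P, hP⟩ := eventuallyPoly_sand_siteDiff hψ q w r (i s) (j s) hX
    obtain ⟨Q, hQ⟩ := eventuallyPoly_sand_siteDiff hψ q w r 0 0 isWordFamily_one
    obtain ⟨L, hL⟩ := exists_tendsto_eval_div_eval (p := P) (q := Q) (C := C) (by
      filter_upwards [hP, hQ, eventually_ge_atTop n₀, eventually_ge_atTop r] with n h1 h2 h3 h4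
      rw [← h1, ← h2]
      exact hle n h3 h4 w hw s)
    refine ⟨2 * L, (hL.const_mul 2).congr' ?_⟩
    filter_upwards [hP, hQ] with n h1 h2
    rw [h1, h2, mul_div_assoc]

variable {m : ℕ} (h : Matrix (Fin (m + 1) → Fin d) (Fin (m + 1) → Fin d) ℂ)

theorem isWordFamily_nearOp : IsWordFamily fun n => nearOp (n + 1) h :=
  IsWordFamily.sum fun _ _ => (isWordFamily_blockOp h _).mul (isWordFamily_blockOp h _)

theorem isWordFamily_farOp : IsWordFamily fun n => farOp (n + 1) h :=
  (isWordFamily_blockOp h _).mul (isWordFamily_blockOp h _)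

theorem norm_blockOp_mul_le {N : ℕ} [NeZero N] (hN : m + 1 ≤ N) (l l' : ZMod N) :
    ‖blockOp N h l * blockOp N h l'‖ ≤ (∑ s, ∑ t, ‖h s t‖) * ∑ s, ∑ t, ‖h s t‖ :=
  (norm_mul_le _ _).trans (mul_le_mul (norm_blockOp_le hN h l) (norm_blockOp_le hN h l')
    (norm_nonneg _) (Finset.sum_nonneg fun _ _ => Finset.sum_nonneg fun _ _ => norm_nonneg _))

theorem norm_nearOp_le {N : ℕ} [NeZero N] (hN : m + 1 ≤ N) :
    ‖nearOp N h‖ ≤ ∑ _t : Fin (2 * m + 1), (∑ s, ∑ t, ‖h s t‖) * ∑ s, ∑ t, ‖h s t‖ :=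
  (norm_sum_le _ _).trans (Finset.sum_le_sum fun _ _ => norm_blockOp_mul_le h hN _ _)

variable {h} {q}

theorem exists_trigFamily_energy (hψ : star ψ ⬝ᵥ ψ = 1) (hq : q ∈ complexGenerators u) {n₁ : ℕ}
    (h0 : ∀ n ≥ n₁, ∀ Φ ∈ scarSpace u ψ (n + 1), hamiltonian (n + 1) h *ᵥ Φ = 0) :
    ∃ f, IsTrigFamily (IsLabel u) f ∧ ∃ n₀ : ℕ, ∀ n ≥ n₀, ∀ w, IsLabel u w →
      ∀ (p : ℤ) (k : ℝ), k = 2 * Real.pi * p / (n + 1 : ℕ) → ¬ ((n + 1 : ℕ) : ℤ) ∣ p →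
      sand (twistedState (n + 1) ψ w q k) (hamiltonian (n + 1) h) (twistedState (n + 1) ψ w q k) /
        sand (twistedState (n + 1) ψ w q k) 1 (twistedState (n + 1) ψ w q k) = f n w k := by
  refine ⟨_, isTrigFamily_sand_siteDiff (u := u) q hψ (ι := Fin (3 * m + 2) × Fin (3 * m + 2))
    (fun s => ((s.2 : ℕ) : ℝ) - ((s.1 : ℕ) : ℝ)) (i := fun s => s.1) (j := fun s => s.2)
    (r := 3 * m + 3) (fun s => by omega) (fun s => by omega) (by omega)
    (isWordFamily_blockOp h (m + 1)) (n₀ := max n₁ (3 * m + 3))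
    (fun n hn => norm_blockOp_le (by have := le_of_max_le_right hn; omega) h _) ?_,
    max n₁ (3 * m + 3), ?_⟩
  · intro n hn w hw
    have hN : 3 * m + 4 ≤ n + 1 := by have := le_of_max_le_right hn; omega
    have hΨ : towerState (n + 1) ψ w ∈ scarSpace u ψ (n + 1) := towerState_mem_scarSpace u hw
    have := sum_sand_siteDiff_eq_zero q hΨ (collectiveOp_mem_scarSpace u hq hΨ)
      (nullOn_window_blockOp hψ hN (h0 n (le_of_max_le_left hn))) (notMem_window hN)
    simp only [sum_window hN] at this
    rw [Fintype.sum_prod_type]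
    exact this
  · intro n hn w hw p k hk hp
    have hN : 3 * m + 4 ≤ n + 1 := by have := le_of_max_le_right hn; omega
    have h0' := h0 n (le_of_max_le_left hn)
    have hΨ : towerState (n + 1) ψ w ∈ scarSpace u ψ (n + 1) := towerState_mem_scarSpace u hw
    have hs := isSymm_of_mem_scarSpace u hΨ
    have hχ := sum_phase hk hp
    have hne : ((0 : ℕ) : ZMod (n + 1)) ≠ ((3 * m + 3 : ℕ) : ZMod (n + 1)) := fun hc => by
      have := eq_of_natCast_zmod_eq (by omega) (by omega) hc
      omega
    have hn0 : ((n + 1 : ℕ) : ℂ) ≠ 0 := by exact_mod_cast Nat.succ_ne_zero n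
    rw [twistedState_eq_twist, sand_twist_self q hχ star_phase_mul_self hs hne,
      sand_twist_hamiltonian q (phase_add hk) star_phase_mul_self hs ((m + 1 : ℕ) : ZMod (n + 1)),
      mul_div_mul_left _ _ hn0, sand_twist_window q hχ hΨ hN (localOn_window_blockOp hN)
      (nullOn_window_blockOp hψ hN h0'), ← Fintype.sum_prod_type', Finset.sum_div]
    refine Finset.sum_congr rfl fun s _ => ?_
    rw [star_phase_natCast_mul hk]
    push_cast
    ring

theorem exists_trigFamily_energy_sq (hψ : star ψ ⬝ᵥ ψ = 1) (hq : q ∈ complexGenerators u) {n₁ : ℕ}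
    (h0 : ∀ n ≥ n₁, ∀ Φ ∈ scarSpace u ψ (n + 1), hamiltonian (n + 1) h *ᵥ Φ = 0) :
    ∃ f, IsTrigFamily (IsLabel u) f ∧ ∃ n₀ : ℕ, ∀ n ≥ n₀, ∀ w, IsLabel u w →
      ∀ (p : ℤ) (k : ℝ), k = 2 * Real.pi * p / (n + 1 : ℕ) → ¬ ((n + 1 : ℕ) : ℤ) ∣ p →
      sand (twistedState (n + 1) ψ w q k) (hamiltonian (n + 1) h * hamiltonian (n + 1) h)
          (twistedState (n + 1) ψ w q k) /
        sand (twistedState (n + 1) ψ w q k) 1 (twistedState (n + 1) ψ w q k) = f n w k := by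
  have hT1 := isTrigFamily_sand_siteDiff (u := u) q hψ (ι := Fin (3 * m + 2) × Fin (3 * m + 2))
    (fun s => ((s.2 : ℕ) : ℝ) - ((s.1 : ℕ) : ℝ)) (i := fun s => s.1) (j := fun s => s.2)
    (r := 3 * m + 3) (fun s => by omega) (fun s => by omega) (by omega)
    (isWordFamily_nearOp h) (n₀ := max n₁ (3 * m + 3))
    (fun n hn => norm_nearOp_le h (by have := le_of_max_le_right hn; omega)) (by
      intro n hn w hw
      have hN : 3 * m + 4 ≤ n + 1 := by have := le_of_max_le_right hn; omega
      have hΨ : towerState (n + 1) ψ w ∈ scarSpace u ψ (n + 1) := towerState_mem_scarSpace u hw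
      have := sum_sand_siteDiff_eq_zero q hΨ (collectiveOp_mem_scarSpace u hq hΨ)
        (nullOn_window_nearOp hψ hN (h0 n (le_of_max_le_left hn))) (notMem_window hN)
      simp only [sum_window hN] at this
      rw [Fintype.sum_prod_type]
      exact this)
  have hfar : ∀ n ≥ max n₁ (3 * m + 3), ∀ w, IsLabel u w → _ := fun n hn w hw =>
    have hΨ : towerState (n + 1) ψ w ∈ scarSpace u ψ (n + 1) := towerState_mem_scarSpace u hw
    sum_farOp_eq_zero (u := u) q hψ hΨ (collectiveOp_mem_scarSpace u hq hΨ)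
      (by have := le_of_max_le_right hn; omega) (h0 n (le_of_max_le_left hn))
  -- In the distant part the frequencies use the near base point t + 1, while the matrix elements
  -- sit at the representative block 2m + 2; for each `t` the coefficients already sum to zero.
  have hT2 := isTrigFamily_sand_siteDiff (u := u) q hψ
    (ι := Fin (2 * m + 1) × Fin (m + 1) × Fin (m + 1))
    (fun s => (((s.1 : ℕ) + 1 + (s.2.2 : ℕ) : ℕ) : ℝ) - ((m + 1 + (s.2.1 : ℕ) : ℕ) : ℝ))
    (i := fun s => m + 1 + s.2.1) (j := fun s => 2 * m + 2 + s.2.2)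
    (r := 3 * m + 3) (fun s => by omega) (fun s => by omega) (by omega)
    (isWordFamily_farOp h) (n₀ := max n₁ (3 * m + 3))
    (fun n hn => norm_blockOp_mul_le h (by have := le_of_max_le_right hn; omega) _ _) (by
      intro n hn w hw
      rw [Fintype.sum_prod_type]
      refine Finset.sum_eq_zero fun t _ => ?_
      rw [Fintype.sum_prod_type]
      exact (hfar n hn w hw).1)
  have hT3 := isTrigFamily_sand_siteDiff (u := u) q hψ
    (ι := Fin (2 * m + 1) × Fin (m + 1) × Fin (m + 1))
    (fun s => ((m + 1 + (s.2.1 : ℕ) : ℕ) : ℝ) - (((s.1 : ℕ) + 1 + (s.2.2 : ℕ) : ℕ) : ℝ))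
    (i := fun s => 2 * m + 2 + s.2.2) (j := fun s => m + 1 + s.2.1)
    (r := 3 * m + 3) (fun s => by omega) (fun s => by omega) (by omega)
    (isWordFamily_farOp h) (n₀ := max n₁ (3 * m + 3))
    (fun n hn => norm_blockOp_mul_le h (by have := le_of_max_le_right hn; omega) _ _) (by
      intro n hn w hw
      rw [Fintype.sum_prod_type]
      refine Finset.sum_eq_zero fun t _ => ?_
      rw [Fintype.sum_prod_type]
      exact (hfar n hn w hw).2)
  refine ⟨_, hT1.add (hT2.add hT3).neg, max n₁ (3 * m + 3), ?_⟩
  intro n hn w hw p k hk hp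
  have hN : 3 * m + 4 ≤ n + 1 := by have := le_of_max_le_right hn; omega
  have h0' := h0 n (le_of_max_le_left hn)
  have hΨ : towerState (n + 1) ψ w ∈ scarSpace u ψ (n + 1) := towerState_mem_scarSpace u hw
  have hs := isSymm_of_mem_scarSpace u hΨ
  have hχ := sum_phase hk hp
  have hne : ((0 : ℕ) : ZMod (n + 1)) ≠ ((3 * m + 3 : ℕ) : ZMod (n + 1)) := fun hc => by
    have := eq_of_natCast_zmod_eq (by omega) (by omega) hc
    omega
  have hn0 : ((n + 1 : ℕ) : ℂ) ≠ 0 := by exact_mod_cast Nat.succ_ne_zero n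
  rw [twistedState_eq_twist, sand_twist_self q hχ star_phase_mul_self hs hne,
    sand_twist_hamiltonian_sq q (phase_add hk) star_phase_mul_self hs ((m + 1 : ℕ) : ZMod (n + 1)),
    mul_div_mul_left _ _ hn0, ← Finset.sum_add_sum_compl (nearSites (n + 1) m),
    sum_far_eq q hχ hψ hΨ hN h0', ← sand_sum_mid, ← nearOp_eq_sum h hN,
    sand_twist_window q hχ hΨ hN (localOn_window_nearOp hN)
    (nullOn_window_nearOp hψ hN h0'), ← Fintype.sum_prod_type', add_div, neg_div]
  congr 1
  · rw [Finset.sum_div]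
    refine Finset.sum_congr rfl fun s _ => ?_
    rw [star_phase_natCast_mul hk]
    push_cast
    ring
  · congr 1
    rw [Fintype.sum_prod_type, Fintype.sum_prod_type, ← Finset.sum_add_distrib, Finset.sum_div]
    refine Finset.sum_congr rfl fun t _ => ?_
    rw [Fintype.sum_prod_type, Fintype.sum_prod_type, ← Finset.sum_add_distrib, Finset.sum_div]
    refine Finset.sum_congr rfl fun a _ => ?_
    rw [← Finset.sum_add_distrib, Finset.sum_div]
    refine Finset.sum_congr rfl fun b _ => ?_
    rw [star_phase_natCast_mul hk, star_phase_natCast_mul hk, Complex.ofReal_sub,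
      Complex.ofReal_sub]
    ring

end Families

/-! ### Subtracting the ground value from the local term -/

section Shift

variable {d N m : ℕ} [NeZero N] (h : Matrix (Fin (m + 1) → Fin d) (Fin (m + 1) → Fin d) ℂ)

/-- The expectation of the local term in the product of anchor states. -/
noncomputable def anchorEnergy (ψ : Fin d → ℂ) : ℂ :=
  ∑ s, ∑ t, h s t * ∏ a, (star (ψ (s a)) * ψ (t a))

theorem sand_blockOp_productState {ψ : Fin d → ℂ} (hψ : star ψ ⬝ᵥ ψ = 1) (hN : m + 1 ≤ N)
    (l : ZMod N) :
    sand (productState N ψ) (blockOp N h l) (productState N ψ) = anchorEnergy h ψ := by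
  have hf := blockSites_injective hN l
  rw [blockOp_eq_placeOp, placeOp_eq_sum_unitFamily h hf, sand_sum_mid, anchorEnergy]
  refine Finset.sum_congr rfl fun s _ => ?_
  rw [sand_sum_mid]
  refine Finset.sum_congr rfl fun t _ => ?_
  rw [sand_smul_mid, productState_eq_prodVec, sand, multiOp_mulVec_prodVec,
    star_prodVec_dotProduct]
  congr 1
  symm
  refine Fintype.prod_of_injective _ hf _ _ (fun j hj => ?_) fun a => ?_
  · rw [unitFamily_of_ne _ _ _ fun a ha => hj ⟨a, ha.symm⟩, Matrix.one_mulVec, hψ]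
  · rw [unitFamily_apply hf, Matrix.single_mulVec]
    simp [dotProduct, Function.update_apply]

theorem hamiltonian_sub_smul_one (c : ℂ) :
    hamiltonian N (h - c • 1) = hamiltonian N h - (N * c) • (1 : Op d N) := by
  simp only [hamiltonian, blockOp_eq_placeOp, placeOp_sub, placeOp_smul_one,
    Finset.sum_sub_distrib, Finset.sum_const, Finset.card_univ, ZMod.card]
  rw [mul_smul, Nat.cast_smul_eq_nsmul]

variable {h}

open scoped ComplexOrder in
-- Shifting by a scalar moves the mean and leaves the variance unchanged. The variance is expanded
-- with the real part of the mean because `energy` is defined as a real part.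
theorem energy_eq_and_energyVariance_eq {H H' : Op d N} {E : ℝ} (hH : H = H' + (E : ℂ) • 1)
    {Ψ : State d N} (hΨ : Ψ ≠ 0) :
    energy N H Ψ - E = (sand Ψ H' Ψ / sand Ψ 1 Ψ).re ∧
      energyVariance N H Ψ = (sand Ψ (H' * H') Ψ / sand Ψ 1 Ψ).re
        - (sand Ψ H' Ψ / sand Ψ 1 Ψ).re ^ 2 := by
  have hne : sand Ψ 1 Ψ ≠ 0 := by
    rw [sand_one]
    exact fun hc => hΨ (dotProduct_star_self_eq_zero.mp hc)
  have hexp : ∀ A : Op d N, expectation N A Ψ = sand Ψ A Ψ / sand Ψ 1 Ψ := fun A => by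
    rw [expectation, sand_one, sand]
  have h1 : energy N H Ψ - E = (sand Ψ H' Ψ / sand Ψ 1 Ψ).re := by
    rw [energy, hexp, hH, sand_add_mid, sand_smul_mid, add_div, mul_div_cancel_right₀ _ hne]
    simp
  refine ⟨h1, ?_⟩
  set R := sand Ψ H' Ψ / sand Ψ 1 Ψ with hR
  have h2 : H - (energy N H Ψ : ℂ) • (1 : Op d N) = H' - (R.re : ℂ) • 1 := by
    rw [← h1, hH]
    push_cast
    rw [sub_smul]
    abel
  have h3 : (H' - (R.re : ℂ) • (1 : Op d N)) ^ 2
      = H' * H' - (2 * R.re : ℂ) • H' + (R.re ^ 2 : ℂ) • 1 := by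
    rw [sq, sub_mul, mul_sub, mul_sub]
    simp only [mul_smul_comm, smul_mul_assoc, mul_one, one_mul, smul_smul]
    module
  rw [energyVariance, h2, hexp, h3, sand_add_mid, sand_sub_mid, sand_smul_mid, sand_smul_mid,
    add_div, sub_div, mul_div_cancel_right₀ _ hne, mul_div_assoc, ← hR, Complex.add_re,
    Complex.sub_re]
  have h4 : ((2 * R.re : ℂ) * R).re = 2 * R.re * R.re := by
    simp
  have h5 : ((R.re : ℂ) ^ 2).re = R.re ^ 2 := by
    rw [← Complex.ofReal_pow, Complex.ofReal_re]
  rw [h4, h5]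
  ring

end Shift

end ScarTower

namespace ScarTower

open Filter Topology

/-! ### From trigonometric families to limits and uniform moduli of continuity -/

theorem abs_sq_sub_sq_le {x y K a : ℝ} (hx : |x| ≤ K) (hy : |y| ≤ K) (hxy : |x - y| ≤ a) :
    |x ^ 2 - y ^ 2| ≤ 2 * K * a := by
  have h1 : x ^ 2 - y ^ 2 = (x + y) * (x - y) := by ring
  rw [h1, abs_mul]
  have h2 : |x + y| ≤ 2 * K := (abs_add_le x y).trans (by linarith)
  exact mul_le_mul h2 hxy (abs_nonneg _) ((abs_nonneg _).trans h2)

section Limits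

variable {M : Type*} {good : M → Prop} {f₁ f₂ : ℕ → M → ℝ → ℂ}

theorem exists_limits_of_isTrigFamily (h₁ : IsTrigFamily good f₁) (h₂ : IsTrigFamily good f₂)
    {w : M} (hw : good w) :
    ∃ ε v : ℝ → ℝ, Continuous ε ∧ Continuous v ∧ Tendsto ε (𝓝 0) (𝓝 0) ∧ Tendsto v (𝓝 0) (𝓝 0) ∧
      ∀ η > 0, ∃ n₀ : ℕ, ∀ n ≥ n₀, ∀ k : ℝ, |(f₁ n w k).re - ε k| < η ∧
        |((f₂ n w k).re - (f₁ n w k).re ^ 2) - v k| < η := by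
  obtain ⟨g₁, hc₁, hz₁, hl₁⟩ := h₁.exists_limit hw
  obtain ⟨g₂, hc₂, hz₂, hl₂⟩ := h₂.exists_limit hw
  obtain ⟨K, hK, n₁, hb⟩ := h₁.exists_bound
  have hε : Continuous fun k => (g₁ k).re := Complex.continuous_re.comp hc₁
  have hv : Continuous fun k => (g₂ k).re - (g₁ k).re ^ 2 :=
    (Complex.continuous_re.comp hc₂).sub (hε.pow 2)
  refine ⟨_, _, hε, hv, ?_, ?_, fun η hη => ?_⟩
  · simpa [hz₁] using hε.tendsto 0
  · simpa [hz₁, hz₂] using hv.tendsto 0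
  -- The cap 1 keeps the limit bounded by K + 1; the variance error is then below η' from the second
  -- moment plus 2(K + 1)η' from the squared mean.
  · set η' := min 1 (η / (2 * (K + 1) + 2)) with hη'
    have hη'0 : 0 < η' := by positivity
    have hη'1 : η' ≤ 1 := min_le_left _ _
    have hη'2 : η' * (2 * (K + 1) + 2) ≤ η := by
      rw [← le_div_iff₀ (by positivity)]
      exact min_le_right _ _
    obtain ⟨n₂, hn₂⟩ := hl₁ η' hη'0
    obtain ⟨n₃, hn₃⟩ := hl₂ η' hη'0
    refine ⟨max n₁ (max n₂ n₃), fun n hn k => ?_⟩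
    have e1 := hn₂ n ((le_max_left _ _).trans (le_of_max_le_right hn)) k
    have e2 := hn₃ n ((le_max_right _ _).trans (le_of_max_le_right hn)) k
    have e3 := (hb n (le_of_max_le_left hn) w hw k k).1
    have r1 : |(f₁ n w k).re - (g₁ k).re| < η' := by
      rw [← Complex.sub_re]
      exact (Complex.abs_re_le_norm _).trans_lt e1
    have r2 : |(f₂ n w k).re - (g₂ k).re| < η' := by
      rw [← Complex.sub_re]
      exact (Complex.abs_re_le_norm _).trans_lt e2
    have r3 : |(f₁ n w k).re| ≤ K := (Complex.abs_re_le_norm _).trans e3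
    have r4 : |(g₁ k).re| ≤ K + 1 := by
      have := abs_sub_abs_le_abs_sub (g₁ k).re (f₁ n w k).re
      rw [abs_sub_comm] at this
      linarith
    have r5 := abs_sq_sub_sq_le (r3.trans (by linarith : K ≤ K + 1)) r4 r1.le
    have hη'3 : η' * 1 ≤ η' * (2 * (K + 1) + 2) := by gcongr; linarith
    refine ⟨by linarith, ?_⟩
    have r6 : (f₂ n w k).re - (f₁ n w k).re ^ 2 - ((g₂ k).re - (g₁ k).re ^ 2)
        = ((f₂ n w k).re - (g₂ k).re) - ((f₁ n w k).re ^ 2 - (g₁ k).re ^ 2) := by ring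
    rw [r6]
    have := abs_sub ((f₂ n w k).re - (g₂ k).re) ((f₁ n w k).re ^ 2 - (g₁ k).re ^ 2)
    linarith

theorem exists_modulus_of_isTrigFamily (h₁ : IsTrigFamily good f₁) (h₂ : IsTrigFamily good f₂)
    {η : ℝ} (hη : 0 < η) :
    ∃ δ > 0, ∃ n₀ : ℕ, ∀ n ≥ n₀, ∀ w, good w → ∀ k : ℝ,
      (∀ k', |k - k'| < δ → |(f₁ n w k).re - (f₁ n w k').re| < η ∧
        |((f₂ n w k).re - (f₁ n w k).re ^ 2) - ((f₂ n w k').re - (f₁ n w k').re ^ 2)| < η) ∧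
      (|k| < δ → |(f₁ n w k).re| < η ∧ |(f₂ n w k).re - (f₁ n w k).re ^ 2| < η) := by
  obtain ⟨K₁, hK₁, n₁, hb₁⟩ := h₁.exists_bound
  obtain ⟨K₂, hK₂, n₂, hb₂⟩ := h₂.exists_bound
  -- A common Lipschitz constant: K₁ for the energy, K₂ for the second moment, and 2K₁² for the
  -- squared energy.
  set A := K₁ + K₂ + 2 * K₁ * K₁ with hA
  have hA0 : 0 < A := by positivity
  have hre : ∀ {x y : ℂ} {a : ℝ}, ‖x - y‖ ≤ a → |x.re - y.re| ≤ a := fun hxy => by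
    rw [← Complex.sub_re]
    exact (Complex.abs_re_le_norm _).trans hxy
  have hre' : ∀ {x : ℂ} {a : ℝ}, ‖x‖ ≤ a → |x.re| ≤ a := fun hx =>
    (Complex.abs_re_le_norm _).trans hx
  refine ⟨η / A, by positivity, max n₁ n₂, fun n hn w hw k => ⟨fun k' hk => ?_, fun hk => ?_⟩⟩
  · rw [lt_div_iff₀ hA0] at hk
    obtain ⟨b1, b2, _⟩ := hb₁ n (le_of_max_le_left hn) w hw k k'
    obtain ⟨b3, _, _⟩ := hb₁ n (le_of_max_le_left hn) w hw k' k'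
    obtain ⟨_, b4, _⟩ := hb₂ n (le_of_max_le_right hn) w hw k k'
    have c1 := hre b2
    have c2 := hre b4
    have c3 := abs_sq_sub_sq_le (hre' b1) (hre' b3) c1
    have p0 := abs_nonneg (k - k')
    have p1 : 0 ≤ K₁ * |k - k'| := by positivity
    have p2 : 0 ≤ K₂ * |k - k'| := by positivity
    have p3 : 0 ≤ 2 * K₁ * (K₁ * |k - k'|) := by positivity
    have hsum : |k - k'| * A = K₁ * |k - k'| + K₂ * |k - k'| + 2 * K₁ * (K₁ * |k - k'|) := by
      rw [hA]; ring
    refine ⟨by linarith, ?_⟩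
    have r6 : (f₂ n w k).re - (f₁ n w k).re ^ 2 - ((f₂ n w k').re - (f₁ n w k').re ^ 2)
        = ((f₂ n w k).re - (f₂ n w k').re) - ((f₁ n w k).re ^ 2 - (f₁ n w k').re ^ 2) := by ring
    rw [r6]
    have c4 := abs_sub ((f₂ n w k).re - (f₂ n w k').re) ((f₁ n w k).re ^ 2 - (f₁ n w k').re ^ 2)
    have c5 : |(f₂ n w k).re - (f₂ n w k').re| + |(f₁ n w k).re ^ 2 - (f₁ n w k').re ^ 2| < η := by
      by_cases hz : 0 < |k - k'|
      · have : 0 < K₁ * |k - k'| := by positivity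
        linarith
      · have hz' : |k - k'| = 0 := le_antisymm (not_lt.mp hz) p0
        rw [hz'] at c2 c3
        linarith
    linarith
  · rw [lt_div_iff₀ hA0] at hk
    obtain ⟨b1, _, b2⟩ := hb₁ n (le_of_max_le_left hn) w hw k k
    obtain ⟨_, _, b4⟩ := hb₂ n (le_of_max_le_right hn) w hw k k
    have c1 := hre' b2
    have c2 := hre' b4
    have c3 := abs_sq_sub_sq_le (y := 0) (hre' b1) (by simpa using hK₁.le) (by simpa using c1)
    rw [zero_pow two_ne_zero, sub_zero] at c3
    have p1 : 0 ≤ K₁ * |k| := by positivity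
    have p2 : 0 ≤ K₂ * |k| := by positivity
    have p3 : 0 ≤ 2 * K₁ * (K₁ * |k|) := by positivity
    have hsum : |k| * A = K₁ * |k| + K₂ * |k| + 2 * K₁ * (K₁ * |k|) := by
      rw [hA]; ring
    have c4 := abs_sub (f₂ n w k).re ((f₁ n w k).re ^ 2)
    exact ⟨by linarith, by linarith⟩

end Limits

/-! ### Assembly -/

section Main

variable {d m : ℕ} {G : Type*} [Group G] {u : G →* Matrix.unitaryGroup (Fin d) ℂ}
variable {ψ : Fin d → ℂ} {h : Matrix (Fin (m + 1) → Fin d) (Fin (m + 1) → Fin d) ℂ}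

/-- Taking the expectation in the anchor product state shows that the degenerate energy is exactly
extensive. Hence one size-independent scalar subtracted from the local term removes it at every
size. -/
theorem energy_eq_natCast_mul_anchorEnergy (hψ : star ψ ⬝ᵥ ψ = 1) {N : ℕ} [NeZero N]
    (hN : m + 1 ≤ N) {E : ℝ}
    (hE : ∀ Ψ ∈ scarSpace u ψ N, hamiltonian N h *ᵥ Ψ = (E : ℂ) • Ψ) :
    (E : ℂ) = N * anchorEnergy h ψ := by
  have hmem : productState N ψ ∈ scarSpace u ψ N :=
    towerState_mem_scarSpace u (w := []) (by simp)
  have h1 : sand (productState N ψ) (hamiltonian N h) (productState N ψ) = E := by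
    rw [sand, hE _ hmem, dotProduct_smul, productState_eq_prodVec, star_prodVec_dotProduct]
    simp [hψ]
  rw [← h1, hamiltonian, sand_sum_mid]
  simp_rw [sand_blockOp_productState h hψ hN]
  simp [ZMod.card]

/-- Energy and variance of the twisted tower states are trigonometric polynomials in the momentum
with bounded coefficients. -/
theorem exists_trigFamilies (hψ : star ψ ⬝ᵥ ψ = 1) {N₁ : ℕ} {E₀ : ℕ → ℝ}
    (hscar : ∀ (N : ℕ) [NeZero N], N₁ ≤ N → ∀ Ψ ∈ scarSpace u ψ N,
      hamiltonian N h *ᵥ Ψ = (E₀ N : ℂ) • Ψ)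
    {q : Matrix (Fin d) (Fin d) ℂ} (hq : q ∈ complexGenerators u) :
    ∃ f₁ f₂, IsTrigFamily (IsLabel u) f₁ ∧ IsTrigFamily (IsLabel u) f₂ ∧
      ∃ n₀ : ℕ, ∀ n ≥ n₀, ∀ w, IsLabel u w → ∀ (p : ℤ) (k : ℝ),
        k = 2 * Real.pi * p / (n + 1 : ℕ) → ¬ ((n + 1 : ℕ) : ℤ) ∣ p →
        twistedState (n + 1) ψ w q k ≠ 0 →
        energy (n + 1) (hamiltonian (n + 1) h) (twistedState (n + 1) ψ w q k) - E₀ (n + 1)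
            = (f₁ n w k).re ∧
          energyVariance (n + 1) (hamiltonian (n + 1) h) (twistedState (n + 1) ψ w q k)
            = (f₂ n w k).re - (f₁ n w k).re ^ 2 := by
  set h' := h - anchorEnergy h ψ • 1 with hh'
  have hH : ∀ n ≥ max N₁ m, hamiltonian (n + 1) h
      = hamiltonian (n + 1) h' + (E₀ (n + 1) : ℂ) • 1 := by
    intro n hn
    have h1 : N₁ ≤ n := le_of_max_le_left hn
    have h2 : m ≤ n := le_of_max_le_right hn
    rw [hh', hamiltonian_sub_smul_one, energy_eq_natCast_mul_anchorEnergy (u := u) hψ (by omega)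
      (hscar (n + 1) (by omega)), sub_add_cancel]
  have h0 : ∀ n ≥ max N₁ m, ∀ Φ ∈ scarSpace u ψ (n + 1), hamiltonian (n + 1) h' *ᵥ Φ = 0 := by
    intro n hn Φ hΦ
    have h1 := hscar (n + 1) (by have := le_of_max_le_left hn; omega) Φ hΦ
    rw [hH n hn, Matrix.add_mulVec, Matrix.smul_mulVec, Matrix.one_mulVec] at h1
    simpa using h1
  obtain ⟨f₁, hf₁, n₁, hn₁⟩ := exists_trigFamily_energy hψ hq h0
  obtain ⟨f₂, hf₂, n₂, hn₂⟩ := exists_trigFamily_energy_sq hψ hq h0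
  refine ⟨f₁, f₂, hf₁, hf₂, max (max N₁ m) (max n₁ n₂), fun n hn w hw p k hk hp hne => ?_⟩
  have e1 := hn₁ n ((le_max_left _ _).trans (le_of_max_le_right hn)) w hw p k hk hp
  have e2 := hn₂ n ((le_max_right _ _).trans (le_of_max_le_right hn)) w hw p k hk hp
  rw [← e1, ← e2]
  exact energy_eq_and_energyVariance_eq (hH n (le_of_max_le_left hn)) hne

end Main

end ScarTower

theorem mainTheorem6 {d m : ℕ} {G : Type*} [Group G]
    -- the onsite unitary action of the quasisymmetry group
    (u : G →* Matrix.unitaryGroup (Fin d) ℂ)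
    -- Cartan subalgebra, choice of positive roots, and local anchor state
    (T : Submodule ℝ (Matrix (Fin d) (Fin d) ℂ)) (hT : ScarTower.IsCartan u T)
    (z : T) (hz : ScarTower.IsRegular u T z)
    (ψ : Fin d → ℂ) (hψ : ScarTower.IsAnchor u T z ψ)
    -- the local term, and degeneracy of the Hamiltonian on the quasisymmetry subspace
    (h : Matrix (Fin (m + 1) → Fin d) (Fin (m + 1) → Fin d) ℂ) (hh : h.IsHermitian)
    (N₁ : ℕ) (E₀ : ℕ → ℝ)
    (hscar : ∀ (N : ℕ) [NeZero N], N₁ ≤ N → ∀ Ψ ∈ ScarTower.scarSpace u ψ N,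
      ScarTower.hamiltonian N h *ᵥ Ψ = (E₀ N : ℂ) • Ψ)
    -- the ladder operator that creates the mode
    (q : Matrix (Fin d) (Fin d) ℂ) (hq : ScarTower.IsRaising u T z q) :
    -- a fixed tower label: the thermodynamic limits exist, are continuous in `k`, and vanish
    -- as `k → 0`; the finite-size quantities converge to them uniformly in the momentum
    (∀ w : List (Matrix (Fin d) (Fin d) ℂ), (∀ a ∈ w, ScarTower.IsRaising u T z a) →
      ∃ ε v : ℝ → ℝ, Continuous ε ∧ Continuous v ∧
        Filter.Tendsto ε (nhds 0) (nhds 0) ∧ Filter.Tendsto v (nhds 0) (nhds 0) ∧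
        ∀ η > 0, ∃ N₀ : ℕ, ∀ (N : ℕ) [NeZero N], N₀ ≤ N → ∀ (p : ℤ) (k : ℝ),
          k = 2 * Real.pi * p / N → ¬ (N : ℤ) ∣ p →
          ScarTower.twistedState N ψ w q k ≠ 0 →
          |ScarTower.energy N (ScarTower.hamiltonian N h) (ScarTower.twistedState N ψ w q k)
              - E₀ N - ε k| < η ∧
          |ScarTower.energyVariance N (ScarTower.hamiltonian N h)
              (ScarTower.twistedState N ψ w q k) - v k| < η) ∧
    -- arbitrary tower states, whose label may depend on the size (finite filling included):
    -- energy and variance are continuous in `k`, and small for small `k`, uniformly in the tower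
    -- state and in the size
    (∀ η > 0, ∃ δ > 0, ∃ N₀ : ℕ, ∀ (N : ℕ) [NeZero N], N₀ ≤ N →
      ∀ w : List (Matrix (Fin d) (Fin d) ℂ), (∀ a ∈ w, ScarTower.IsRaising u T z a) →
      ∀ (p : ℤ) (k : ℝ), k = 2 * Real.pi * p / N → ¬ (N : ℤ) ∣ p →
        ScarTower.twistedState N ψ w q k ≠ 0 →
        (∀ (p' : ℤ) (k' : ℝ), k' = 2 * Real.pi * p' / N → ¬ (N : ℤ) ∣ p' →
          ScarTower.twistedState N ψ w q k' ≠ 0 → |k - k'| < δ →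
          |ScarTower.energy N (ScarTower.hamiltonian N h) (ScarTower.twistedState N ψ w q k)
              - ScarTower.energy N (ScarTower.hamiltonian N h)
                  (ScarTower.twistedState N ψ w q k')| < η ∧
          |ScarTower.energyVariance N (ScarTower.hamiltonian N h)
                (ScarTower.twistedState N ψ w q k)
              - ScarTower.energyVariance N (ScarTower.hamiltonian N h)
                  (ScarTower.twistedState N ψ w q k')| < η) ∧
        (|k| < δ →
          |ScarTower.energy N (ScarTower.hamiltonian N h) (ScarTower.twistedState N ψ w q k)
              - E₀ N| < η ∧
          |ScarTower.energyVariance N (ScarTower.hamiltonian N h)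
              (ScarTower.twistedState N ψ w q k)| < η)) := by
  have hraise : ∀ a, ScarTower.IsRaising u T z a → a ∈ ScarTower.complexGenerators u :=
    fun a ha => ha.choose_spec.1.mem
  obtain ⟨f₁, f₂, hf₁, hf₂, n₀, hn₀⟩ :=
    ScarTower.exists_trigFamilies hψ.normalized hscar (hraise q hq)
  constructor
  · intro w hw
    have hw' : ScarTower.IsLabel u w := fun a ha => hraise a (hw a ha)
    obtain ⟨ε, v, h1, h2, h3, h4, h5⟩ := ScarTower.exists_limits_of_isTrigFamily hf₁ hf₂ hw'
    refine ⟨ε, v, h1, h2, h3, h4, fun η hη => ?_⟩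
    obtain ⟨n₁, hn₁⟩ := h5 η hη
    refine ⟨max n₀ n₁ + 1, fun N _ hN p k hk hp hne => ?_⟩
    -- The families are indexed by n with N = n + 1 sites, which accounts for the extra 1 in the
    -- threshold.
    obtain ⟨n, rfl⟩ := Nat.exists_eq_add_of_le' (show 1 ≤ N by omega)
    have hn : max n₀ n₁ ≤ n := by omega
    obtain ⟨e1, e2⟩ := hn₀ n (le_of_max_le_left hn) w hw' p k hk hp hne
    rw [e1, e2]
    exact hn₁ n (le_of_max_le_right hn) k
  · intro η hη
    obtain ⟨δ, hδ, n₁, hn₁⟩ := ScarTower.exists_modulus_of_isTrigFamily hf₁ hf₂ hη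
    refine ⟨δ, hδ, max n₀ n₁ + 1, fun N _ hN w hw p k hk hp hne => ?_⟩
    have hw' : ScarTower.IsLabel u w := fun a ha => hraise a (hw a ha)
    obtain ⟨n, rfl⟩ := Nat.exists_eq_add_of_le' (show 1 ≤ N by omega)
    have hn : max n₀ n₁ ≤ n := by omega
    obtain ⟨e1, e2⟩ := hn₀ n (le_of_max_le_left hn) w hw' p k hk hp hne
    obtain ⟨c1, c2⟩ := hn₁ n (le_of_max_le_right hn) w hw' k
    refine ⟨fun p' k' hk' hp' hne' hkk => ?_, fun hkδ => ?_⟩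
    · obtain ⟨e1', e2'⟩ := hn₀ n (le_of_max_le_left hn) w hw' p' k' hk' hp' hne'
      rw [← sub_sub_sub_cancel_right _ _ (E₀ (n + 1)), e1, e1', e2, e2']
      exact c1 k' hkk
    · rw [e1, e2]
      exact c2 hkδ
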